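/- Let $k\in\mathbb N$ and $\beta\in[0,1/2)$. There is a constant $C>0$, depending only on $k$ and $\beta$, with the following property. Let $a,h>0$ and $R=(0,h)\times(0,a)$. Let $\Gamma_1=\{0\}$ or $\Gamma_1=\{a\}$ be one of the two endpoints of $(0,a)$, let $\delta(x,y)=\operatorname{dist}((x,y),(0,h)\times\Gamma_1)$ (so $\delta(x,y)=y$, respectively $\delta(x,y)=a-y$, on $R$), and let $$w=c_1\delta^{\alpha_1}+\dots+c_k\delta^{\alpha_k},\qquad c_i\ge 0,\quad \alpha_i\in[0,\beta],\quad i=1,\dots,k.$$ Let $U=(u,v)\in H^1(R,\mathbb R^2)$ satisfy $u(x,0)=u(x,a)$ for $x\in(0,h)$ in the sense of traces, and let $e(U)=\frac12(\nabla U+\nabla U^T)$. Then $$\|w\nabla U\|_{L^2(R)}^2\le C\left(\frac{\|wu\|_{L^2(R)}\,\|we(U)\|_{L^2(R)}}{h}+\|we(U)\|_{L^2(R)}^2\right),$$ where matrices carry the Euclidean (Frobenius) norm. In particular $C$ does not depend on $h$, $a$, the coefficients $c_i$ or $U$. -/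

import Mathlib

open MeasureTheory Set Filter Topology
open scoped ContDiff

/-- The open rectangle `(0,h) × (0,a)`. -/
def rect (h a : ℝ) : Set (ℝ × ℝ) := Ioo 0 h ×ˢ Ioo 0 a

/-- `g` is the weak derivative of `u` in the direction `e` on the open set `Ω`. -/
def IsWeakDeriv (Ω : Set (ℝ × ℝ)) (e : ℝ × ℝ) (u g : ℝ × ℝ → ℝ) : Prop :=
  ∀ φ : ℝ × ℝ → ℝ, ContDiff ℝ ∞ φ → HasCompactSupport φ → tsupport φ ⊆ Ω →
    ∫ p in Ω, u p * fderiv ℝ φ p e = -∫ p in Ω, g p * φ p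

/-- `u ∈ H¹(Ω)`, with weak partial derivatives `ux` and `uy`. -/
structure IsSobolevH1 (Ω : Set (ℝ × ℝ)) (u ux uy : ℝ × ℝ → ℝ) : Prop where
  memLp : MemLp u 2 (volume.restrict Ω)
  memLp_dx : MemLp ux 2 (volume.restrict Ω)
  memLp_dy : MemLp uy 2 (volume.restrict Ω)
  weak_dx : IsWeakDeriv Ω (1, 0) u ux
  weak_dy : IsWeakDeriv Ω (0, 1) u uy

/-- `g ∈ L²(0,h)` is the trace, on the horizontal side `(0,h) × {s}` of `(0,h) × (0,a)`
(`s = 0` or `s = a`), of the `H¹` function `u` with weak partial derivatives `ux`, `uy`: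
the limit in `L²` of the restrictions of functions that are smooth up to the boundary and
converge to `u` in `H¹`. -/
def HasTraceOnSide (h a s : ℝ) (u ux uy : ℝ × ℝ → ℝ) (g : ℝ → ℝ) : Prop :=
  MemLp g 2 (volume.restrict (Ioo 0 h)) ∧
  ∃ φ : ℕ → ℝ × ℝ → ℝ, (∀ n, ContDiff ℝ ∞ (φ n)) ∧
    Tendsto (fun n => eLpNorm (fun p => φ n p - u p) 2 (volume.restrict (rect h a)))
      atTop (𝓝 0) ∧
    Tendsto (fun n => eLpNorm (fun p => fderiv ℝ (φ n) p (1, 0) - ux p) 2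
      (volume.restrict (rect h a))) atTop (𝓝 0) ∧
    Tendsto (fun n => eLpNorm (fun p => fderiv ℝ (φ n) p (0, 1) - uy p) 2
      (volume.restrict (rect h a))) atTop (𝓝 0) ∧
    Tendsto (fun n => eLpNorm (fun x => φ n (x, s) - g x) 2 (volume.restrict (Ioo 0 h)))
      atTop (𝓝 0)

noncomputable section

/-- The Euclidean distance from `p` to the segment `(0,h) × {s}`. -/
def sideDist (h s : ℝ) (p : ℝ × ℝ) : ℝ :=
  Metric.infDist (WithLp.toLp 2 p) (WithLp.toLp 2 '' (Ioo 0 h ×ˢ {s} : Set (ℝ × ℝ)))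

/-- The weight `w = ∑ᵢ cᵢ δ ^ αᵢ`, with `δ` the distance to `(0,h) × {s}`. -/
def sideWeight {k : ℕ} (h s : ℝ) (c α : Fin k → ℝ) (p : ℝ × ℝ) : ℝ :=
  ∑ i, c i * sideDist h s p ^ α i

/-- The `L²(Ω)` norm of a real function. -/
def l2norm (Ω : Set (ℝ × ℝ)) (f : ℝ × ℝ → ℝ) : ℝ := √(∫ p in Ω, f p ^ 2)

/-- The Frobenius (Euclidean) norm of a `2 × 2` matrix. -/
def frob (A : Matrix (Fin 2) (Fin 2) ℝ) : ℝ := √(∑ i, ∑ j, A i j ^ 2)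

/-- The gradient matrix of a displacement `(u, v)` with the given partial derivatives. -/
def gradMat (ux uy vx vy : ℝ × ℝ → ℝ) (p : ℝ × ℝ) : Matrix (Fin 2) (Fin 2) ℝ :=
  !![ux p, uy p; vx p, vy p]

/-- The symmetric part of a matrix. -/
def symPart (A : Matrix (Fin 2) (Fin 2) ℝ) : Matrix (Fin 2) (Fin 2) ℝ :=
  (1 / 2 : ℝ) • (A + A.transpose)

end

/-!
Since `e(U)` controls `uₓ`, `v_y` and `u_y + vₓ`, only `u_y` has to be bounded, and `v` enters
through the curl free field `(F, G) = (vₓ, v_y)` alone.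

If `u` vanishes on both horizontal sides, curl freeness can be tested with `m(x) V(y) u`, where `m`
is a cutoff near the right side. The left side is removed by passing to the doublings
`u(x, y) - 2 u(2x, y)`, `F(x, y) - 2 F(2x, y)` and `G(x, y) - G(2x, y)`: the first two transform
alike, hence so does `u_y + F`, and the new field can be tested with functions that need not vanish
at `x = 0`. For a concave weight `V` the integral of `V_y u u_y` equals that of `-V_yy u² / 2 ≥ 0`,
which absorbs the term `V_y u (u_y + F)` as soon as `V_y² ≤ K V (-V_yy)`. Squares of sums of powers
`y ^ α` with `0 ≤ α ≤ β < 1 / 2` have this property with `K` depending only on `β`.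

If `u` only has equal values on the horizontal sides, the folds `u(x, ζ y) - u(x, a - (1 - ζ) y)`
vanish on both of them. With `W = w²`, the fold at `ζ = 1 / 2` bounds the energy of `u_y` in the
upper half, for the reflected weight, by that in the lower half, and the fold at `ζ = 2 / 3` bounds
the energy in the lower two thirds by that in the upper third, for the weight `W(2 (a - y))`. As
`W(2y) ≤ 2 ^ (2β) W(y)` and `2 ^ (2β) < 2`, chaining the two bounds is a contraction up to the
desired right-hand side. A combination of four folded pieces then reaches the upper part of the
rectangle.
-/

/-- The classical partial derivative with respect to the first variable. -/
noncomputable abbrev pdx (f : ℝ × ℝ → ℝ) (p : ℝ × ℝ) : ℝ := fderiv ℝ f p (1, 0)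

/-- The classical partial derivative with respect to the second variable. -/
noncomputable abbrev pdy (f : ℝ × ℝ → ℝ) (p : ℝ × ℝ) : ℝ := fderiv ℝ f p (0, 1)

/-- The field `(F, G)` is curl free on `Ω` in the sense of distributions. -/
def CurlFree (Ω : Set (ℝ × ℝ)) (F G : ℝ × ℝ → ℝ) : Prop :=
  ∀ ψ : ℝ × ℝ → ℝ, ContDiff ℝ ∞ ψ → HasCompactSupport ψ → tsupport ψ ⊆ Ω →
    ∫ p in Ω, F p * pdy ψ p = ∫ p in Ω, G p * pdx ψ p

theorem contDiff_fderiv_apply {ψ : ℝ × ℝ → ℝ} (hψ : ContDiff ℝ ∞ ψ) (e : ℝ × ℝ) :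
    ContDiff ℝ ∞ (fun p => fderiv ℝ ψ p e) :=
  (hψ.fderiv_right (m := ∞) (by simp)).clm_apply contDiff_const

theorem continuousOn_fderiv_apply {S : Set (ℝ × ℝ)} {ψ : ℝ × ℝ → ℝ}
    (hψ : ∀ p ∈ S, ContDiffAt ℝ ∞ ψ p) (e : ℝ × ℝ) : ContinuousOn (fun p => fderiv ℝ ψ p e) S :=
  fun p hp => (((hψ p hp).fderiv_right (m := 0) (by simp)).continuousAt.clm_apply
    continuousAt_const).continuousWithinAt

theorem pdx_pdy_comm {ψ : ℝ × ℝ → ℝ} (hψ : ContDiff ℝ ∞ ψ) (p : ℝ × ℝ) :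
    pdx (pdy ψ) p = pdy (pdx ψ) p := by
  have hs : IsSymmSndFDerivAt ℝ ψ p := hψ.contDiffAt.isSymmSndFDerivAt (by
    rw [minSmoothness_of_isRCLikeNormedField]
    exact WithTop.coe_le_coe.2 (le_top : (2 : ℕ∞) ≤ ⊤))
  have hd : DifferentiableAt ℝ (fderiv ℝ ψ) p :=
    ((hψ.fderiv_right (m := ∞) (by simp)).differentiable (by simp)) p
  have hsecond (e e' : ℝ × ℝ) : fderiv ℝ (fun q => fderiv ℝ ψ q e) p e' =
      fderiv ℝ (fderiv ℝ ψ) p e' e := by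
    rw [fderiv_clm_apply hd (differentiableAt_const _)]
    simp
  rw [pdx, pdy, hsecond, hsecond]
  exact hs _ _

theorem IsSobolevH1.curlFree {Ω : Set (ℝ × ℝ)} {v vx vy : ℝ × ℝ → ℝ}
    (hv : IsSobolevH1 Ω v vx vy) : CurlFree Ω vx vy := by
  intro ψ hψ hc hs
  have hcs (e : ℝ × ℝ) : HasCompactSupport (fun p => fderiv ℝ ψ p e) :=
    hc.of_isClosed_subset (isClosed_tsupport _) (tsupport_fderiv_apply_subset ℝ e)
  have hx := hv.weak_dx (pdy ψ) (contDiff_fderiv_apply hψ _) (hcs _)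
    ((tsupport_fderiv_apply_subset ℝ _).trans hs)
  have hy := hv.weak_dy (pdx ψ) (contDiff_fderiv_apply hψ _) (hcs _)
    ((tsupport_fderiv_apply_subset ℝ _).trans hs)
  have hcomm (p : ℝ × ℝ) : fderiv ℝ (pdy ψ) p (1, 0) = fderiv ℝ (pdx ψ) p (0, 1) :=
    pdx_pdy_comm hψ p
  simp only [hcomm] at hx
  exact (neg_injective (hy.symm.trans hx)).symm

/-! ### Test functions that only vanish on the boundary -/

theorem deriv_smoothTransition_of_neg {t : ℝ} (ht : t < 0) :
    deriv Real.smoothTransition t = 0 := by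
  have : Real.smoothTransition =ᶠ[𝓝 t] fun _ => 0 := by
    filter_upwards [Iio_mem_nhds ht] with s hs
    exact Real.smoothTransition.zero_of_nonpos (le_of_lt hs)
  rw [this.deriv_eq, deriv_const]

theorem deriv_smoothTransition_of_one_lt {t : ℝ} (ht : 1 < t) :
    deriv Real.smoothTransition t = 0 := by
  have : Real.smoothTransition =ᶠ[𝓝 t] fun _ => 1 := by
    filter_upwards [Ioi_mem_nhds ht] with s hs
    exact Real.smoothTransition.one_of_one_le (le_of_lt hs)
  rw [this.deriv_eq, deriv_const]

theorem exists_bound_deriv_smoothTransition :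
    ∃ M : ℝ, 0 < M ∧ ∀ t, |deriv Real.smoothTransition t| ≤ M := by
  have hc : Continuous (deriv Real.smoothTransition) :=
    (Real.smoothTransition.contDiff (n := 1)).continuous_deriv le_rfl
  obtain ⟨C, hC⟩ := (isCompact_Icc (a := (0 : ℝ)) (b := 1)).exists_bound_of_continuousOn
    hc.continuousOn
  refine ⟨max C 1, by positivity, fun t => ?_⟩
  rcases lt_or_ge t 0 with h | h
  · rw [deriv_smoothTransition_of_neg h, abs_zero]
    positivity
  rcases lt_or_ge 1 t with h' | h'
  · rw [deriv_smoothTransition_of_one_lt h', abs_zero]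
    positivity
  · exact (hC t ⟨h, h'⟩).trans (le_max_left _ _)

/-- A smooth soft threshold: it vanishes for `|t| ≤ 1` and is the identity for `t ^ 2 ≥ 2`. Its
rescalings `ε * softThreshold (t / ε)` cut small values off without increasing the order of the
derivative. -/
noncomputable def softThreshold (t : ℝ) : ℝ := t * Real.smoothTransition (t ^ 2 - 1)

theorem contDiff_softThreshold : ContDiff ℝ ∞ softThreshold :=
  contDiff_id.mul (Real.smoothTransition.contDiff.comp (by fun_prop))

theorem softThreshold_eq_zero {t : ℝ} (ht : |t| ≤ 1) : softThreshold t = 0 := by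
  rw [softThreshold, Real.smoothTransition.zero_of_nonpos, mul_zero]
  nlinarith [sq_abs t, abs_nonneg t]

theorem deriv_softThreshold_of_lt {t : ℝ} (ht : 2 < |t|) : deriv softThreshold t = 1 := by
  have : softThreshold =ᶠ[𝓝 t] id := by
    filter_upwards [(continuous_abs.tendsto t).eventually (lt_mem_nhds ht)] with s hs
    rw [softThreshold, Real.smoothTransition.one_of_one_le, mul_one, id]
    nlinarith [sq_abs s]
  rw [this.deriv_eq, deriv_id]

theorem exists_bound_deriv_softThreshold : ∃ M : ℝ, ∀ t, |deriv softThreshold t| ≤ M := by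
  have hc : Continuous (deriv softThreshold) := contDiff_softThreshold.continuous_deriv (by simp)
  obtain ⟨C, hC⟩ := (isCompact_Icc (a := (-2 : ℝ)) (b := 2)).exists_bound_of_continuousOn
    hc.continuousOn
  refine ⟨max C 1, fun t => ?_⟩
  rcases lt_or_ge 2 |t| with h | h
  · rw [deriv_softThreshold_of_lt h, abs_one]
    exact le_max_right _ _
  · exact (hC t (abs_le.1 h)).trans (le_max_left _ _)

theorem ae_fderiv_apply_eq_zero_of_eq_zero {E : Type*} [NormedAddCommGroup E] [NormedSpace ℝ E]
    [FiniteDimensional ℝ E] [MeasurableSpace E] [BorelSpace E] {μ : Measure E}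
    [μ.IsAddHaarMeasure] {Ω : Set E} (hΩ : IsOpen Ω) {f : E → ℝ} (hf : DifferentiableOn ℝ f Ω)
    (e : E) : ∀ᵐ p ∂μ, p ∈ Ω → f p = 0 → fderiv ℝ f p e = 0 := by
  let Z : Set E := (Ω ∩ f ⁻¹' {0}) ∩ {p | fderiv ℝ f p e ≠ 0}
  have hZ : MeasurableSet Z := by
    have hdiff : Ω ∩ f ⁻¹' {0} = Ω \ (Ω ∩ f ⁻¹' {0}ᶜ) := by
      ext p; by_cases hp : f p = 0 <;> simp [hp]
    rw [show Z = _ from congrArg (· ∩ {p | fderiv ℝ f p e ≠ 0}) hdiff]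
    exact (hΩ.measurableSet.diff (hf.continuousOn.isOpen_inter_preimage hΩ
      isOpen_compl_singleton).measurableSet).inter
      (measurable_fderiv_apply_const ℝ f e (measurableSet_singleton 0).compl)
  -- on each line in direction `e`, the points of `Z` are isolated, hence countable
  have hline (p : E) : {t : ℝ | p + t • e ∈ Z}.Countable := by
    have : DiscreteTopology {t : ℝ | p + t • e ∈ Z} := by
      refine discreteTopology_of_noAccPts fun t ht hacc => ?_
      have hderiv : HasDerivAt (fun t : ℝ => f (p + t • e)) (fderiv ℝ f (p + t • e) e) t :=
        ((hf.differentiableAt (hΩ.mem_nhds ht.1.1)).hasFDerivAt.comp_hasDerivAt t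
          (((hasDerivAt_id t).smul_const e).const_add p)).congr_deriv (by simp)
      obtain ⟨s, hs, hs0⟩ := ((accPt_iff_frequently_nhdsNE.1 hacc).and_eventually
        (hderiv.eventually_ne ht.2 (c := 0))).exists
      exact hs0 hs.1.2
    exact countable_coe_iff.1 (TopologicalSpace.separableSpace_iff_countable.1 inferInstance)
  have hae : ∀ᵐ p ∂μ, p ∈ Zᶜ := by
    refine ae_mem_of_ae_add_linearMap_mem ((LinearMap.id : ℝ →ₗ[ℝ] ℝ).smulRight e) volume μ
      hZ.compl fun p => ?_
    filter_upwards [(hline p).ae_notMem volume] with t ht using ht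
  filter_upwards [hae] with p hp hpΩ h0
  by_contra hne
  exact hp ⟨⟨hpΩ, h0⟩, hne⟩

/-- The smooth truncation `ψ ↦ ε softThreshold (ψ / ε)` with `ε = 1 / (n + 1)`, extended by zero
outside `Ω`. It turns a function vanishing on the boundary of `Ω` into one supported in `Ω`. -/
noncomputable def truncation (Ω : Set (ℝ × ℝ)) (ψ : ℝ × ℝ → ℝ) (n : ℕ) : ℝ × ℝ → ℝ :=
  Ω.indicator fun p => (n + 1 : ℝ)⁻¹ * softThreshold ((n + 1) * ψ p)

section Truncation

variable {Ω : Set (ℝ × ℝ)} {ψ : ℝ × ℝ → ℝ}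

theorem tsupport_truncation_subset (hψ : ContinuousOn ψ (closure Ω))
    (h0 : ∀ p ∈ frontier Ω, ψ p = 0) (n : ℕ) : tsupport (truncation Ω ψ n) ⊆ Ω := by
  have hclosed : IsClosed (closure Ω ∩ ψ ⁻¹' {t | 1 ≤ |(n + 1 : ℝ) * t|}) :=
    hψ.preimage_isClosed_of_isClosed isClosed_closure
      (isClosed_le continuous_const (by fun_prop))
  have hsupp : Function.support (truncation Ω ψ n) ⊆
      closure Ω ∩ ψ ⁻¹' {t | 1 ≤ |(n + 1 : ℝ) * t|} := by
    intro p hp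
    have hpΩ : p ∈ Ω := by
      by_contra h
      exact hp (indicator_of_notMem h _)
    have hlarge : (1 : ℝ) ≤ |(n + 1 : ℝ) * ψ p| := by
      by_contra! hlt
      refine hp ?_
      rw [truncation, indicator_of_mem hpΩ, softThreshold_eq_zero hlt.le, mul_zero]
    exact ⟨subset_closure hpΩ, hlarge⟩
  refine (closure_minimal hsupp hclosed).trans fun p hp => ?_
  by_contra hpΩ
  have : (1 : ℝ) ≤ |(n + 1 : ℝ) * ψ p| := hp.2
  rw [h0 p ⟨hp.1, fun h => hpΩ (interior_subset h)⟩, mul_zero, abs_zero] at this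
  exact absurd this (by norm_num)

theorem truncation_eventuallyEq (hΩ : IsOpen Ω) {p : ℝ × ℝ} (hp : p ∈ Ω) (n : ℕ) :
    truncation Ω ψ n =ᶠ[𝓝 p] fun q => (n + 1 : ℝ)⁻¹ * softThreshold ((n + 1) * ψ q) := by
  filter_upwards [hΩ.mem_nhds hp] with q hq
  exact indicator_of_mem hq _

theorem contDiff_truncation (hΩ : IsOpen Ω) (hψ : ∀ p ∈ closure Ω, ContDiffAt ℝ ∞ ψ p)
    (h0 : ∀ p ∈ frontier Ω, ψ p = 0) (n : ℕ) : ContDiff ℝ ∞ (truncation Ω ψ n) := by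
  refine contDiff_iff_contDiffAt.2 fun p => ?_
  by_cases hp : p ∈ tsupport (truncation Ω ψ n)
  · have hpΩ := tsupport_truncation_subset
      (fun q hq => (hψ q hq).continuousAt.continuousWithinAt) h0 n hp
    exact (contDiffAt_const.mul (contDiff_softThreshold.contDiffAt.comp p
      (contDiffAt_const.mul (hψ p (subset_closure hpΩ))))).congr_of_eventuallyEq
      (truncation_eventuallyEq hΩ hpΩ n)
  · exact contDiffAt_const.congr_of_eventuallyEq (notMem_tsupport_iff_eventuallyEq.1 hp)

theorem fderiv_truncation (hΩ : IsOpen Ω) (hψ : DifferentiableOn ℝ ψ Ω) {p : ℝ × ℝ} (hp : p ∈ Ω)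
    (n : ℕ) (e : ℝ × ℝ) : fderiv ℝ (truncation Ω ψ n) p e =
      deriv softThreshold ((n + 1) * ψ p) * fderiv ℝ ψ p e := by
  have hinner := ((hψ.differentiableAt (hΩ.mem_nhds hp)).hasFDerivAt).const_mul (n + 1 : ℝ)
  have houter := ((contDiff_softThreshold.differentiable (by simp) _).hasDerivAt.comp_hasFDerivAt
    p hinner).const_mul (n + 1 : ℝ)⁻¹
  rw [(houter.congr_of_eventuallyEq (truncation_eventuallyEq hΩ hp n)).fderiv]
  simp only [smul_apply, smul_eq_mul]
  field_simp

theorem tendsto_deriv_softThreshold {t : ℝ} (ht : t ≠ 0) :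
    Tendsto (fun n : ℕ => deriv softThreshold ((n + 1) * t)) atTop (𝓝 1) := by
  have hlarge : Tendsto (fun n : ℕ => (n + 1 : ℝ) * |t|) atTop atTop :=
    (tendsto_atTop_add_const_right _ _ tendsto_natCast_atTop_atTop).atTop_mul_const (abs_pos.2 ht)
  refine tendsto_const_nhds.congr' ?_
  filter_upwards [hlarge.eventually_gt_atTop 2] with n hn
  refine (deriv_softThreshold_of_lt ?_).symm
  rwa [abs_mul, abs_of_pos (by positivity : (0 : ℝ) < n + 1)]

-- The derivative of the truncation only fails to converge to that of `ψ` where `ψ` vanishes and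
-- its derivative does not, which is a null set.
theorem tendsto_integral_mul_fderiv_truncation (hΩ : IsOpen Ω) (hψ : DifferentiableOn ℝ ψ Ω)
    {H : ℝ × ℝ → ℝ} {e : ℝ × ℝ} (hH : IntegrableOn (fun p => H p * fderiv ℝ ψ p e) Ω) :
    Tendsto (fun n => ∫ p in Ω, H p * fderiv ℝ (truncation Ω ψ n) p e) atTop
      (𝓝 (∫ p in Ω, H p * fderiv ℝ ψ p e)) := by
  obtain ⟨M, hM⟩ := exists_bound_deriv_softThreshold
  have hformula (n : ℕ) : ∫ p in Ω, H p * fderiv ℝ (truncation Ω ψ n) p e =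
      ∫ p in Ω, deriv softThreshold ((n + 1) * ψ p) * (H p * fderiv ℝ ψ p e) :=
    setIntegral_congr_fun hΩ.measurableSet fun p hp => by
      simp only [fderiv_truncation hΩ hψ hp]; ring
  simp only [hformula]
  have hcont : Continuous (deriv softThreshold) := contDiff_softThreshold.continuous_deriv (by simp)
  refine tendsto_integral_of_dominated_convergence (fun p => M * |H p * fderiv ℝ ψ p e|)
    (fun n => ?_) (hH.abs.const_mul M) (fun n => ?_) ?_
  · exact ((hcont.comp_continuousOn (continuousOn_const.mul
      hψ.continuousOn)).aestronglyMeasurable hΩ.measurableSet).mul hH.aestronglyMeasurable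
  · refine Eventually.of_forall fun p => ?_
    rw [Real.norm_eq_abs, abs_mul]
    gcongr
    exact hM _
  · refine (ae_restrict_iff' hΩ.measurableSet).2 ?_
    filter_upwards [ae_fderiv_apply_eq_zero_of_eq_zero (μ := volume) hΩ hψ e] with p hp hpΩ
    by_cases h0 : ψ p = 0
    · simp only [hp hpΩ h0, mul_zero, tendsto_const_nhds_iff]
    · simpa using (tendsto_deriv_softThreshold h0).mul_const (H p * fderiv ℝ ψ p e)

theorem CurlFree.integral_eq_of_frontier_eq_zero {F G : ℝ × ℝ → ℝ} (hΩ : IsOpen Ω)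
    (hcomp : IsCompact (closure Ω)) (hc : CurlFree Ω F G) (hF : IntegrableOn F Ω)
    (hG : IntegrableOn G Ω) (hψ : ∀ p ∈ closure Ω, ContDiffAt ℝ ∞ ψ p)
    (h0 : ∀ p ∈ frontier Ω, ψ p = 0) :
    ∫ p in Ω, F p * pdy ψ p = ∫ p in Ω, G p * pdx ψ p := by
  have hdiff : DifferentiableOn ℝ ψ Ω := fun p hp =>
    ((hψ p (subset_closure hp)).differentiableAt (by simp)).differentiableWithinAt
  have hint {H : ℝ × ℝ → ℝ} (hH : IntegrableOn H Ω) (e : ℝ × ℝ) :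
      IntegrableOn (fun p => H p * fderiv ℝ ψ p e) Ω := by
    have hcont := continuousOn_fderiv_apply hψ e
    obtain ⟨C, hC⟩ := hcomp.exists_bound_of_continuousOn hcont
    exact hH.mul_bdd ((hcont.mono subset_closure).aestronglyMeasurable hΩ.measurableSet)
      ((ae_restrict_iff' hΩ.measurableSet).2
        (Eventually.of_forall fun p hp => hC p (subset_closure hp)))
  have hsub := tsupport_truncation_subset
    (fun q hq => (hψ q hq).continuousAt.continuousWithinAt) h0
  refine tendsto_nhds_unique (tendsto_integral_mul_fderiv_truncation hΩ hdiff (hint hF _))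
    ((tendsto_integral_mul_fderiv_truncation hΩ hdiff (hint hG _)).congr fun n => ?_)
  exact (hc _ (contDiff_truncation hΩ hψ h0 n) (hcomp.of_isClosed_subset (isClosed_tsupport _)
    ((hsub n).trans subset_closure)) (hsub n)).symm

end Truncation

/-! ### Diagonal affine changes of variables -/

/-- The map `(x, y) ↦ (σ x + τ, t y + s)`, a common form for the doubling in `x`, the reflections
and the vertical rescalings. -/
def diagAffine (σ τ t s : ℝ) (p : ℝ × ℝ) : ℝ × ℝ := (σ * p.1 + τ, t * p.2 + s)

theorem contDiff_diagAffine (σ τ t s : ℝ) : ContDiff ℝ ∞ (diagAffine σ τ t s) := by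
  unfold diagAffine; fun_prop

theorem hasFDerivAt_diagAffine (σ τ t s : ℝ) (p : ℝ × ℝ) :
    HasFDerivAt (diagAffine σ τ t s)
      ((σ • ContinuousLinearMap.fst ℝ ℝ ℝ).prod (t • ContinuousLinearMap.snd ℝ ℝ ℝ)) p :=
  ((hasFDerivAt_fst.const_mul σ).add_const τ).prodMk ((hasFDerivAt_snd.const_mul t).add_const s)

section DiagAffine

variable {σ τ t s : ℝ}

theorem fderiv_comp_diagAffine {f : ℝ × ℝ → ℝ} {p : ℝ × ℝ}
    (hf : DifferentiableAt ℝ f (diagAffine σ τ t s p)) (e : ℝ × ℝ) :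
    fderiv ℝ (fun q => f (diagAffine σ τ t s q)) p e =
      fderiv ℝ f (diagAffine σ τ t s p) (σ * e.1, t * e.2) :=
  congrArg (· e) (hf.hasFDerivAt.comp p (hasFDerivAt_diagAffine σ τ t s p)).fderiv

theorem pdx_comp_diagAffine {f : ℝ × ℝ → ℝ} {p : ℝ × ℝ}
    (hf : DifferentiableAt ℝ f (diagAffine σ τ t s p)) :
    pdx (fun q => f (diagAffine σ τ t s q)) p = σ * pdx f (diagAffine σ τ t s p) := by
  have he : ((σ * 1, t * 0) : ℝ × ℝ) = σ • (1, 0) := by simp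
  rw [pdx, fderiv_comp_diagAffine hf, he, map_smul, smul_eq_mul]

theorem pdy_comp_diagAffine {f : ℝ × ℝ → ℝ} {p : ℝ × ℝ}
    (hf : DifferentiableAt ℝ f (diagAffine σ τ t s p)) :
    pdy (fun q => f (diagAffine σ τ t s q)) p = t * pdy f (diagAffine σ τ t s p) := by
  have he : ((σ * 0, t * 1) : ℝ × ℝ) = t • (0, 1) := by simp
  rw [pdy, fderiv_comp_diagAffine hf, he, map_smul, smul_eq_mul]

/-- `diagAffine` as a homeomorphism of the plane. -/
noncomputable def diagAffineHomeomorph (hσ : σ ≠ 0) (ht : t ≠ 0) (τ s : ℝ) :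
    (ℝ × ℝ) ≃ₜ (ℝ × ℝ) where
  toFun := diagAffine σ τ t s
  invFun := diagAffine σ⁻¹ (-σ⁻¹ * τ) t⁻¹ (-t⁻¹ * s)
  left_inv p := by ext <;> simp only [diagAffine] <;> field_simp <;> ring
  right_inv p := by ext <;> simp only [diagAffine] <;> field_simp <;> ring
  continuous_toFun := (contDiff_diagAffine σ τ t s).continuous
  continuous_invFun := (contDiff_diagAffine _ _ _ _).continuous

theorem measurableEmbedding_diagAffine (hσ : σ ≠ 0) (ht : t ≠ 0) (τ s : ℝ) :
    MeasurableEmbedding (diagAffine σ τ t s) :=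
  (diagAffineHomeomorph hσ ht τ s).measurableEmbedding

theorem map_volume_affine (hσ : σ ≠ 0) (τ : ℝ) :
    Measure.map (fun x : ℝ => σ * x + τ) volume = ENNReal.ofReal |σ⁻¹| • volume := by
  rw [show (fun x : ℝ => σ * x + τ) = (fun x => x + τ) ∘ (fun x => σ * x) from rfl,
    ← Measure.map_map (by fun_prop) (by fun_prop), Real.map_volume_mul_left hσ,
    Measure.map_smul, map_add_right_eq_self]

theorem map_volume_diagAffine (hσ : σ ≠ 0) (ht : t ≠ 0) (τ s : ℝ) :
    Measure.map (diagAffine σ τ t s) volume = ENNReal.ofReal |(σ * t)⁻¹| • volume := by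
  rw [show diagAffine σ τ t s = Prod.map (fun x => σ * x + τ) (fun y => t * y + s) from rfl,
    Measure.volume_eq_prod, ← Measure.map_prod_map _ _ (by fun_prop) (by fun_prop),
    map_volume_affine hσ, map_volume_affine ht, Measure.prod_smul_left, Measure.prod_smul_right,
    smul_smul, ← ENNReal.ofReal_mul (abs_nonneg _), ← abs_mul, mul_inv]

theorem setIntegral_comp_diagAffine (hσ : σ ≠ 0) (ht : t ≠ 0) (τ s : ℝ)
    (f : ℝ × ℝ → ℝ) (S : Set (ℝ × ℝ)) :
    ∫ p in diagAffine σ τ t s ⁻¹' S, f (diagAffine σ τ t s p) = |(σ * t)⁻¹| * ∫ p in S, f p := by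
  rw [← (measurableEmbedding_diagAffine hσ ht τ s).setIntegral_map, map_volume_diagAffine hσ ht,
    Measure.restrict_smul, integral_smul_measure, ENNReal.toReal_ofReal (abs_nonneg _), smul_eq_mul]

theorem memLp_comp_diagAffine (hσ : σ ≠ 0) (ht : t ≠ 0) (τ s : ℝ) {q : ENNReal}
    {f : ℝ × ℝ → ℝ} {S Q : Set (ℝ × ℝ)}
    (hf : MemLp f q (volume.restrict S)) (hQ : MapsTo (diagAffine σ τ t s) Q S) :
    MemLp (fun p => f (diagAffine σ τ t s p)) q (volume.restrict Q) := by
  have he := measurableEmbedding_diagAffine hσ ht τ s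
  have hmap : MemLp f q ((Measure.map (diagAffine σ τ t s) volume).restrict S) := by
    rw [map_volume_diagAffine hσ ht, Measure.restrict_smul]
    exact hf.smul_measure ENNReal.ofReal_ne_top
  rw [he.restrict_map, he.memLp_map_measure_iff] at hmap
  exact hmap.mono_measure (Measure.restrict_mono hQ le_rfl)

theorem integrableOn_comp_diagAffine (hσ : σ ≠ 0) (ht : t ≠ 0) (τ s : ℝ)
    {f : ℝ × ℝ → ℝ} {S Q : Set (ℝ × ℝ)}
    (hf : IntegrableOn f S) (hQ : MapsTo (diagAffine σ τ t s) Q S) :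
    IntegrableOn (fun p => f (diagAffine σ τ t s p)) Q :=
  memLp_one_iff_integrable.1
    (memLp_comp_diagAffine hσ ht τ s (memLp_one_iff_integrable.2 hf) hQ)

theorem setIntegral_comp_diagAffine_le (hσ : σ ≠ 0) (ht : t ≠ 0) (τ s : ℝ)
    {f : ℝ × ℝ → ℝ} {S Q : Set (ℝ × ℝ)} (hS : MeasurableSet S)
    (hf : IntegrableOn f S) (hf0 : ∀ p ∈ S, 0 ≤ f p) (hQ : MapsTo (diagAffine σ τ t s) Q S) :
    ∫ p in Q, f (diagAffine σ τ t s p) ≤ |(σ * t)⁻¹| * ∫ p in S, f p := by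
  rw [← setIntegral_comp_diagAffine hσ ht τ s f S]
  have hm : MeasurableSet (diagAffine σ τ t s ⁻¹' S) :=
    (contDiff_diagAffine σ τ t s).continuous.measurable hS
  exact setIntegral_mono_set (integrableOn_comp_diagAffine hσ ht τ s hf fun _ h => h)
    ((ae_restrict_iff' hm).2 (Eventually.of_forall fun p hp => hf0 _ hp))
    (Eventually.of_forall hQ)

theorem setIntegral_mul_of_tsupport_subset {Ω : Set (ℝ × ℝ)} (F ψ : ℝ × ℝ → ℝ) (e : ℝ × ℝ)
    (hs : tsupport ψ ⊆ Ω) : ∫ p in Ω, F p * fderiv ℝ ψ p e = ∫ p, F p * fderiv ℝ ψ p e := by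
  refine setIntegral_eq_integral_of_forall_compl_eq_zero fun p hp => ?_
  have hzero : fderiv ℝ ψ p e = 0 := by
    by_contra hne
    exact hp (hs (tsupport_fderiv_apply_subset ℝ e (subset_tsupport _ hne)))
  rw [hzero, mul_zero]

theorem CurlFree.comp_diagAffine {Ω Ω' : Set (ℝ × ℝ)} {F G : ℝ × ℝ → ℝ} (hc : CurlFree Ω F G)
    (hσ : σ ≠ 0) (ht : t ≠ 0) (τ s : ℝ) (hΩ : MapsTo (diagAffine σ τ t s) Ω' Ω) :
    CurlFree Ω' (fun p => t * F (diagAffine σ τ t s p))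
      (fun p => t ^ 2 / σ * G (diagAffine σ τ t s p)) := by
  intro ψ hψ hcs hsub
  set Φ := diagAffineHomeomorph hσ ht τ s
  let χ : ℝ × ℝ → ℝ := fun q => ψ (Φ.symm q)
  have hχ : ContDiff ℝ ∞ χ := hψ.comp (contDiff_diagAffine _ _ _ _)
  have hψχ : ψ = fun p => χ (Φ p) := by simp [χ]
  have hχsub : tsupport χ ⊆ Ω := by
    intro q hq
    have hq' : Φ.symm q ∈ tsupport ψ :=
      closure_minimal (t := Φ.symm ⁻¹' tsupport ψ) (fun _ h => subset_tsupport _ h)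
        ((isClosed_tsupport ψ).preimage Φ.symm.continuous) hq
    exact Φ.apply_symm_apply q ▸ hΩ (hsub hq')
  have key : ∫ q, F q * pdy χ q = ∫ q, G q * pdx χ q := by
    rw [← setIntegral_mul_of_tsupport_subset F χ _ hχsub,
      ← setIntegral_mul_of_tsupport_subset G χ _ hχsub]
    exact hc χ hχ (hcs.comp_homeomorph Φ.symm) hχsub
  have hdiff (p : ℝ × ℝ) : DifferentiableAt ℝ χ (Φ p) := hχ.differentiable (by simp) _
  have hy (p : ℝ × ℝ) : t * F (Φ p) * pdy ψ p = t ^ 2 * (F (Φ p) * pdy χ (Φ p)) := by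
    have : pdy ψ p = t * pdy χ (Φ p) := by rw [hψχ]; exact pdy_comp_diagAffine (hdiff p)
    rw [this]; ring
  have hx (p : ℝ × ℝ) : t ^ 2 / σ * G (Φ p) * pdx ψ p = t ^ 2 * (G (Φ p) * pdx χ (Φ p)) := by
    have : pdx ψ p = σ * pdx χ (Φ p) := by rw [hψχ]; exact pdx_comp_diagAffine (hdiff p)
    rw [this]; field_simp
  have hchange (f : ℝ × ℝ → ℝ) : ∫ p, f (Φ p) = |(σ * t)⁻¹| * ∫ q, f q := by
    have huniv := setIntegral_comp_diagAffine hσ ht τ s f univ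
    rwa [preimage_univ, Measure.restrict_univ] at huniv
  rw [setIntegral_mul_of_tsupport_subset _ _ _ hsub,
    setIntegral_mul_of_tsupport_subset _ _ _ hsub]
  change ∫ p, t * F (Φ p) * pdy ψ p = ∫ p, t ^ 2 / σ * G (Φ p) * pdx ψ p
  simp only [hy, hx]
  rw [integral_const_mul, integral_const_mul, hchange fun q => F q * pdy χ q,
    hchange fun q => G q * pdx χ q, key]

end DiagAffine

theorem integrableOn_mul_fderiv {Ω : Set (ℝ × ℝ)} {F ψ : ℝ × ℝ → ℝ} (hF : IntegrableOn F Ω)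
    (hψ : ContDiff ℝ ∞ ψ) (hcs : HasCompactSupport ψ) (e : ℝ × ℝ) :
    IntegrableOn (fun p => F p * fderiv ℝ ψ p e) Ω := by
  have hc := (contDiff_fderiv_apply hψ e).continuous
  have hk : HasCompactSupport (fun p => fderiv ℝ ψ p e) :=
    hcs.of_isClosed_subset (isClosed_tsupport _) (tsupport_fderiv_apply_subset ℝ e)
  obtain ⟨C, hC⟩ := hk.exists_bound_of_continuous hc
  exact Integrable.mul_bdd hF hc.aestronglyMeasurable (Eventually.of_forall hC)

theorem CurlFree.sum {Ω : Set (ℝ × ℝ)} {ι : Type*} (I : Finset ι) {F G : ι → ℝ × ℝ → ℝ} (μ : ι → ℝ)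
    (hF : ∀ i ∈ I, IntegrableOn (F i) Ω) (hG : ∀ i ∈ I, IntegrableOn (G i) Ω)
    (hc : ∀ i ∈ I, CurlFree Ω (F i) (G i)) :
    CurlFree Ω (fun p => ∑ i ∈ I, μ i * F i p) (fun p => ∑ i ∈ I, μ i * G i p) := by
  intro ψ hψ hcs hsub
  simp only [Finset.sum_mul, mul_assoc]
  rw [integral_finsetSum I fun i hi => (integrableOn_mul_fderiv (hF i hi) hψ hcs _).const_mul _,
    integral_finsetSum I fun i hi => (integrableOn_mul_fderiv (hG i hi) hψ hcs _).const_mul _]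
  refine Finset.sum_congr rfl fun i hi => ?_
  rw [integral_const_mul, integral_const_mul, hc i hi ψ hψ hcs hsub]

/-! ### Integration on rectangles -/

theorem measurableSet_rect (h a : ℝ) : MeasurableSet (rect h a) :=
  measurableSet_Ioo.prod measurableSet_Ioo

theorem isOpen_rect (h a : ℝ) : IsOpen (rect h a) := isOpen_Ioo.prod isOpen_Ioo

theorem rect_subset_Icc (h a : ℝ) : rect h a ⊆ Icc 0 h ×ˢ Icc 0 a :=
  prod_mono Ioo_subset_Icc_self Ioo_subset_Icc_self

theorem rect_mono {h h' a : ℝ} (hh : h ≤ h') : rect h a ⊆ rect h' a :=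
  prod_mono (Ioo_subset_Ioo_right hh) subset_rfl

theorem closure_rect {h a : ℝ} (hh : 0 < h) (ha : 0 < a) :
    closure (rect h a) = Icc 0 h ×ˢ Icc 0 a := by
  rw [rect, closure_prod_eq, closure_Ioo hh.ne, closure_Ioo ha.ne]

theorem eq_or_eq_of_mem_frontier_rect {h a : ℝ} (hh : 0 < h) (ha : 0 < a) {p : ℝ × ℝ}
    (hp : p ∈ frontier (rect h a)) : p.1 = 0 ∨ p.1 = h ∨ p.2 = 0 ∨ p.2 = a := by
  rw [(isOpen_rect h a).frontier_eq, closure_rect hh ha] at hp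
  obtain ⟨⟨⟨h1, h2⟩, h3, h4⟩, hout⟩ := hp
  by_contra! hne
  exact hout ⟨⟨h1.lt_of_ne' hne.1, h2.lt_of_ne hne.2.1⟩,
    ⟨h3.lt_of_ne' hne.2.2.1, h4.lt_of_ne hne.2.2.2⟩⟩

instance isFiniteMeasure_restrict_rect (h a : ℝ) :
    IsFiniteMeasure (volume.restrict (rect h a)) := by
  constructor
  rw [Measure.restrict_apply_univ]
  exact (measure_mono (rect_subset_Icc h a)).trans_lt
    (isCompact_Icc.prod isCompact_Icc).measure_lt_top

theorem ae_restrict_rect {h a : ℝ} {P : ℝ × ℝ → Prop} (hP : ∀ p ∈ rect h a, P p) :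
    ∀ᵐ p ∂(volume.restrict (rect h a)), P p :=
  (ae_restrict_iff' (measurableSet_rect h a)).2 (Eventually.of_forall hP)

theorem setIntegral_union_le {α : Type*} [MeasurableSpace α] {μ : Measure α} {S T : Set α}
    {f : α → ℝ} (hS : MeasurableSet S) (hT : MeasurableSet T) (hfS : IntegrableOn f S μ)
    (hfT : IntegrableOn f T μ) (h0 : ∀ p ∈ T, 0 ≤ f p) :
    ∫ p in S ∪ T, f p ∂μ ≤ (∫ p in S, f p ∂μ) + ∫ p in T, f p ∂μ := by
  rw [← union_sdiff_self, setIntegral_union disjoint_sdiff_right (hT.diff hS) hfS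
    (hfT.mono_set sdiff_subset)]
  exact add_le_add le_rfl (setIntegral_mono_set hfT
    ((ae_restrict_iff' hT).2 (Eventually.of_forall h0)) (Eventually.of_forall fun p hp => hp.1))

theorem setIntegral_mono_subset {α : Type*} [MeasurableSpace α] {μ : Measure α} {S T : Set α}
    {f : α → ℝ} (hST : S ⊆ T) (hT : MeasurableSet T) (hf : IntegrableOn f T μ)
    (h0 : ∀ p ∈ T, 0 ≤ f p) : ∫ p in S, f p ∂μ ≤ ∫ p in T, f p ∂μ :=
  setIntegral_mono_set hf ((ae_restrict_iff' hT).2 (Eventually.of_forall h0))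
    (Eventually.of_forall hST)

theorem integral_mul_le_sqrt_mul_sqrt {α : Type*} [MeasurableSpace α] {μ : Measure α} {f g : α → ℝ}
    (hf : MemLp f 2 μ) (hg : MemLp g 2 μ) :
    ∫ x, |f x| * |g x| ∂μ ≤ √(∫ x, f x ^ 2 ∂μ) * √(∫ x, g x ^ 2 ∂μ) := by
  have h2 : ENNReal.ofReal 2 = 2 := by norm_num
  have := integral_mul_le_Lp_mul_Lq_of_nonneg (μ := μ) Real.HolderConjugate.two_two
    (Eventually.of_forall fun x => abs_nonneg (f x))
    (Eventually.of_forall fun x => abs_nonneg (g x)) (by rw [h2]; exact hf.abs)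
    (by rw [h2]; exact hg.abs)
  simpa [Real.sqrt_eq_rpow] using this

theorem hasDerivAt_slice_snd {f : ℝ × ℝ → ℝ} {x y : ℝ} (hf : DifferentiableAt ℝ f (x, y)) :
    HasDerivAt (fun y => f (x, y)) (pdy f (x, y)) y :=
  hf.hasFDerivAt.comp_hasDerivAt y ((hasDerivAt_const y x).prodMk (hasDerivAt_id y))

section Rect

variable {h a : ℝ} {f g : ℝ × ℝ → ℝ}

theorem aestronglyMeasurable_rect (hg : ContinuousOn g (Icc 0 h ×ˢ Icc 0 a)) :
    AEStronglyMeasurable g (volume.restrict (rect h a)) :=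
  (hg.mono (rect_subset_Icc h a)).aestronglyMeasurable (measurableSet_rect h a)

theorem exists_ae_bound_rect (hg : ContinuousOn g (Icc 0 h ×ˢ Icc 0 a)) :
    ∃ C : ℝ, ∀ᵐ p ∂(volume.restrict (rect h a)), ‖g p‖ ≤ C := by
  obtain ⟨C, hC⟩ := (isCompact_Icc.prod isCompact_Icc).exists_bound_of_continuousOn hg
  exact ⟨C, ae_restrict_rect fun p hp => hC p (rect_subset_Icc h a hp)⟩

theorem integrableOn_rect_continuousOn_mul
    (hg : ContinuousOn g (Icc 0 h ×ˢ Icc 0 a)) (hf : IntegrableOn f (rect h a)) :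
    IntegrableOn (fun p => g p * f p) (rect h a) := by
  obtain ⟨C, hC⟩ := exists_ae_bound_rect hg
  exact Integrable.bdd_mul hf (aestronglyMeasurable_rect hg) hC

theorem integrableOn_rect_mul_continuousOn (hf : IntegrableOn f (rect h a))
    (hg : ContinuousOn g (Icc 0 h ×ˢ Icc 0 a)) :
    IntegrableOn (fun p => f p * g p) (rect h a) := by
  simpa only [mul_comm] using integrableOn_rect_continuousOn_mul hg hf

theorem memLp_rect_of_continuousOn {q : ENNReal} (hg : ContinuousOn g (Icc 0 h ×ˢ Icc 0 a)) :
    MemLp g q (volume.restrict (rect h a)) := by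
  obtain ⟨C, hC⟩ := exists_ae_bound_rect hg
  exact MemLp.of_bound (aestronglyMeasurable_rect hg) C hC

theorem integrableOn_rect_of_continuousOn (hg : ContinuousOn g (Icc 0 h ×ˢ Icc 0 a)) :
    IntegrableOn g (rect h a) :=
  memLp_one_iff_integrable.1 (memLp_rect_of_continuousOn hg)

theorem memLp_rect_continuousOn_mul {q : ENNReal} (hg : ContinuousOn g (Icc 0 h ×ˢ Icc 0 a))
    (hf : MemLp f q (volume.restrict (rect h a))) :
    MemLp (fun p => g p * f p) q (volume.restrict (rect h a)) := by
  obtain ⟨C, hC⟩ := exists_ae_bound_rect hg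
  refine MemLp.of_le_mul (c := C) hf ((aestronglyMeasurable_rect hg).mul hf.1) ?_
  filter_upwards [hC] with p hp
  rw [norm_mul]; gcongr

theorem continuousOn_comp_snd {V : ℝ → ℝ} (hV : ContinuousOn V (Icc 0 a)) :
    ContinuousOn (fun p : ℝ × ℝ => V p.2) (Icc 0 h ×ˢ Icc 0 a) :=
  hV.comp continuousOn_snd fun _ hp => hp.2

theorem integral_weight_mul_le {V : ℝ → ℝ} (hV : ContinuousOn V (Icc 0 a))
    (hV0 : ∀ y ∈ Icc 0 a, 0 ≤ V y)
    (hf : MemLp f 2 (volume.restrict (rect h a))) (hg : MemLp g 2 (volume.restrict (rect h a))) :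
    ∫ p in rect h a, V p.2 * (|f p| * |g p|) ≤
      √(∫ p in rect h a, V p.2 * f p ^ 2) * √(∫ p in rect h a, V p.2 * g p ^ 2) := by
  have hs : ContinuousOn (fun p : ℝ × ℝ => √(V p.2)) (Icc 0 h ×ˢ Icc 0 a) :=
    (continuousOn_comp_snd hV).sqrt
  have hpos (p : ℝ × ℝ) (hp : p ∈ rect h a) : 0 ≤ V p.2 := hV0 _ (rect_subset_Icc h a hp).2
  have hprod : ∫ p in rect h a, |√(V p.2) * f p| * |√(V p.2) * g p| =
      ∫ p in rect h a, V p.2 * (|f p| * |g p|) := by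
    refine setIntegral_congr_fun (measurableSet_rect h a) fun p hp => ?_
    simp only [abs_mul, abs_of_nonneg (Real.sqrt_nonneg _)]
    linear_combination |f p| * |g p| * Real.mul_self_sqrt (hpos p hp)
  have hsq (k : ℝ × ℝ → ℝ) : ∫ p in rect h a, (√(V p.2) * k p) ^ 2 =
      ∫ p in rect h a, V p.2 * k p ^ 2 :=
    setIntegral_congr_fun (measurableSet_rect h a) fun p hp => by
      simp only [mul_pow, Real.sq_sqrt (hpos p hp)]
  rw [← hprod, ← hsq f, ← hsq g]
  exact integral_mul_le_sqrt_mul_sqrt (memLp_rect_continuousOn_mul hs hf)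
    (memLp_rect_continuousOn_mul hs hg)

theorem setIntegral_rect_deriv_eq_zero (ha : 0 < a)
    (hd : ∀ x ∈ Ioo 0 h, ∀ y ∈ Icc 0 a, HasDerivAt (fun y => f (x, y)) (g (x, y)) y)
    (hc : ContinuousOn g (Icc 0 h ×ˢ Icc 0 a))
    (hbot : ∀ x ∈ Ioo 0 h, f (x, 0) = 0) (htop : ∀ x ∈ Ioo 0 h, f (x, a) = 0) :
    ∫ p in rect h a, g p = 0 := by
  have hi := integrableOn_rect_of_continuousOn hc
  rw [rect, Measure.volume_eq_prod] at hi ⊢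
  rw [setIntegral_prod _ hi]
  refine setIntegral_eq_zero_of_forall_eq_zero fun x hx => ?_
  have hcx : ContinuousOn (fun y => g (x, y)) (uIcc 0 a) := by
    rw [uIcc_of_le ha.le]
    exact hc.comp (by fun_prop) fun y hy => ⟨Ioo_subset_Icc_self hx, hy⟩
  rw [← integral_Ioc_eq_integral_Ioo, ← intervalIntegral.integral_of_le ha.le,
    intervalIntegral.integral_eq_sub_of_hasDerivAt (f := fun y => f (x, y))
      (fun y hy => hd x hx y (uIcc_of_le ha.le ▸ hy)) hcx.intervalIntegrable,
    hbot x hx, htop x hx, sub_zero]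

end Rect

/-! ### Testing with a function that need not vanish on the left side -/

section Doubling

variable {h a c : ℝ} {F G ψ : ℝ × ℝ → ℝ}

theorem diagAffine_two_preimage_rect (h a : ℝ) :
    diagAffine 2 0 1 0 ⁻¹' rect h a = rect (h / 2) a := by
  ext p
  simp only [diagAffine, rect, mem_preimage, mem_prod, mem_Ioo, one_mul, add_zero, lt_div_iff₀,
    two_pos, mul_comm p.1, mul_pos_iff_of_pos_left]

theorem mapsTo_diagAffine_half (h a : ℝ) :
    MapsTo (diagAffine (1 / 2) 0 1 0) (Icc 0 h ×ˢ Icc 0 a) (Icc 0 h ×ˢ Icc 0 a) := fun p hp => by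
  simp only [diagAffine, mem_prod, mem_Icc, one_mul, add_zero] at hp ⊢
  exact ⟨⟨by linarith, by linarith⟩, hp.2⟩

theorem setIntegral_mul_comp_half (H g : ℝ × ℝ → ℝ) (h a : ℝ) :
    ∫ p in rect h a, H p * g (diagAffine (1 / 2) 0 1 0 p) =
      2 * ∫ p in rect (h / 2) a, H (diagAffine 2 0 1 0 p) * g p := by
  have hhalf (p : ℝ × ℝ) : diagAffine (1 / 2) 0 1 0 (diagAffine 2 0 1 0 p) = p := by
    ext <;> simp [diagAffine]
  have key := setIntegral_comp_diagAffine two_ne_zero one_ne_zero 0 0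
    (fun p => H p * g (diagAffine (1 / 2) 0 1 0 p)) (rect h a)
  simp only [diagAffine_two_preimage_rect, hhalf] at key
  rw [key, ← mul_assoc]
  norm_num

theorem setIntegral_mul_sub_comp_half (hh : 0 < h) {H g : ℝ × ℝ → ℝ} (r : ℝ)
    (hH : IntegrableOn H (rect h a)) (hg : ContinuousOn g (Icc 0 h ×ˢ Icc 0 a))
    (h0 : ∀ p : ℝ × ℝ, h / 2 ≤ p.1 → g p = 0) :
    ∫ p in rect h a, H p * (g p - r * g (diagAffine (1 / 2) 0 1 0 p)) =
      ∫ p in rect (h / 2) a, (H p - 2 * r * H (diagAffine 2 0 1 0 p)) * g p := by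
  have hle : rect (h / 2) a ⊆ rect h a := rect_mono (by linarith)
  have hghalf : ContinuousOn (fun p => g (diagAffine (1 / 2) 0 1 0 p)) (Icc 0 h ×ˢ Icc 0 a) :=
    hg.comp (contDiff_diagAffine _ _ _ _).continuous.continuousOn
      (mapsTo_diagAffine_half h a)
  have hint := integrableOn_rect_mul_continuousOn hH hg
  have hHdbl : IntegrableOn (fun p => H (diagAffine 2 0 1 0 p)) (rect (h / 2) a) :=
    integrableOn_comp_diagAffine two_ne_zero one_ne_zero 0 0 hH
      (diagAffine_two_preimage_rect h a).ge
  have hintdbl := integrableOn_rect_mul_continuousOn hHdbl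
    (hg.mono (prod_mono (Icc_subset_Icc_right (by linarith)) subset_rfl))
  have hsupp : ∫ p in rect h a, H p * g p = ∫ p in rect (h / 2) a, H p * g p :=
    setIntegral_eq_of_subset_of_forall_sdiff_eq_zero (measurableSet_rect h a) hle fun p hp => by
      rw [h0 p (not_lt.1 fun hlt => hp.2 ⟨⟨hp.1.1.1, hlt⟩, hp.1.2⟩), mul_zero]
  calc ∫ p in rect h a, H p * (g p - r * g (diagAffine (1 / 2) 0 1 0 p))
      = ∫ p in rect h a, (H p * g p - r * (H p * g (diagAffine (1 / 2) 0 1 0 p))) := by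
        congr with p; ring
    _ = (∫ p in rect (h / 2) a, H p * g p) -
          r * (2 * ∫ p in rect (h / 2) a, H (diagAffine 2 0 1 0 p) * g p) := by
        rw [integral_sub hint ((integrableOn_rect_mul_continuousOn hH hghalf).const_mul r),
          integral_const_mul, setIntegral_mul_comp_half, hsupp]
    _ = ∫ p in rect (h / 2) a, (H p * g p - 2 * r * (H (diagAffine 2 0 1 0 p) * g p)) := by
        rw [integral_sub (hint.mono_set hle) (hintdbl.const_mul _), integral_const_mul]
        ring
    _ = ∫ p in rect (h / 2) a, (H p - 2 * r * H (diagAffine 2 0 1 0 p)) * g p := by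
        congr with p; ring

theorem fderiv_apply_eq_zero_of_right {d : ℝ} (hcd : c < d)
    (hright : ∀ p : ℝ × ℝ, c ≤ p.1 → ψ p = 0) (e p : ℝ × ℝ) (hp : d ≤ p.1) :
    fderiv ℝ ψ p e = 0 := by
  have hzero : ψ =ᶠ[𝓝 p] fun _ => 0 := by
    filter_upwards [(isOpen_lt continuous_const continuous_fst).mem_nhds (hcd.trans_le hp)]
      with q hq using hright q (le_of_lt hq)
  rw [hzero.fderiv_eq, fderiv_fun_const, Pi.zero_apply, zero_apply]

-- The test function `ψ(x, y) - ψ(x / 2, y)` vanishes on the side `x = 0` although `ψ` does not.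
theorem sub_comp_half_eq_zero_of_mem_frontier (hh : 0 < h) (ha : 0 < a) (hch : c ≤ h / 2)
    (hright : ∀ p : ℝ × ℝ, c ≤ p.1 → ψ p = 0) (hbot : ∀ x, ψ (x, 0) = 0)
    (htop : ∀ x, ψ (x, a) = 0) {p : ℝ × ℝ} (hp : p ∈ frontier (rect h a)) :
    ψ p - ψ (diagAffine (1 / 2) 0 1 0 p) = 0 := by
  obtain ⟨x, y⟩ := p
  rcases eq_or_eq_of_mem_frontier_rect hh ha hp with rfl | rfl | rfl | rfl
  · simp [diagAffine]
  · rw [hright _ (by dsimp only; linarith),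
      hright _ (by simp only [diagAffine]; linarith), sub_zero]
  · simp [diagAffine, hbot]
  · simp [diagAffine, htop]

theorem CurlFree.integral_doubling_eq (hh : 0 < h) (ha : 0 < a) (hch : c < h / 2)
    (hc : CurlFree (rect h a) F G) (hF : IntegrableOn F (rect h a)) (hG : IntegrableOn G (rect h a))
    (hψ : ∀ p ∈ Icc 0 h ×ˢ Icc 0 a, ContDiffAt ℝ ∞ ψ p)
    (hright : ∀ p : ℝ × ℝ, c ≤ p.1 → ψ p = 0)
    (hbot : ∀ x, ψ (x, 0) = 0) (htop : ∀ x, ψ (x, a) = 0) :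
    ∫ p in rect (h / 2) a, (F p - 2 * F (diagAffine 2 0 1 0 p)) * pdy ψ p =
      ∫ p in rect (h / 2) a, (G p - G (diagAffine 2 0 1 0 p)) * pdx ψ p := by
  have hmaps {p : ℝ × ℝ} (hp : p ∈ rect h a) :=
    mapsTo_diagAffine_half h a (rect_subset_Icc h a hp)
  have hψhalf (p : ℝ × ℝ) (hp : p ∈ Icc 0 h ×ˢ Icc 0 a) :
      ContDiffAt ℝ ∞ (fun q => ψ (diagAffine (1 / 2) 0 1 0 q)) p :=
    (hψ _ (mapsTo_diagAffine_half h a hp)).comp p (contDiff_diagAffine _ _ _ _).contDiffAt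
  have hdiff (p : ℝ × ℝ) (hp : p ∈ Icc 0 h ×ˢ Icc 0 a) : DifferentiableAt ℝ ψ p :=
    (hψ p hp).differentiableAt (by simp)
  have hsub (p : ℝ × ℝ) (hp : p ∈ rect h a) (e : ℝ × ℝ) :
      fderiv ℝ (fun q => ψ q - ψ (diagAffine (1 / 2) 0 1 0 q)) p e =
        fderiv ℝ ψ p e - fderiv ℝ (fun q => ψ (diagAffine (1 / 2) 0 1 0 q)) p e :=
    congrArg (· e) (fderiv_fun_sub (hdiff p (rect_subset_Icc h a hp))
      ((hψhalf p (rect_subset_Icc h a hp)).differentiableAt (by simp)))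
  have hparts := hc.integral_eq_of_frontier_eq_zero (isOpen_rect h a)
    (by rw [closure_rect hh ha]; exact isCompact_Icc.prod isCompact_Icc) hF hG
    (by rw [closure_rect hh ha]; exact fun p hp => (hψ p hp).sub (hψhalf p hp))
    fun p hp => sub_comp_half_eq_zero_of_mem_frontier hh ha (by linarith) hright hbot htop hp
  have hvanish := fderiv_apply_eq_zero_of_right hch hright
  calc ∫ p in rect (h / 2) a, (F p - 2 * F (diagAffine 2 0 1 0 p)) * pdy ψ p
      = ∫ p in rect h a, F p * (pdy ψ p - 1 * pdy ψ (diagAffine (1 / 2) 0 1 0 p)) := by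
        rw [setIntegral_mul_sub_comp_half hh 1 hF (continuousOn_fderiv_apply hψ _) (hvanish _),
          mul_one]
    _ = ∫ p in rect h a, G p * (pdx ψ p - 1 / 2 * pdx ψ (diagAffine (1 / 2) 0 1 0 p)) := by
        convert hparts using 1 <;>
          refine setIntegral_congr_fun (measurableSet_rect h a) fun p hp => ?_
        · simp only [hsub p hp, ← pdy_comp_diagAffine (hdiff _ (hmaps hp))]
        · simp only [hsub p hp, ← pdx_comp_diagAffine (hdiff _ (hmaps hp))]
    _ = ∫ p in rect (h / 2) a, (G p - G (diagAffine 2 0 1 0 p)) * pdx ψ p := by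
        rw [setIntegral_mul_sub_comp_half hh _ hG (continuousOn_fderiv_apply hψ _) (hvanish _)]
        simp only [one_div, mul_inv_cancel₀ (two_ne_zero' ℝ), one_mul]

end Doubling

/-! ### Weighted square integrals -/

/-- A continuous nonnegative weight on `[0, a]`; its values outside `[0, a]` are irrelevant. -/
structure IsWeight (a : ℝ) (V : ℝ → ℝ) : Prop where
  continuousOn : ContinuousOn V (Icc 0 a)
  nonneg : ∀ y ∈ Icc 0 a, 0 ≤ V y

/-- The squared norm of `f` in `L²(S)` for the density `V(y)`. -/
noncomputable def wsq (S : Set (ℝ × ℝ)) (V : ℝ → ℝ) (f : ℝ × ℝ → ℝ) : ℝ :=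
  ∫ p in S, V p.2 * f p ^ 2

/-- The right-hand side of the weighted Korn inequality on `rect h a`, for a displacement with
first component `u`, diagonal strains `A`, `B` and doubled shear strain `D`. The strains are kept
independent of `u`, so that the bound is continuous in them. -/
noncomputable def kornBound (h a : ℝ) (V : ℝ → ℝ) (u A D B : ℝ × ℝ → ℝ) : ℝ :=
  √(wsq (rect h a) V u) * √(wsq (rect h a) V B) / h +
    (wsq (rect h a) V A + wsq (rect h a) V D + wsq (rect h a) V B)

section Weighted

variable {h L a : ℝ} {V W : ℝ → ℝ} {f g k : ℝ × ℝ → ℝ}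

theorem IsWeight.nonneg_of_mem_rect (hV : IsWeight a V) {p : ℝ × ℝ} (hp : p ∈ rect h a) :
    0 ≤ V p.2 := hV.nonneg _ (rect_subset_Icc h a hp).2

theorem wsq_nonneg (hV : IsWeight a V) (f : ℝ × ℝ → ℝ) : 0 ≤ wsq (rect h a) V f :=
  setIntegral_nonneg (measurableSet_rect h a) fun _ hp =>
    mul_nonneg (hV.nonneg_of_mem_rect hp) (sq_nonneg _)

theorem integrableOn_wsq (hV : ContinuousOn V (Icc 0 a))
    (hf : MemLp f 2 (volume.restrict (rect h a))) :
    IntegrableOn (fun p => V p.2 * f p ^ 2) (rect h a) :=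
  integrableOn_rect_continuousOn_mul (continuousOn_comp_snd hV) hf.integrable_sq

theorem memLp_rect_mono (hL : L ≤ h) (hf : MemLp f 2 (volume.restrict (rect h a))) :
    MemLp f 2 (volume.restrict (rect L a)) :=
  hf.mono_measure (Measure.restrict_mono (rect_mono hL) le_rfl)

theorem wsq_mono_set (hV : IsWeight a V) (hf : MemLp f 2 (volume.restrict (rect h a)))
    {S : Set (ℝ × ℝ)} (hS : S ⊆ rect h a) : wsq S V f ≤ wsq (rect h a) V f :=
  setIntegral_mono_subset hS (measurableSet_rect h a) (integrableOn_wsq hV.continuousOn hf)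
    fun _ hp => mul_nonneg (hV.nonneg_of_mem_rect hp) (sq_nonneg _)

theorem wsq_le_add_of_subset_union (hV : IsWeight a V)
    (hf : MemLp f 2 (volume.restrict (rect h a))) {S T : Set (ℝ × ℝ)} (hS : MeasurableSet S)
    (hT : MeasurableSet T) (hSR : S ⊆ rect h a) (hTR : T ⊆ rect h a) (hST : rect h a ⊆ S ∪ T) :
    wsq (rect h a) V f ≤ wsq S V f + wsq T V f := by
  have hint := integrableOn_wsq hV.continuousOn hf
  rw [hST.antisymm (union_subset hSR hTR)]
  exact setIntegral_union_le hS hT (hint.mono_set hSR) (hint.mono_set hTR)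
    fun p hp => mul_nonneg (hV.nonneg_of_mem_rect (hTR hp)) (sq_nonneg _)

theorem wsq_le_sum {ι : Type*} {I : Finset ι} {c : ι → ℝ} {f : ℝ × ℝ → ℝ} {g : ι → ℝ × ℝ → ℝ}
    (hV : IsWeight a V) (hf : MemLp f 2 (volume.restrict (rect h a)))
    (hg : ∀ i ∈ I, MemLp (g i) 2 (volume.restrict (rect h a)))
    (hle : ∀ p ∈ rect h a, f p ^ 2 ≤ ∑ i ∈ I, c i * g i p ^ 2) :
    wsq (rect h a) V f ≤ ∑ i ∈ I, c i * wsq (rect h a) V (g i) := by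
  have hint i (hi : i ∈ I) := (integrableOn_wsq hV.continuousOn (hg i hi)).const_mul (c i)
  simp only [wsq, ← integral_const_mul]
  rw [← integral_finsetSum I hint]
  refine setIntegral_mono_on (integrableOn_wsq hV.continuousOn hf) (integrable_finsetSum I hint)
    (measurableSet_rect h a) fun p hp => ?_
  calc V p.2 * f p ^ 2 ≤ V p.2 * ∑ i ∈ I, c i * g i p ^ 2 :=
        mul_le_mul_of_nonneg_left (hle p hp) (hV.nonneg_of_mem_rect hp)
    _ = ∑ i ∈ I, c i * (V p.2 * g i p ^ 2) := by
        rw [Finset.mul_sum]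
        exact Finset.sum_congr rfl fun i _ => by ring

theorem wsq_le_add {c₁ c₂ : ℝ} (hV : IsWeight a V) (hf : MemLp f 2 (volume.restrict (rect h a)))
    (hg : MemLp g 2 (volume.restrict (rect h a))) (hk : MemLp k 2 (volume.restrict (rect h a)))
    (hle : ∀ p ∈ rect h a, f p ^ 2 ≤ c₁ * g p ^ 2 + c₂ * k p ^ 2) :
    wsq (rect h a) V f ≤ c₁ * wsq (rect h a) V g + c₂ * wsq (rect h a) V k := by
  have hsum := wsq_le_sum (I := Finset.univ) (c := ![c₁, c₂]) (g := ![g, k]) hV hf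
    (by simp [Fin.forall_fin_two, hg, hk]) (by simpa using hle)
  simpa using hsum

theorem wsq_mul_comp_diagAffine {σ t : ℝ} (hσ : σ ≠ 0) (ht : t ≠ 0) (τ s r : ℝ)
    {S : Set (ℝ × ℝ)} (hS : MeasurableSet S)
    (hVW : ∀ p ∈ diagAffine σ τ t s ⁻¹' S, V p.2 = W (t * p.2 + s)) (f : ℝ × ℝ → ℝ) :
    wsq (diagAffine σ τ t s ⁻¹' S) V (fun p => r * f (diagAffine σ τ t s p)) =
      r ^ 2 * |(σ * t)⁻¹| * wsq S W f := by
  have hcov := setIntegral_comp_diagAffine hσ ht τ s (fun p => W p.2 * f p ^ 2) S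
  rw [wsq, wsq, mul_assoc, ← hcov, ← integral_const_mul]
  have hmeas := (contDiff_diagAffine σ τ t s).continuous.measurable hS
  refine setIntegral_congr_fun hmeas fun p hp => ?_
  have hV : V p.2 = W (diagAffine σ τ t s p).2 := hVW p hp
  simp only [hV]
  ring

theorem wsq_comp_diagAffine_le {κ σ τ t s : ℝ} (hσ : σ ≠ 0) (ht : t ≠ 0) (hW : IsWeight a W)
    (hV : ContinuousOn V (Icc 0 a)) (hVW : ∀ y ∈ Ioo 0 a, V y ≤ κ * W (t * y + s)) (hκ : 0 ≤ κ)
    (hm : MapsTo (diagAffine σ τ t s) (rect L a) (rect h a))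
    (hf : MemLp f 2 (volume.restrict (rect h a))) :
    wsq (rect L a) V (fun p => f (diagAffine σ τ t s p)) ≤
      κ * |(σ * t)⁻¹| * wsq (rect h a) W f := by
  have hint := integrableOn_wsq hW.continuousOn hf
  calc wsq (rect L a) V (fun p => f (diagAffine σ τ t s p))
      ≤ ∫ p in rect L a, κ * (W (diagAffine σ τ t s p).2 * f (diagAffine σ τ t s p) ^ 2) := by
        refine setIntegral_mono_on (integrableOn_wsq hV (memLp_comp_diagAffine hσ ht τ s hf hm))
          ((integrableOn_comp_diagAffine hσ ht τ s hint hm).const_mul κ)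
          (measurableSet_rect L a) fun p hp => ?_
        rw [← mul_assoc]
        exact mul_le_mul_of_nonneg_right (hVW p.2 hp.2) (sq_nonneg _)
    _ = κ * ∫ p in rect L a, W (diagAffine σ τ t s p).2 * f (diagAffine σ τ t s p) ^ 2 :=
        integral_const_mul _ _
    _ ≤ κ * (|(σ * t)⁻¹| * wsq (rect h a) W f) := by
        gcongr
        exact setIntegral_comp_diagAffine_le hσ ht τ s (measurableSet_rect h a) hint
          (fun p hp => mul_nonneg (hW.nonneg_of_mem_rect hp) (sq_nonneg _)) hm
    _ = κ * |(σ * t)⁻¹| * wsq (rect h a) W f := (mul_assoc _ _ _).symm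

end Weighted

/-! ### The energy inequality -/

theorem energy_integrand_le {K N c c' V V₁ V₂ U Ux Uy F G : ℝ} (hK : 0 ≤ K) (hc0 : 0 ≤ c)
    (hc1 : c ≤ 1) (hc' : |c'| ≤ N) (hV : 0 ≤ V) (hV₂ : V₂ ≤ 0) (hsq : V₁ ^ 2 ≤ K * V * (-V₂)) :
    c * (V * Uy ^ 2) + 2 * (c * (V₁ * U + V * Uy) * F) -
        2 * ((c' * V * U + c * V * Ux) * G) + c * (V₂ * U ^ 2 + V₁ * (2 * U * Uy)) ≤
      (K + 1) * (V * (Uy + F) ^ 2) + V * G ^ 2 + V * Ux ^ 2 + 2 * N * (V * (|G| * |U|)) := by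
  have hconcave : 2 * (V₁ * U * (Uy + F)) ≤ K * V * (Uy + F) ^ 2 + -V₂ * U ^ 2 := by
    refine two_mul_le_add_of_sq_le_mul (by positivity)
      (mul_nonneg (neg_nonneg.2 hV₂) (sq_nonneg _)) ?_
    calc (V₁ * U * (Uy + F)) ^ 2 = V₁ ^ 2 * (U * (Uy + F)) ^ 2 := by ring
      _ ≤ K * V * (-V₂) * (U * (Uy + F)) ^ 2 := by gcongr
      _ = K * V * (Uy + F) ^ 2 * (-V₂ * U ^ 2) := by ring
  have hcutoff : -(c' * (V * (U * G))) ≤ N * (V * (|G| * |U|)) :=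
    calc -(c' * (V * (U * G))) ≤ |c' * (V * (U * G))| := neg_le_abs _
      _ = |c'| * (V * (|G| * |U|)) := by
        rw [abs_mul, abs_mul, abs_mul, abs_of_nonneg hV, mul_comm |U|]
      _ ≤ N * (V * (|G| * |U|)) := by gcongr
  have hdrop : c * (K * V * (Uy + F) ^ 2 + V * (Uy + F) ^ 2 + V * G ^ 2 + V * Ux ^ 2) ≤
      K * V * (Uy + F) ^ 2 + V * (Uy + F) ^ 2 + V * G ^ 2 + V * Ux ^ 2 :=
    mul_le_of_le_one_left (by positivity) hc1
  have hF : 0 ≤ c * V * F ^ 2 := by positivity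
  have hGx : 0 ≤ c * V * (Ux + G) ^ 2 := by positivity
  linarith [mul_le_mul_of_nonneg_left hconcave hc0]

/-- A smooth concave weight `V` on `[0, a]` with derivatives `V₁`, `V₂`. Concavity is required in
the quantitative form `V₁² ≤ -K V V₂`; for `V = y ^ α` with `0 < α < 1` this holds with
`K = α / (1 - α)`. -/
structure ConcaveWeight (a K : ℝ) (V V₁ V₂ : ℝ → ℝ) : Prop where
  smooth : ∀ y ∈ Icc 0 a, ContDiffAt ℝ ∞ V y
  hasDerivAt : ∀ y ∈ Icc 0 a, HasDerivAt V (V₁ y) y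
  hasDerivAt₁ : ∀ y ∈ Icc 0 a, HasDerivAt V₁ (V₂ y) y
  continuousOn₂ : ContinuousOn V₂ (Icc 0 a)
  nonneg : ∀ y ∈ Icc 0 a, 0 ≤ V y
  nonpos₂ : ∀ y ∈ Icc 0 a, V₂ y ≤ 0
  sq_le : ∀ y ∈ Icc 0 a, V₁ y ^ 2 ≤ K * V y * (-V₂ y)

namespace ConcaveWeight

variable {L a K N : ℝ} {V V₁ V₂ m : ℝ → ℝ} {U F G : ℝ × ℝ → ℝ}

theorem isWeight (hV : ConcaveWeight a K V V₁ V₂) : IsWeight a V :=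
  ⟨fun y hy => (hV.smooth y hy).continuousAt.continuousWithinAt, hV.nonneg⟩

theorem continuousOn₁ (hV : ConcaveWeight a K V V₁ V₂) : ContinuousOn V₁ (Icc 0 a) :=
  fun y hy => (hV.hasDerivAt₁ y hy).continuousAt.continuousWithinAt

theorem hasFDerivAt_cutoff_mul (hV : ConcaveWeight a K V V₁ V₂) (hm : Differentiable ℝ m)
    {p : ℝ × ℝ} (hU : DifferentiableAt ℝ U p) (hp : p.2 ∈ Icc 0 a) :
    HasFDerivAt (fun p : ℝ × ℝ => m p.1 * V p.2 * U p)
      ((m p.1 * V p.2) • fderiv ℝ U p + U p • (m p.1 • (V₁ p.2 • ContinuousLinearMap.snd ℝ ℝ ℝ) +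
        V p.2 • (deriv m p.1 • ContinuousLinearMap.fst ℝ ℝ ℝ))) p := by
  have hm' : HasFDerivAt (fun p : ℝ × ℝ => m p.1)
      (deriv m p.1 • ContinuousLinearMap.fst ℝ ℝ ℝ) p :=
    (hm p.1).hasDerivAt.comp_hasFDerivAt p hasFDerivAt_fst
  have hV' : HasFDerivAt (fun p : ℝ × ℝ => V p.2) (V₁ p.2 • ContinuousLinearMap.snd ℝ ℝ ℝ) p :=
    (hV.hasDerivAt p.2 hp).comp_hasFDerivAt p hasFDerivAt_snd
  exact (hm'.mul hV').mul hU.hasFDerivAt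

theorem pdx_cutoff_mul (hV : ConcaveWeight a K V V₁ V₂) (hm : Differentiable ℝ m)
    {p : ℝ × ℝ} (hU : DifferentiableAt ℝ U p) (hp : p.2 ∈ Icc 0 a) :
    pdx (fun p => m p.1 * V p.2 * U p) p =
      deriv m p.1 * V p.2 * U p + m p.1 * V p.2 * pdx U p := by
  rw [pdx, (hV.hasFDerivAt_cutoff_mul hm hU hp).fderiv]
  simp only [smul_add, add_apply, smul_apply, smul_eq_mul, ContinuousLinearMap.coe_snd', mul_zero,
    ContinuousLinearMap.coe_fst', mul_one, zero_add]
  ring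

theorem pdy_cutoff_mul (hV : ConcaveWeight a K V V₁ V₂) (hm : Differentiable ℝ m)
    {p : ℝ × ℝ} (hU : DifferentiableAt ℝ U p) (hp : p.2 ∈ Icc 0 a) :
    pdy (fun p => m p.1 * V p.2 * U p) p = m p.1 * (V₁ p.2 * U p + V p.2 * pdy U p) := by
  rw [pdy, (hV.hasFDerivAt_cutoff_mul hm hU hp).fderiv]
  simp only [smul_add, add_apply, smul_apply, smul_eq_mul, ContinuousLinearMap.coe_snd', mul_one,
    ContinuousLinearMap.coe_fst', mul_zero, add_zero]
  ring

theorem contDiffAt_cutoff_mul (hV : ConcaveWeight a K V V₁ V₂) (hm : ContDiff ℝ ∞ m)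
    (hU : ContDiff ℝ ∞ U) {p : ℝ × ℝ} (hp : p.2 ∈ Icc 0 a) :
    ContDiffAt ℝ ∞ (fun p => m p.1 * V p.2 * U p) p :=
  ((hm.comp contDiff_fst).contDiffAt.mul
    ((hV.smooth p.2 hp).comp p contDiffAt_snd)).mul hU.contDiffAt

theorem continuousOn_cutoff_mul (hV : ConcaveWeight a K V V₁ V₂) (hm : Continuous m)
    (hU : ContDiff ℝ ∞ U) :
    ContinuousOn (fun p => m p.1 * (V₂ p.2 * U p ^ 2 + V₁ p.2 * (2 * U p * pdy U p)))
      (Icc 0 L ×ˢ Icc 0 a) := by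
  have hc : Continuous fun p : ℝ × ℝ => m p.1 := hm.comp continuous_fst
  have hUy : Continuous (pdy U) := (contDiff_fderiv_apply hU _).continuous
  have hU₀ := hU.continuous
  exact hc.continuousOn.mul
    (((continuousOn_comp_snd hV.continuousOn₂).mul (hU₀.pow 2).continuousOn).add
      ((continuousOn_comp_snd hV.continuousOn₁).mul
        ((continuous_const.mul hU₀).mul hUy).continuousOn))

-- Since `U` vanishes at both ends, `∂y (m V₁ U²)` integrates to zero; this trades `m V₁ U U_y` for
-- the good term `-m V₂ U² / 2`.
theorem integral_cutoff_mul_eq_zero (hV : ConcaveWeight a K V V₁ V₂) (ha : 0 < a)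
    (hm : Continuous m) (hU : ContDiff ℝ ∞ U) (hbot : ∀ x, U (x, 0) = 0)
    (htop : ∀ x, U (x, a) = 0) :
    ∫ p in rect L a, m p.1 * (V₂ p.2 * U p ^ 2 + V₁ p.2 * (2 * U p * pdy U p)) = 0 := by
  refine setIntegral_rect_deriv_eq_zero ha (f := fun p => m p.1 * (V₁ p.2 * U p ^ 2))
    (fun x _ y hy => ?_) ?_ (fun x _ => by simp [hbot]) (fun x _ => by simp [htop])
  · have hsq := (hasDerivAt_slice_snd (hU.differentiable (by simp) (x, y))).pow 2
    refine (((hV.hasDerivAt₁ y hy).mul hsq).const_mul (m x)).congr_deriv ?_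
    simp
  · exact hV.continuousOn_cutoff_mul hm hU

theorem integrableOn_mul_pdx_cutoff_mul (hV : ConcaveWeight a K V V₁ V₂) (hm : ContDiff ℝ ∞ m)
    (hU : ContDiff ℝ ∞ U) (hG : IntegrableOn G (rect L a)) :
    IntegrableOn (fun p => 2 * (G p * pdx (fun p => m p.1 * V p.2 * U p) p)) (rect L a) :=
  (integrableOn_rect_mul_continuousOn hG (continuousOn_fderiv_apply
    (fun _ hp => hV.contDiffAt_cutoff_mul hm hU hp.2) _)).const_mul 2

theorem integrableOn_mul_pdy_cutoff_mul (hV : ConcaveWeight a K V V₁ V₂) (hm : ContDiff ℝ ∞ m)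
    (hU : ContDiff ℝ ∞ U) (hF : IntegrableOn F (rect L a)) :
    IntegrableOn (fun p => 2 * (F p * pdy (fun p => m p.1 * V p.2 * U p) p)) (rect L a) :=
  (integrableOn_rect_mul_continuousOn hF (continuousOn_fderiv_apply
    (fun _ hp => hV.contDiffAt_cutoff_mul hm hU hp.2) _)).const_mul 2

theorem integral_add_test_identity (ha : 0 < a) (hV : ConcaveWeight a K V V₁ V₂)
    (hm : ContDiff ℝ ∞ m) (hU : ContDiff ℝ ∞ U) (hbot : ∀ x, U (x, 0) = 0)
    (htop : ∀ x, U (x, a) = 0) (hF : IntegrableOn F (rect L a)) (hG : IntegrableOn G (rect L a))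
    (htest : ∫ p in rect L a, F p * pdy (fun p => m p.1 * V p.2 * U p) p =
      ∫ p in rect L a, G p * pdx (fun p => m p.1 * V p.2 * U p) p)
    {P : ℝ × ℝ → ℝ} (hP : IntegrableOn P (rect L a)) :
    ∫ p in rect L a, (P p + 2 * (F p * pdy (fun p => m p.1 * V p.2 * U p) p) -
      2 * (G p * pdx (fun p => m p.1 * V p.2 * U p) p) +
        m p.1 * (V₂ p.2 * U p ^ 2 + V₁ p.2 * (2 * U p * pdy U p))) = ∫ p in rect L a, P p := by
  have hiF := hV.integrableOn_mul_pdy_cutoff_mul hm hU hF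
  have hiG := hV.integrableOn_mul_pdx_cutoff_mul hm hU hG
  rw [integral_add ?_ (integrableOn_rect_of_continuousOn
      (hV.continuousOn_cutoff_mul hm.continuous hU)),
    integral_sub ?_ hiG, integral_add hP hiF, integral_const_mul, integral_const_mul,
    hV.integral_cutoff_mul_eq_zero ha hm.continuous hU hbot htop, htest]
  · ring
  exacts [hP.add hiF, (hP.add hiF).sub hiG]

theorem energy_le (ha : 0 < a) (hV : ConcaveWeight a K V V₁ V₂) (hK : 0 ≤ K)
    (hm : ContDiff ℝ ∞ m) (hm01 : ∀ x, m x ∈ Icc 0 1) (hmN : ∀ x, |deriv m x| ≤ N)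
    (hU : ContDiff ℝ ∞ U) (hbot : ∀ x, U (x, 0) = 0) (htop : ∀ x, U (x, a) = 0)
    (hF : MemLp F 2 (volume.restrict (rect L a))) (hG : MemLp G 2 (volume.restrict (rect L a)))
    (htest : ∫ p in rect L a, F p * pdy (fun p => m p.1 * V p.2 * U p) p =
      ∫ p in rect L a, G p * pdx (fun p => m p.1 * V p.2 * U p) p) :
    ∫ p in rect L a, m p.1 * (V p.2 * pdy U p ^ 2) ≤
      (K + 1) * wsq (rect L a) V (fun p => pdy U p + F p) + wsq (rect L a) V G +
        wsq (rect L a) V (pdx U) + 2 * N * (√(wsq (rect L a) V G) * √(wsq (rect L a) V U)) := by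
  have hN : 0 ≤ N := (abs_nonneg _).trans (hmN 0)
  have hW := hV.isWeight
  have hLp {f : ℝ × ℝ → ℝ} (hf : Continuous f) : MemLp f 2 (volume.restrict (rect L a)) :=
    memLp_rect_of_continuousOn hf.continuousOn
  have hUx := hLp (contDiff_fderiv_apply hU (1, 0)).continuous
  have hUy := hLp (contDiff_fderiv_apply hU (0, 1)).continuous
  have hiF := hF.integrable one_le_two
  have hiG := hG.integrable one_le_two
  have hcm : Continuous fun p : ℝ × ℝ => m p.1 := hm.continuous.comp continuous_fst
  have hiP : IntegrableOn (fun p => m p.1 * (V p.2 * pdy U p ^ 2)) (rect L a) :=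
    integrableOn_rect_continuousOn_mul hcm.continuousOn (integrableOn_wsq hW.continuousOn hUy)
  have hiD := (integrableOn_wsq hW.continuousOn (hUy.add hF)).const_mul (K + 1)
  have hiG2 := integrableOn_wsq hW.continuousOn hG
  have hiUx := integrableOn_wsq hW.continuousOn hUx
  have hiGU : IntegrableOn (fun p => 2 * N * (V p.2 * (|G p| * |U p|))) (rect L a) :=
    (integrableOn_rect_continuousOn_mul (continuousOn_comp_snd hW.continuousOn)
      (hG.abs.integrable_mul (hLp hU.continuous).abs)).const_mul _
  rw [← hV.integral_add_test_identity ha hm hU hbot htop hiF hiG htest hiP]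
  refine (setIntegral_mono_on (((hiP.add (hV.integrableOn_mul_pdy_cutoff_mul hm hU hiF)).sub
    (hV.integrableOn_mul_pdx_cutoff_mul hm hU hiG)).add
      (integrableOn_rect_of_continuousOn (hV.continuousOn_cutoff_mul hm.continuous hU)))
    (((hiD.add hiG2).add hiUx).add hiGU) (measurableSet_rect L a) fun p hp => ?_).trans ?_
  · have hy := (rect_subset_Icc L a hp).2
    have hdU := hU.differentiable (by simp) p
    simp only [Pi.add_apply, Pi.sub_apply]
    rw [hV.pdy_cutoff_mul (hm.differentiable (by simp)) hdU hy,
      hV.pdx_cutoff_mul (hm.differentiable (by simp)) hdU hy, mul_comm (F p), mul_comm (G p)]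
    exact energy_integrand_le hK (hm01 p.1).1 (hm01 p.1).2 (hmN p.1) (hV.nonneg _ hy)
      (hV.nonpos₂ _ hy) (hV.sq_le _ hy)
  · rw [integral_add' ((hiD.add hiG2).add hiUx) hiGU, integral_add' (hiD.add hiG2) hiUx,
      integral_add' hiD hiG2, integral_const_mul, integral_const_mul]
    have hCS := integral_weight_mul_le hW.continuousOn hW.nonneg hG (hLp hU.continuous)
    exact add_le_add_right (mul_le_mul_of_nonneg_left hCS (by positivity)) _

end ConcaveWeight

/-! ### Dirichlet conditions on the horizontal sides -/

/-- The bound `kornBound` for a displacement with smooth first component `u` whose second component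
has partial derivatives `F` and `G`. -/
noncomputable abbrev dataBound (h a : ℝ) (V : ℝ → ℝ) (u F G : ℝ × ℝ → ℝ) : ℝ :=
  kornBound h a V u (pdx u) (fun p => pdy u p + F p) G

/-- A displacement on `rect h a` with smooth first component `u`. The second component enters only
through its weak partial derivatives `F` and `G`. -/
structure KornData (h a : ℝ) (u F G : ℝ × ℝ → ℝ) : Prop where
  width_pos : 0 < h
  height_pos : 0 < a
  smooth : ContDiff ℝ ∞ u
  curlFree : CurlFree (rect h a) F G
  memLp_dx : MemLp F 2 (volume.restrict (rect h a))
  memLp_dy : MemLp G 2 (volume.restrict (rect h a))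

namespace KornData

variable {h a : ℝ} {u F G : ℝ × ℝ → ℝ}

theorem memLp (hd : KornData h a u F G) : MemLp u 2 (volume.restrict (rect h a)) :=
  memLp_rect_of_continuousOn hd.smooth.continuous.continuousOn

theorem memLp_pdx (hd : KornData h a u F G) : MemLp (pdx u) 2 (volume.restrict (rect h a)) :=
  memLp_rect_of_continuousOn (contDiff_fderiv_apply hd.smooth _).continuous.continuousOn

theorem memLp_pdy (hd : KornData h a u F G) : MemLp (pdy u) 2 (volume.restrict (rect h a)) :=
  memLp_rect_of_continuousOn (contDiff_fderiv_apply hd.smooth _).continuous.continuousOn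

theorem memLp_shear (hd : KornData h a u F G) :
    MemLp (fun p => pdy u p + F p) 2 (volume.restrict (rect h a)) :=
  hd.memLp_pdy.add hd.memLp_dx

theorem differentiable (hd : KornData h a u F G) : Differentiable ℝ u :=
  hd.smooth.differentiable (by simp)

theorem comp_diagAffine {σ t : ℝ} (hd : KornData h a u F G) (hσ : σ ≠ 0) (ht : t ≠ 0) (τ s : ℝ)
    {h' a' : ℝ} (hh' : 0 < h') (ha' : 0 < a')
    (hm : MapsTo (diagAffine σ τ t s) (rect h' a') (rect h a)) :
    KornData h' a' (fun p => u (diagAffine σ τ t s p)) (fun p => t * F (diagAffine σ τ t s p))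
      (fun p => t ^ 2 / σ * G (diagAffine σ τ t s p)) where
  width_pos := hh'
  height_pos := ha'
  smooth := hd.smooth.comp (contDiff_diagAffine _ _ _ _)
  curlFree := hd.curlFree.comp_diagAffine hσ ht τ s hm
  memLp_dx := (memLp_comp_diagAffine hσ ht τ s hd.memLp_dx hm).const_mul _
  memLp_dy := (memLp_comp_diagAffine hσ ht τ s hd.memLp_dy hm).const_mul _

theorem pdx_sub_doubling (hd : KornData h a u F G) :
    pdx (fun p => u p - 2 * u (diagAffine 2 0 1 0 p)) =
      fun p => pdx u p - 4 * pdx u (diagAffine 2 0 1 0 p) := by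
  funext p
  have hdbl : DifferentiableAt ℝ (fun q => u (diagAffine 2 0 1 0 q)) p :=
    (hd.smooth.comp (contDiff_diagAffine _ _ _ _)).differentiable (by simp) p
  have hpdx := pdx_comp_diagAffine (hd.differentiable (diagAffine 2 0 1 0 p))
  simp only [pdx] at hpdx ⊢
  rw [fderiv_fun_sub (hd.differentiable p) (hdbl.const_mul 2), fderiv_const_mul hdbl, sub_apply,
    smul_apply, hpdx, smul_eq_mul]
  ring

theorem pdy_sub_doubling (hd : KornData h a u F G) :
    pdy (fun p => u p - 2 * u (diagAffine 2 0 1 0 p)) =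
      fun p => pdy u p - 2 * pdy u (diagAffine 2 0 1 0 p) := by
  funext p
  have hdbl : DifferentiableAt ℝ (fun q => u (diagAffine 2 0 1 0 q)) p :=
    (hd.smooth.comp (contDiff_diagAffine _ _ _ _)).differentiable (by simp) p
  have hpdy := pdy_comp_diagAffine (hd.differentiable (diagAffine 2 0 1 0 p))
  simp only [pdy] at hpdy ⊢
  rw [fderiv_fun_sub (hd.differentiable p) (hdbl.const_mul 2), fderiv_const_mul hdbl, sub_apply,
    smul_apply, hpdy, smul_eq_mul, one_mul]

end KornData

section Doubling

variable {h a c : ℝ} {V : ℝ → ℝ} {f : ℝ × ℝ → ℝ}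

theorem memLp_doubling (hf : MemLp f 2 (volume.restrict (rect h a))) :
    MemLp (fun p => f (diagAffine 2 0 1 0 p)) 2 (volume.restrict (rect (h / 2) a)) :=
  memLp_comp_diagAffine two_ne_zero one_ne_zero 0 0 hf (diagAffine_two_preimage_rect h a).ge

theorem memLp_sub_doubling (hh : 0 < h) (hf : MemLp f 2 (volume.restrict (rect h a))) (c : ℝ) :
    MemLp (fun p => f p - c * f (diagAffine 2 0 1 0 p)) 2 (volume.restrict (rect (h / 2) a)) :=
  (memLp_rect_mono (by linarith) hf).sub ((memLp_doubling hf).const_mul c)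

theorem wsq_doubling (V : ℝ → ℝ) (f : ℝ × ℝ → ℝ) (h a c : ℝ) :
    wsq (rect (h / 2) a) V (fun p => c * f (diagAffine 2 0 1 0 p)) =
      c ^ 2 / 2 * wsq (rect h a) V f := by
  rw [← diagAffine_two_preimage_rect h a, wsq_mul_comp_diagAffine two_ne_zero one_ne_zero 0 0 c
    (measurableSet_rect h a) (W := V) (fun p _ => by simp) f]
  norm_num [div_eq_mul_inv]

theorem wsq_sub_doubling_le (hh : 0 < h) (hV : IsWeight a V)
    (hf : MemLp f 2 (volume.restrict (rect h a))) (c : ℝ) :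
    wsq (rect (h / 2) a) V (fun p => f p - c * f (diagAffine 2 0 1 0 p)) ≤
      (2 + c ^ 2) * wsq (rect h a) V f := by
  have hle : h / 2 ≤ h := by linarith
  have hadd := wsq_le_add (c₁ := 2) (c₂ := 2) hV (memLp_sub_doubling hh hf c)
    (memLp_rect_mono hle hf) ((memLp_doubling hf).const_mul c)
    (fun p _ => by linarith [sq_nonneg (f p + c * f (diagAffine 2 0 1 0 p))])
  rw [wsq_doubling] at hadd
  linarith [wsq_mono_set hV hf (rect_mono hle)]

end Doubling

theorem exists_left_cutoff : ∃ M : ℝ, 0 < M ∧ ∀ h : ℝ, 0 < h → ∃ m : ℝ → ℝ, ContDiff ℝ ∞ m ∧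
    (∀ x, m x ∈ Icc 0 1) ∧ (∀ x, |deriv m x| ≤ M / h) ∧
    (∀ x ≤ 3 * h / 10, m x = 1) ∧ ∀ x, 2 * h / 5 ≤ x → m x = 0 := by
  obtain ⟨M, hM0, hM⟩ := exists_bound_deriv_smoothTransition
  refine ⟨10 * M, by positivity, fun h hh => ⟨fun x => Real.smoothTransition (4 - 10 / h * x),
    Real.smoothTransition.contDiff.comp (by fun_prop),
    fun x => ⟨Real.smoothTransition.nonneg _, Real.smoothTransition.le_one _⟩, fun x => ?_,
    fun x hx => Real.smoothTransition.one_of_one_le ?_,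
    fun x hx => Real.smoothTransition.zero_of_nonpos ?_⟩⟩
  · have hlin : HasDerivAt (fun x : ℝ => 4 - 10 / h * x) (-(10 / h)) x := by
      simpa using ((hasDerivAt_id x).const_mul (10 / h)).const_sub 4
    have hderiv : deriv (fun x => Real.smoothTransition (4 - 10 / h * x)) x = _ :=
      ((Real.smoothTransition.contDiff (n := 1)).differentiable one_ne_zero _).hasDerivAt.comp x
        hlin |>.deriv
    rw [hderiv, abs_mul, abs_neg, abs_of_pos (by positivity : 0 < 10 / h), mul_comm,
      ← mul_div_right_comm]
    gcongr
    exact hM _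
  · rw [div_mul_eq_mul_div, le_sub_comm, div_le_iff₀ hh]
    linarith
  · rw [div_mul_eq_mul_div, sub_nonpos, le_div_iff₀ hh]
    linarith

section Left

variable {h a K N : ℝ} {V V₁ V₂ m : ℝ → ℝ} {u F G : ℝ × ℝ → ℝ}

theorem energy_terms_le_kornBound {u A D B U Ux Uy H : ℝ × ℝ → ℝ} (hV : IsWeight a V) (hh : 0 < h)
    (hK : 0 ≤ K) (hN : 0 ≤ N)
    (hD : wsq (rect (h / 2) a) V Uy ≤ (2 + 2 ^ 2) * wsq (rect h a) V D)
    (hB : wsq (rect (h / 2) a) V H ≤ (2 + 1 ^ 2) * wsq (rect h a) V B)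
    (hA : wsq (rect (h / 2) a) V Ux ≤ (2 + 4 ^ 2) * wsq (rect h a) V A)
    (hu : wsq (rect (h / 2) a) V U ≤ (2 + 2 ^ 2) * wsq (rect h a) V u) :
    (K + 1) * wsq (rect (h / 2) a) V Uy + wsq (rect (h / 2) a) V H + wsq (rect (h / 2) a) V Ux +
        2 * (N / h) * (√(wsq (rect (h / 2) a) V H) * √(wsq (rect (h / 2) a) V U)) ≤
      (6 * (K + 1) + 18 + 10 * N) * kornBound h a V u A D B := by
  have hmixed : √(wsq (rect (h / 2) a) V H) * √(wsq (rect (h / 2) a) V U) ≤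
      5 * (√(wsq (rect h a) V u) * √(wsq (rect h a) V B)) := by
    have hsqrt : √(3 * 6 : ℝ) ≤ 5 := Real.sqrt_le_iff.2 (by norm_num)
    calc √(wsq (rect (h / 2) a) V H) * √(wsq (rect (h / 2) a) V U)
        ≤ √(3 * wsq (rect h a) V B) * √(6 * wsq (rect h a) V u) := by
          gcongr <;> linarith
      _ = √(3 * 6) * (√(wsq (rect h a) V u) * √(wsq (rect h a) V B)) := by
          rw [Real.sqrt_mul (by norm_num), Real.sqrt_mul (by norm_num), Real.sqrt_mul (by norm_num)]
          ring
      _ ≤ 5 * (√(wsq (rect h a) V u) * √(wsq (rect h a) V B)) := by gcongr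
  have hA0 := wsq_nonneg (h := h) hV A
  have hD0 := wsq_nonneg (h := h) hV D
  have hB0 := wsq_nonneg (h := h) hV B
  set X := √(wsq (rect h a) V u) * √(wsq (rect h a) V B) / h with hX
  have hX0 : 0 ≤ X := by positivity
  have hcross : 2 * (N / h) * (√(wsq (rect (h / 2) a) V H) * √(wsq (rect (h / 2) a) V U)) ≤
      10 * N * X :=
    calc _ ≤ 2 * (N / h) * (5 * (√(wsq (rect h a) V u) * √(wsq (rect h a) V B))) := by gcongr
      _ = 10 * N * X := by ring
  rw [kornBound, ← hX]
  nlinarith [mul_nonneg hK hX0, mul_nonneg hK hA0, mul_nonneg hK hB0, mul_nonneg hN hA0,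
    mul_nonneg hN hB0, mul_nonneg hN hD0, mul_le_mul_of_nonneg_left hD hK]

theorem KornData.energy_sub_doubling_le (hd : KornData h a u F G) (hV : ConcaveWeight a K V V₁ V₂)
    (hK : 0 ≤ K) (hbot : ∀ x, u (x, 0) = 0) (htop : ∀ x, u (x, a) = 0) (hm : ContDiff ℝ ∞ m)
    (hm01 : ∀ x, m x ∈ Icc 0 1) (hmN : ∀ x, |deriv m x| ≤ N / h)
    (hm0 : ∀ x, 2 * h / 5 ≤ x → m x = 0) :
    ∫ p in rect (h / 2) a,
        m p.1 * (V p.2 * pdy (fun p => u p - 2 * u (diagAffine 2 0 1 0 p)) p ^ 2) ≤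
      (6 * (K + 1) + 18 + 10 * N) * dataBound h a V u F G := by
  have hh := hd.width_pos
  have hW := hV.isWeight
  have hN : 0 ≤ N := by simpa [hh.ne'] using mul_nonneg ((abs_nonneg _).trans (hmN 0)) hh.le
  have hU : ContDiff ℝ ∞ (fun p => u p - 2 * u (diagAffine 2 0 1 0 p)) :=
    hd.smooth.sub (contDiff_const.mul (hd.smooth.comp (contDiff_diagAffine _ _ _ _)))
  have htest := hd.curlFree.integral_doubling_eq hh hd.height_pos
    (by linarith : 2 * h / 5 < h / 2) (hd.memLp_dx.integrable one_le_two)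
    (hd.memLp_dy.integrable one_le_two)
    (ψ := fun p => m p.1 * V p.2 * (u p - 2 * u (diagAffine 2 0 1 0 p)))
    (fun p hp => hV.contDiffAt_cutoff_mul hm hU hp.2) (fun p hp => by simp [hm0 _ hp])
    (fun x => by simp [diagAffine, hbot]) (fun x => by simp [diagAffine, htop])
  have hG1 : MemLp (fun p => G p - G (diagAffine 2 0 1 0 p)) 2
      (volume.restrict (rect (h / 2) a)) := by
    simpa only [one_mul] using memLp_sub_doubling hh hd.memLp_dy 1
  have henergy := hV.energy_le hd.height_pos hK hm hm01 hmN hU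
    (fun x => by simp [diagAffine, hbot]) (fun x => by simp [diagAffine, htop])
    (memLp_sub_doubling hh hd.memLp_dx 2) hG1 htest
  have hD := wsq_sub_doubling_le hh hW hd.memLp_shear 2
  have hB := wsq_sub_doubling_le hh hW hd.memLp_dy 1
  have hA := wsq_sub_doubling_le hh hW hd.memLp_pdx 4
  have hu := wsq_sub_doubling_le hh hW hd.memLp 2
  simp only [hd.pdx_sub_doubling, congrFun hd.pdy_sub_doubling, one_mul] at henergy hB ⊢
  simp only [sub_add_sub_comm, ← mul_add] at henergy
  exact henergy.trans (energy_terms_le_kornBound hW hh hK hN hD hB hA hu)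

theorem KornData.wsq_pdy_sub_doubling_le (hd : KornData h a u F G) (hV : IsWeight a V)
    (hm : Continuous m) (hm0 : ∀ x, 0 ≤ m x) (hm1 : ∀ x ≤ 3 * h / 10, m x = 1) :
    wsq (rect (3 * h / 10) a) V (pdy fun p => u p - 2 * u (diagAffine 2 0 1 0 p)) ≤
      ∫ p in rect (h / 2) a,
        m p.1 * (V p.2 * pdy (fun p => u p - 2 * u (diagAffine 2 0 1 0 p)) p ^ 2) := by
  have hh := hd.width_pos
  have hLp : MemLp (pdy fun p => u p - 2 * u (diagAffine 2 0 1 0 p)) 2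
      (volume.restrict (rect (h / 2) a)) := by
    simpa only [hd.pdy_sub_doubling] using! memLp_sub_doubling hh hd.memLp_pdy 2
  calc wsq (rect (3 * h / 10) a) V (pdy fun p => u p - 2 * u (diagAffine 2 0 1 0 p))
      = ∫ p in rect (3 * h / 10) a,
          m p.1 * (V p.2 * pdy (fun p => u p - 2 * u (diagAffine 2 0 1 0 p)) p ^ 2) :=
        setIntegral_congr_fun (measurableSet_rect _ a) fun p hp => by
          simp only [hm1 p.1 hp.1.2.le, one_mul]
    _ ≤ _ := setIntegral_mono_subset (rect_mono (by linarith)) (measurableSet_rect _ a)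
        (integrableOn_rect_continuousOn_mul (hm.comp continuous_fst).continuousOn
          (integrableOn_wsq hV.continuousOn hLp))
        fun p hp => mul_nonneg (hm0 _) (mul_nonneg (hV.nonneg_of_mem_rect hp) (sq_nonneg _))

theorem KornData.wsq_pdy_le (hd : KornData h a u F G) (hV : IsWeight a V) :
    wsq (rect (3 * h / 5) a) V (pdy u) ≤
      6 * wsq (rect (3 * h / 10) a) V (pdy fun p => u p - 2 * u (diagAffine 2 0 1 0 p)) := by
  have hh := hd.width_pos
  have hLp := memLp_rect_mono (by linarith : 3 * h / 5 ≤ h) hd.memLp_pdy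
  have hhalf : 3 * h / 10 = 3 * h / 5 / 2 := by ring
  have hmono := wsq_mono_set hV hLp (rect_mono (by linarith : 3 * h / 5 / 2 ≤ 3 * h / 5))
  have hdoubling := wsq_doubling V (pdy u) (3 * h / 5) a 2
  have hsplit := wsq_le_add (c₁ := 3 / 2) (c₂ := 3) hV ((memLp_doubling hLp).const_mul 2)
    (memLp_rect_mono (by linarith) hLp) (memLp_sub_doubling (by linarith) hLp 2) fun p _ => by
      linarith [sq_nonneg (3 * pdy u p - 4 * pdy u (diagAffine 2 0 1 0 p))]
  simp only [hd.pdy_sub_doubling, hhalf]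
  linarith

theorem exists_korn_left (hK : 0 ≤ K) : ∃ C : ℝ, 0 < C ∧
    ∀ {h a : ℝ} {V V₁ V₂ : ℝ → ℝ} {u F G : ℝ × ℝ → ℝ}, ConcaveWeight a K V V₁ V₂ →
      KornData h a u F G → (∀ x, u (x, 0) = 0) → (∀ x, u (x, a) = 0) →
      wsq (rect (3 * h / 5) a) V (pdy u) ≤ C * dataBound h a V u F G := by
  obtain ⟨M, hM, hcutoff⟩ := exists_left_cutoff
  refine ⟨6 * (6 * (K + 1) + 18 + 10 * M), by positivity, fun {h a V V₁ V₂ u F G} hV hd hbot htop =>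
    ?_⟩
  obtain ⟨m, hm, hm01, hmM, hm1, hm0⟩ := hcutoff h hd.width_pos
  have henergy := hd.energy_sub_doubling_le hV hK hbot htop hm hm01 hmM hm0
  linarith [hd.wsq_pdy_le hV.isWeight, hd.wsq_pdy_sub_doubling_le hV.isWeight
    hm.continuous (fun x => (hm01 x).1) hm1]

end Left

section Reflection

variable {h a σ τ t s : ℝ} {V W : ℝ → ℝ} {u F G : ℝ × ℝ → ℝ}

theorem preimage_diagAffine_prod {I I' J J' : Set ℝ} (hI : ∀ x, σ * x + τ ∈ I' ↔ x ∈ I)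
    (hJ : ∀ y, t * y + s ∈ J' ↔ y ∈ J) : diagAffine σ τ t s ⁻¹' (I' ×ˢ J') = I ×ˢ J := by
  ext p
  exact and_congr (hI p.1) (hJ p.2)

theorem diagAffine_neg_one_preimage (a b h : ℝ) :
    diagAffine (-1) h 1 0 ⁻¹' (Ioo (h - b) h ×ˢ Ioo 0 a) = rect b a :=
  preimage_diagAffine_prod
    (fun x => by constructor <;> rintro ⟨h₁, h₂⟩ <;> constructor <;> linarith) fun y => by simp

theorem wsq_comp_reflection (hσ : σ ^ 2 = 1) (ht : t ^ 2 = 1)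
    (hpre : diagAffine σ τ t s ⁻¹' rect h a = rect h a)
    (hVW : ∀ y ∈ Ioo 0 a, V y = W (t * y + s)) (r : ℝ) (f : ℝ × ℝ → ℝ) :
    wsq (rect h a) V (fun p => r * f (diagAffine σ τ t s p)) = r ^ 2 * wsq (rect h a) W f := by
  have hmap := wsq_mul_comp_diagAffine (V := V) (W := W) (pow_ne_zero_iff two_ne_zero |>.1 <|
    hσ.trans_ne one_ne_zero) (pow_ne_zero_iff two_ne_zero |>.1 <| ht.trans_ne one_ne_zero) τ s r
    (measurableSet_rect h a) (fun p hp => hVW p.2 (hpre ▸ hp : p ∈ rect h a).2) f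
  have hdet : |(σ * t)⁻¹| = 1 := by
    rw [abs_inv, inv_eq_one, ← pow_eq_one_iff_of_nonneg (abs_nonneg _) two_ne_zero, sq_abs,
      mul_pow, hσ, ht, one_mul]
  rwa [hpre, hdet, mul_one] at hmap

theorem KornData.pdx_comp_diagAffine (hd : KornData h a u F G) (σ τ t s : ℝ) :
    pdx (fun p => u (diagAffine σ τ t s p)) = fun p => σ * pdx u (diagAffine σ τ t s p) :=
  funext fun _ => _root_.pdx_comp_diagAffine (hd.differentiable _)

theorem KornData.pdy_comp_diagAffine (hd : KornData h a u F G) (σ τ t s : ℝ) :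
    pdy (fun p => u (diagAffine σ τ t s p)) = fun p => t * pdy u (diagAffine σ τ t s p) :=
  funext fun _ => _root_.pdy_comp_diagAffine (hd.differentiable _)

theorem KornData.dataBound_comp_reflection (hd : KornData h a u F G) (hσ : σ ^ 2 = 1)
    (ht : t ^ 2 = 1) (hpre : diagAffine σ τ t s ⁻¹' rect h a = rect h a)
    (hVW : ∀ y ∈ Ioo 0 a, V y = W (t * y + s)) :
    dataBound h a V (fun p => u (diagAffine σ τ t s p)) (fun p => t * F (diagAffine σ τ t s p))
      (fun p => t ^ 2 / σ * G (diagAffine σ τ t s p)) = dataBound h a W u F G := by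
  have hwsq (r : ℝ) (hr : r ^ 2 = 1) (f : ℝ × ℝ → ℝ) :
      wsq (rect h a) V (fun p => r * f (diagAffine σ τ t s p)) = wsq (rect h a) W f := by
    rw [wsq_comp_reflection hσ ht hpre hVW, hr, one_mul]
  have hu := hwsq 1 (one_pow 2) u
  have hD := hwsq t ht fun p => pdy u p + F p
  have hB := hwsq (t ^ 2 / σ) (by rw [div_pow, ht, hσ, one_pow, div_one]) G
  simp only [one_mul] at hu
  simp only [kornBound, hd.pdx_comp_diagAffine, congrFun (hd.pdy_comp_diagAffine _ _ _ _),
    ← mul_add, hu, hD, hB, hwsq σ hσ]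

end Reflection

theorem exists_korn_dirichlet {K : ℝ} (hK : 0 ≤ K) : ∃ C : ℝ, 0 < C ∧
    ∀ {h a : ℝ} {V V₁ V₂ : ℝ → ℝ} {u F G : ℝ × ℝ → ℝ}, ConcaveWeight a K V V₁ V₂ →
      KornData h a u F G → (∀ x, u (x, 0) = 0) → (∀ x, u (x, a) = 0) →
      wsq (rect h a) V (pdy u) ≤ C * dataBound h a V u F G := by
  obtain ⟨C, hC, hkorn⟩ := exists_korn_left hK
  refine ⟨2 * C, by positivity, fun {h a V V₁ V₂ u F G} hV hd hbot htop => ?_⟩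
  have hh := hd.width_pos
  have hpre : diagAffine (-1) h 1 0 ⁻¹' rect h a = rect h a := by
    simpa [rect] using diagAffine_neg_one_preimage a h h
  have hreflect := hkorn hV (hd.comp_diagAffine (neg_ne_zero.2 one_ne_zero) one_ne_zero h 0 hh
    hd.height_pos hpre.ge) (fun x => by simp [diagAffine, hbot])
    (fun x => by simp [diagAffine, htop])
  rw [hd.dataBound_comp_reflection (by norm_num) (one_pow 2) hpre (W := V) (by simp)] at hreflect
  have hright : wsq (Ioo (h - 3 * h / 5) h ×ˢ Ioo 0 a) V (pdy u) =
      wsq (rect (3 * h / 5) a) V (pdy fun p => u (diagAffine (-1) h 1 0 p)) := by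
    rw [hd.pdy_comp_diagAffine, ← diagAffine_neg_one_preimage a (3 * h / 5) h,
      wsq_mul_comp_diagAffine (W := V) (neg_ne_zero.2 one_ne_zero) one_ne_zero h 0 1
        (measurableSet_Ioo.prod measurableSet_Ioo) (by simp)]
    norm_num
  have hcover : rect h a ⊆ rect (3 * h / 5) a ∪ Ioo (h - 3 * h / 5) h ×ˢ Ioo 0 a := fun p hp =>
    (lt_or_ge p.1 (3 * h / 5)).imp (fun hlt => ⟨⟨hp.1.1, hlt⟩, hp.2⟩)
      fun hge => ⟨⟨by linarith, hp.1.2⟩, hp.2⟩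
  have hsplit := wsq_le_add_of_subset_union hV.isWeight hd.memLp_pdy (measurableSet_rect _ a)
    (measurableSet_Ioo.prod measurableSet_Ioo) (rect_mono (by linarith))
    (prod_mono (Ioo_subset_Ioo_left (by linarith)) subset_rfl) hcover
  rw [hright] at hsplit
  linarith [hkorn hV hd hbot htop]

section Combination

variable {n : ℕ} {h a : ℝ} {V W : ℝ → ℝ} {u F G : ℝ × ℝ → ℝ} {μ t s : Fin n → ℝ}

theorem kornBound_le_mul {c : ℝ} (hh : 0 < h) (hc : 0 ≤ c) {u A D B u' A' D' B' : ℝ × ℝ → ℝ}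
    (hu : wsq (rect h a) V u' ≤ c * wsq (rect h a) W u)
    (hA : wsq (rect h a) V A' ≤ c * wsq (rect h a) W A)
    (hD : wsq (rect h a) V D' ≤ c * wsq (rect h a) W D)
    (hB : wsq (rect h a) V B' ≤ c * wsq (rect h a) W B) :
    kornBound h a V u' A' D' B' ≤ c * kornBound h a W u A D B := by
  have hcross : √(wsq (rect h a) V u') * √(wsq (rect h a) V B') / h ≤
      c * (√(wsq (rect h a) W u) * √(wsq (rect h a) W B) / h) :=
    calc _ ≤ √(c * wsq (rect h a) W u) * √(c * wsq (rect h a) W B) / h := by gcongr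
      _ = √c * √c * (√(wsq (rect h a) W u) * √(wsq (rect h a) W B) / h) := by
        rw [Real.sqrt_mul hc, Real.sqrt_mul hc]
        ring
      _ = _ := by rw [Real.mul_self_sqrt hc]
  unfold kornBound
  linarith

theorem sq_sum_mul_le {c : Fin n → ℝ} (hc : ∀ i, |c i| ≤ 1) (x : Fin n → ℝ) :
    (∑ i, c i * x i) ^ 2 ≤ ∑ i, n * x i ^ 2 :=
  calc (∑ i, c i * x i) ^ 2 ≤ n * ∑ i, (c i * x i) ^ 2 := by
        simpa using sq_sum_le_card_mul_sum_sq (s := Finset.univ) (f := fun i => c i * x i)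
    _ ≤ n * ∑ i, x i ^ 2 := by
        gcongr _ * ∑ i, ?_ with i
        rw [mul_pow]
        exact mul_le_of_le_one_left (sq_nonneg _) ((sq_le_one_iff_abs_le_one _).2 (hc i))
    _ = ∑ i, n * x i ^ 2 := Finset.mul_sum _ _ _

theorem wsq_sum_comp_le (hV : IsWeight a V) (hW : IsWeight a W) {c : Fin n → ℝ}
    (hc : ∀ i, |c i| ≤ 1) (ht : ∀ i, 1 / 6 ≤ |t i|)
    (hVW : ∀ i, ∀ y ∈ Ioo 0 a, V y ≤ 3 * W (t i * y + s i))
    (hm : ∀ i, MapsTo (diagAffine 1 0 (t i) (s i)) (rect h a) (rect h a)) {f : ℝ × ℝ → ℝ}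
    (hf : MemLp f 2 (volume.restrict (rect h a))) :
    wsq (rect h a) V (fun p => ∑ i, c i * f (diagAffine 1 0 (t i) (s i) p)) ≤
      18 * n ^ 2 * wsq (rect h a) W f := by
  have ht0 i : t i ≠ 0 := abs_pos.1 (by linarith [ht i])
  have hmem i := memLp_comp_diagAffine one_ne_zero (ht0 i) 0 (s i) hf (hm i)
  have hterm i : wsq (rect h a) V (fun p => f (diagAffine 1 0 (t i) (s i) p)) ≤
      18 * wsq (rect h a) W f := by
    have hcomp := wsq_comp_diagAffine_le one_ne_zero (ht0 i) hW hV.continuousOn (hVW i)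
      zero_le_three (hm i) hf
    have hinv : |(1 * t i)⁻¹| ≤ 6 := by
      rw [one_mul, abs_inv]
      exact inv_le_of_inv_le₀ (by norm_num) (by simpa using ht i)
    linarith [mul_le_mul_of_nonneg_right hinv (wsq_nonneg (h := h) hW f)]
  calc wsq (rect h a) V (fun p => ∑ i, c i * f (diagAffine 1 0 (t i) (s i) p))
      ≤ ∑ i, (n : ℝ) * wsq (rect h a) V (fun p => f (diagAffine 1 0 (t i) (s i) p)) :=
        wsq_le_sum hV (memLp_finsetSum _ fun i _ => (hmem i).const_mul (c i)) (fun i _ => hmem i)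
          fun p _ => sq_sum_mul_le hc _
    _ ≤ ∑ _i : Fin n, (n : ℝ) * (18 * wsq (rect h a) W f) := by gcongr; exact hterm _
    _ = 18 * n ^ 2 * wsq (rect h a) W f := by
      rw [Finset.sum_const, Finset.card_univ, Fintype.card_fin, nsmul_eq_mul]
      ring

theorem KornData.combination (hd : KornData h a u F G) (μ : Fin n → ℝ) (ht : ∀ i, t i ≠ 0)
    (hm : ∀ i, MapsTo (diagAffine 1 0 (t i) (s i)) (rect h a) (rect h a)) :
    KornData h a (fun p => ∑ i, μ i * u (diagAffine 1 0 (t i) (s i) p))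
      (fun p => ∑ i, μ i * (t i * F (diagAffine 1 0 (t i) (s i) p)))
      (fun p => ∑ i, μ i * (t i ^ 2 / 1 * G (diagAffine 1 0 (t i) (s i) p))) :=
  have hcomp i := hd.comp_diagAffine one_ne_zero (ht i) 0 (s i) hd.width_pos hd.height_pos (hm i)
  { width_pos := hd.width_pos
    height_pos := hd.height_pos
    smooth := ContDiff.sum fun i _ => contDiff_const.mul (hcomp i).smooth
    curlFree := CurlFree.sum Finset.univ μ
      (fun i _ => (hcomp i).memLp_dx.integrable one_le_two)
      (fun i _ => (hcomp i).memLp_dy.integrable one_le_two) fun i _ => (hcomp i).curlFree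
    memLp_dx := memLp_finsetSum _ fun i _ => (hcomp i).memLp_dx.const_mul (μ i)
    memLp_dy := memLp_finsetSum _ fun i _ => (hcomp i).memLp_dy.const_mul (μ i) }

theorem fderiv_combination_apply (hu : Differentiable ℝ u) (μ t s : Fin n → ℝ) (p e : ℝ × ℝ) :
    fderiv ℝ (fun p => ∑ i, μ i * u (diagAffine 1 0 (t i) (s i) p)) p e =
      ∑ i, μ i * fderiv ℝ (fun p => u (diagAffine 1 0 (t i) (s i) p)) p e := by
  have hcomp i : DifferentiableAt ℝ (fun p => u (diagAffine 1 0 (t i) (s i) p)) p :=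
    (hu _).comp p ((contDiff_diagAffine 1 0 (t i) (s i)).differentiable (by simp) p)
  rw [fderiv_fun_sum fun i _ => (hcomp i).const_mul (μ i), sum_apply]
  refine Finset.sum_congr rfl fun i _ => ?_
  rw [fderiv_const_mul (hcomp i), smul_apply, smul_eq_mul]

theorem pdx_combination (hu : Differentiable ℝ u) (μ t s : Fin n → ℝ) (p : ℝ × ℝ) :
    pdx (fun p => ∑ i, μ i * u (diagAffine 1 0 (t i) (s i) p)) p =
      ∑ i, μ i * pdx u (diagAffine 1 0 (t i) (s i) p) := by
  rw [pdx, fderiv_combination_apply hu]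
  refine Finset.sum_congr rfl fun i _ => ?_
  rw [← pdx, pdx_comp_diagAffine (hu _), one_mul]

theorem pdy_combination (hu : Differentiable ℝ u) (μ t s : Fin n → ℝ) (p : ℝ × ℝ) :
    pdy (fun p => ∑ i, μ i * u (diagAffine 1 0 (t i) (s i) p)) p =
      ∑ i, μ i * t i * pdy u (diagAffine 1 0 (t i) (s i) p) := by
  rw [pdy, fderiv_combination_apply hu]
  refine Finset.sum_congr rfl fun i _ => ?_
  rw [← pdy, pdy_comp_diagAffine (hu _), mul_assoc]

theorem KornData.dataBound_combination_le (hd : KornData h a u F G) (hV : IsWeight a V)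
    (hW : IsWeight a W) (hμ : ∀ i, |μ i| ≤ 1) (ht : ∀ i, |t i| ∈ Icc (1 / 6) 1)
    (hVW : ∀ i, ∀ y ∈ Ioo 0 a, V y ≤ 3 * W (t i * y + s i))
    (hm : ∀ i, MapsTo (diagAffine 1 0 (t i) (s i)) (rect h a) (rect h a)) :
    dataBound h a V (fun p => ∑ i, μ i * u (diagAffine 1 0 (t i) (s i) p))
      (fun p => ∑ i, μ i * (t i * F (diagAffine 1 0 (t i) (s i) p)))
      (fun p => ∑ i, μ i * (t i ^ 2 / 1 * G (diagAffine 1 0 (t i) (s i) p))) ≤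
        18 * n ^ 2 * dataBound h a W u F G := by
  have hμt i : |μ i * t i| ≤ 1 := by
    rw [abs_mul]
    exact mul_le_one₀ (hμ i) (abs_nonneg _) (ht i).2
  have hμt2 i : |μ i * t i ^ 2| ≤ 1 := by
    rw [abs_mul, abs_pow]
    exact mul_le_one₀ (hμ i) (by positivity) (pow_le_one₀ (abs_nonneg _) (ht i).2)
  have hle {c : Fin n → ℝ} (hc : ∀ i, |c i| ≤ 1) {f : ℝ × ℝ → ℝ}
      (hf : MemLp f 2 (volume.restrict (rect h a))) :=
    wsq_sum_comp_le hV hW hc (fun i => (ht i).1) hVW hm hf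
  refine kornBound_le_mul hd.width_pos (by positivity) (hle hμ hd.memLp) ?_ ?_ ?_
  · convert hle hμ hd.memLp_pdx using 2
    exact funext fun p => pdx_combination hd.differentiable μ t s p
  · convert hle hμt hd.memLp_shear using 2
    funext p
    rw [pdy_combination hd.differentiable, ← Finset.sum_add_distrib]
    exact Finset.sum_congr rfl fun i _ => by ring
  · convert hle hμt2 hd.memLp_dy using 2
    funext p
    exact Finset.sum_congr rfl fun i _ => by ring

theorem exists_korn_combination {K : ℝ} (hK : 0 ≤ K) (n : ℕ) [NeZero n] : ∃ C : ℝ, 0 < C ∧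
    ∀ {h a : ℝ} {V V₁ V₂ W : ℝ → ℝ} {u F G : ℝ × ℝ → ℝ} {μ t s : Fin n → ℝ},
      ConcaveWeight a K V V₁ V₂ → IsWeight a W → KornData h a u F G →
      (∀ i, |μ i| ≤ 1) → (∀ i, |t i| ∈ Icc (1 / 6) 1) →
      (∀ i, ∀ y ∈ Ioo 0 a, V y ≤ 3 * W (t i * y + s i)) →
      (∀ i, ∀ y ∈ Ioo 0 a, t i * y + s i ∈ Ioo 0 a) →
      (∀ x, ∑ i, μ i * u (x, s i) = 0) → (∀ x, ∑ i, μ i * u (x, t i * a + s i) = 0) →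
      wsq (rect h a) V (fun p => ∑ i, μ i * t i * pdy u (diagAffine 1 0 (t i) (s i) p)) ≤
        C * dataBound h a W u F G := by
  obtain ⟨C, hC, hkorn⟩ := exists_korn_dirichlet hK
  have hn : (0 : ℝ) < n := Nat.cast_pos.2 (Nat.pos_of_neZero n)
  refine ⟨C * (18 * n ^ 2), by positivity,
    fun {h a V V₁ V₂ W u F G μ t s} hV hW hd hμ ht hVW hT hbot htop => ?_⟩
  have hm i : MapsTo (diagAffine 1 0 (t i) (s i)) (rect h a) (rect h a) := fun p hp =>
    ⟨by simpa [diagAffine] using hp.1, hT i p.2 hp.2⟩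
  have ht0 i : t i ≠ 0 := abs_pos.1 (by linarith [(ht i).1])
  have hdirichlet := hkorn hV (hd.combination μ ht0 hm)
    (fun x => by simpa [diagAffine] using hbot x) (fun x => by simpa [diagAffine] using htop x)
  rw [funext (pdy_combination hd.differentiable μ t s)] at hdirichlet
  calc _ ≤ _ := hdirichlet
    _ ≤ C * (18 * n ^ 2 * dataBound h a W u F G) := by
      gcongr
      exact hd.dataBound_combination_le hV.isWeight hW hμ ht hVW hm
    _ = C * (18 * n ^ 2) * dataBound h a W u F G := (mul_assoc _ _ _).symm

end Combination

/-! ### Equal values on the two horizontal sides -/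

/-- The properties of squared sums of small powers of `y` which enter the folding argument. The
constant `θ < 1` in `doubling` is where powers below `1 / 2` are needed. -/
structure PowerLikeWeight (a K θ : ℝ) (W : ℝ → ℝ) : Prop extends IsWeight a W where
  mono : MonotoneOn W (Icc 0 a)
  doubling : ∀ y ∈ Icc 0 (a / 2), W (2 * y) ≤ 2 * θ * W y
  top_le : ∀ y ∈ Icc (a / 3) a, W a ≤ 3 * W y
  concave : ∀ ζ ∈ Ioc (0 : ℝ) 1, ∃ V₁ V₂, ConcaveWeight a K (fun y => W (ζ * y)) V₁ V₂

/-- The open horizontal strip `b < y < c` of width `h`. -/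
abbrev strip (h b c : ℝ) : Set (ℝ × ℝ) := Ioo 0 h ×ˢ Ioo b c

section Strip

variable {h a b c b' c' r s t : ℝ} {V W : ℝ → ℝ} {f : ℝ × ℝ → ℝ}

theorem concaveWeight_const {K : ℝ} (hc : 0 ≤ c) :
    ConcaveWeight a K (fun _ => c) (fun _ => 0) (fun _ => 0) where
  smooth _ _ := contDiffAt_const
  hasDerivAt _ _ := hasDerivAt_const _ _
  hasDerivAt₁ _ _ := hasDerivAt_const _ _
  continuousOn₂ := continuousOn_const
  nonneg _ _ := hc
  nonpos₂ _ _ := le_rfl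
  sq_le _ _ := by simp

theorem measurableSet_strip (h b c : ℝ) : MeasurableSet (strip h b c) :=
  measurableSet_Ioo.prod measurableSet_Ioo

theorem strip_subset_rect (hb : 0 ≤ b) (hc : c ≤ a) : strip h b c ⊆ rect h a :=
  prod_mono subset_rfl (Ioo_subset_Ioo hb hc)

theorem wsq_strip_le {κ : ℝ} (hκ : 0 ≤ κ) (hW : IsWeight a W)
    (hf : MemLp f 2 (volume.restrict (rect h a))) (hb' : 0 ≤ b') (hb : b' ≤ b) (hc : c ≤ c')
    (hc' : c' ≤ a) (hV : ∀ y ∈ Ioo b c, V y ∈ Icc 0 (κ * W y)) :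
    wsq (strip h b c) V f ≤ κ * wsq (strip h b' c') W f := by
  have hsub : strip h b c ⊆ strip h b' c' := prod_mono subset_rfl (Ioo_subset_Ioo hb hc)
  have hrect : strip h b' c' ⊆ rect h a := strip_subset_rect hb' hc'
  have hint := (integrableOn_wsq hW.continuousOn hf).mono_set hrect
  calc wsq (strip h b c) V f ≤ ∫ p in strip h b c, κ * (W p.2 * f p ^ 2) := by
        refine integral_mono_of_nonneg ?_ ((hint.mono_set hsub).const_mul κ) ?_ <;>
          filter_upwards [ae_restrict_mem (measurableSet_strip h b c)] with p hp
        · exact mul_nonneg (hV p.2 hp.2).1 (sq_nonneg _)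
        · rw [← mul_assoc]
          exact mul_le_mul_of_nonneg_right (hV p.2 hp.2).2 (sq_nonneg _)
    _ = κ * wsq (strip h b c) W f := integral_const_mul _ _
    _ ≤ κ * wsq (strip h b' c') W f := by
        gcongr
        exact setIntegral_mono_subset hsub (measurableSet_strip h b' c') hint fun p hp =>
          mul_nonneg (hW.nonneg_of_mem_rect (hrect hp)) (sq_nonneg _)

theorem wsq_comp_vertical (ht : t ≠ 0) (hr : r ^ 2 = t ^ 2)
    (hI : ∀ y, t * y + s ∈ Ioo b c ↔ y ∈ Ioo 0 a) (hVW : ∀ y ∈ Ioo 0 a, V y = W (t * y + s))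
    (f : ℝ × ℝ → ℝ) :
    wsq (rect h a) V (fun p => r * f (diagAffine 1 0 t s p)) = |t| * wsq (strip h b c) W f := by
  have hpre : diagAffine 1 0 t s ⁻¹' strip h b c = rect h a :=
    preimage_diagAffine_prod (by simp) hI
  have hmap := wsq_mul_comp_diagAffine (V := V) (W := W) one_ne_zero ht 0 s r
    (measurableSet_strip h b c) (fun p hp => hVW p.2 (hpre ▸ hp : p ∈ rect h a).2) f
  have hscale : r ^ 2 * |(1 * t)⁻¹| = |t| := by
    have := abs_pos.2 ht
    rw [hr, one_mul, abs_inv, ← sq_abs]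
    field_simp
  rwa [hpre, hscale] at hmap

end Strip

section Fold

variable {h a K θ ζ τ : ℝ} {W : ℝ → ℝ} {u F G : ℝ × ℝ → ℝ}

theorem exists_fold_le {K : ℝ} (hK : 0 ≤ K) : ∃ C : ℝ, 0 < C ∧
    ∀ {h a θ ζ : ℝ} {W : ℝ → ℝ} {u F G : ℝ × ℝ → ℝ}, PowerLikeWeight a K θ W →
      KornData h a u F G → (∀ x, u (x, 0) = u (x, a)) → ζ ∈ Icc (1 / 2 : ℝ) (2 / 3) →
      wsq (rect h a) (fun y => W (ζ * y)) (fun p => ζ * pdy u (diagAffine 1 0 ζ 0 p) +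
        (1 - ζ) * pdy u (diagAffine 1 0 (-(1 - ζ)) a p)) ≤ C * dataBound h a W u F G := by
  obtain ⟨C, hC, hkorn⟩ := exists_korn_combination hK 2
  refine ⟨C, hC, fun {h a θ ζ W u F G} hW hd hper ⟨hζ, hζ'⟩ => ?_⟩
  obtain ⟨V₁, V₂, hV⟩ := hW.concave ζ ⟨by linarith, by linarith⟩
  have hlow (y : ℝ) (hy : y ∈ Ioo 0 a) : ζ * y + 0 ∈ Ioo 0 a :=
    ⟨by nlinarith [hy.1], by nlinarith [hy.1, hy.2]⟩
  have hup (y : ℝ) (hy : y ∈ Ioo 0 a) : -(1 - ζ) * y + a ∈ Ioo 0 a :=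
    ⟨by nlinarith [hy.1, hy.2], by nlinarith [hy.1]⟩
  have hWlow (y : ℝ) (hy : y ∈ Ioo 0 a) : W (ζ * y) ≤ 3 * W (ζ * y + 0) := by
    rw [add_zero]
    linarith [hV.nonneg y (Ioo_subset_Icc_self hy)]
  have hWup (y : ℝ) (hy : y ∈ Ioo 0 a) : W (ζ * y) ≤ 3 * W (-(1 - ζ) * y + a) := by
    have hmono := hW.mono (Ioo_subset_Icc_self (hlow y hy)) (Ioo_subset_Icc_self (hup y hy))
      (by linarith [hy.2])
    rw [add_zero] at hmono
    linarith [hV.nonneg y (Ioo_subset_Icc_self hy)]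
  have hbound := hkorn hV hW.toIsWeight hd (μ := ![1, -1]) (t := ![ζ, -(1 - ζ)]) (s := ![0, a])
    (by simp [Fin.forall_fin_two])
    (by
      rw [Fin.forall_fin_two]
      simp only [Matrix.cons_val_zero, Matrix.cons_val_one, abs_neg,
        abs_of_pos (show 0 < ζ by linarith), abs_of_pos (show 0 < 1 - ζ by linarith), mem_Icc]
      constructor <;> constructor <;> linarith)
    (Fin.forall_fin_two.2 ⟨hWlow, hWup⟩) (Fin.forall_fin_two.2 ⟨hlow, hup⟩)
    (fun x => by simp [hper])
    (fun x => by
      have htop : (ζ - 1) * a + a = ζ * a := by ring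
      simp [Fin.sum_univ_two, htop])
  simpa [Fin.sum_univ_two] using hbound

theorem sq_le_young {x z : ℝ} (hτ : 0 < τ) (y : ℝ) (hz : z = x + y) :
    x ^ 2 ≤ (1 + τ) * y ^ 2 + (1 + τ⁻¹) * z ^ 2 := by
  have hsq : τ⁻¹ * (τ * y + z) ^ 2 = τ * y ^ 2 + 2 * y * z + τ⁻¹ * z ^ 2 := by
    field_simp
    ring
  have hnonneg : 0 ≤ τ⁻¹ * (τ * y + z) ^ 2 := by positivity
  have hx : x ^ 2 = y ^ 2 - 2 * y * z + z ^ 2 := by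
    rw [hz]
    ring
  linarith

theorem wsq_comp_fold_lower (hζ : 0 < ζ) (h a : ℝ) (W : ℝ → ℝ) (f : ℝ × ℝ → ℝ) :
    wsq (rect h a) (fun y => W (ζ * y)) (fun p => ζ * f (diagAffine 1 0 ζ 0 p)) =
      ζ * wsq (strip h 0 (ζ * a)) W f := by
  rw [wsq_comp_vertical (b := 0) (c := ζ * a) (W := W) hζ.ne' rfl (by simp [hζ]) (by simp),
    abs_of_pos hζ]

theorem wsq_comp_fold_upper (hζ : ζ < 1) (h a : ℝ) (W : ℝ → ℝ) (f : ℝ × ℝ → ℝ) :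
    wsq (rect h a) (fun y => W (ζ * y)) (fun p => (1 - ζ) * f (diagAffine 1 0 (-(1 - ζ)) a p)) =
      (1 - ζ) * wsq (strip h (ζ * a) a) (fun y => W (ζ / (1 - ζ) * (a - y))) f := by
  have hpos : 0 < 1 - ζ := sub_pos.2 hζ
  have hmem (y : ℝ) : -(1 - ζ) * y + a ∈ Ioo (ζ * a) a ↔ y ∈ Ioo 0 a := by
    rw [mem_Ioo, mem_Ioo]
    constructor <;> rintro ⟨h₁, h₂⟩ <;> constructor <;> nlinarith
  rw [wsq_comp_vertical (b := ζ * a) (c := a) (W := fun y => W (ζ / (1 - ζ) * (a - y)))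
    (neg_ne_zero.2 hpos.ne') (neg_sq _).symm hmem, abs_neg, abs_of_pos hpos]
  intro y _
  congr 1
  field_simp
  ring

theorem KornData.memLp_mul_pdy_comp (hd : KornData h a u F G) (t s r : ℝ) :
    MemLp (fun p => r * pdy u (diagAffine 1 0 t s p)) 2 (volume.restrict (rect h a)) :=
  memLp_rect_of_continuousOn (continuous_const.mul
    ((contDiff_fderiv_apply hd.smooth _).continuous.comp
      (contDiff_diagAffine 1 0 t s).continuous)).continuousOn

theorem KornData.fold_young (hd : KornData h a u F G) (hW : PowerLikeWeight a K θ W)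
    (hζ : ζ ∈ Ioo (0 : ℝ) 1) (hτ : 0 < τ) {e : ℝ}
    (hfold : wsq (rect h a) (fun y => W (ζ * y)) (fun p => ζ * pdy u (diagAffine 1 0 ζ 0 p) +
      (1 - ζ) * pdy u (diagAffine 1 0 (-(1 - ζ)) a p)) ≤ e) :
    ζ * wsq (strip h 0 (ζ * a)) W (pdy u) ≤
        (1 + τ) * ((1 - ζ) * wsq (strip h (ζ * a) a) (fun y => W (ζ / (1 - ζ) * (a - y))) (pdy u)) +
          (1 + τ⁻¹) * e ∧
      (1 - ζ) * wsq (strip h (ζ * a) a) (fun y => W (ζ / (1 - ζ) * (a - y))) (pdy u) ≤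
        (1 + τ) * (ζ * wsq (strip h 0 (ζ * a)) W (pdy u)) + (1 + τ⁻¹) * e := by
  obtain ⟨V₁, V₂, hV⟩ := hW.concave ζ (Ioo_subset_Ioc_self hζ)
  have hlow := hd.memLp_mul_pdy_comp ζ 0 ζ
  have hup := hd.memLp_mul_pdy_comp (-(1 - ζ)) a (1 - ζ)
  have he := mul_le_mul_of_nonneg_left hfold (by positivity : 0 ≤ 1 + τ⁻¹)
  rw [← wsq_comp_fold_lower hζ.1, ← wsq_comp_fold_upper hζ.2]
  constructor
  · exact (wsq_le_add hV.isWeight hlow hup (hlow.add hup) fun p _ =>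
      sq_le_young hτ _ rfl).trans (add_le_add le_rfl he)
  · exact (wsq_le_add hV.isWeight hup hlow (hlow.add hup) fun p _ =>
      sq_le_young hτ _ (add_comm _ _)).trans (add_le_add le_rfl he)

theorem exists_absorb_folds (hθ0 : 0 < θ) (hθ1 : θ < 1) : ∃ τ C : ℝ, 0 < τ ∧ 0 < C ∧
    ∀ X X' Y Y' e : ℝ, 0 ≤ X' → X ≤ X' → Y' ≤ 2 * θ * Y →
      (1 - 1 / 2) * Y ≤ (1 + τ) * (1 / 2 * X) + (1 + τ⁻¹) * e →
      2 / 3 * X' ≤ (1 + τ) * ((1 - 2 / 3) * Y') + (1 + τ⁻¹) * e → X' ≤ C * e := by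
  set τ := (1 - θ) / 3 with hτ
  have hτ0 : 0 < τ := by linarith
  refine ⟨τ, ((1 + τ) * θ * 2 + 3 / 2) * (1 + τ⁻¹) / τ, hτ0, by positivity,
    fun X X' Y Y' e hX' hXX' hYY' hY hX => ?_⟩
  have hcontract : (1 + τ) ^ 2 * θ ≤ 1 - τ := by
    rw [show θ = 1 - 3 * τ by linarith]
    nlinarith [mul_pos hτ0 hτ0, mul_pos (mul_pos hτ0 hτ0) hτ0]
  have hYX : Y ≤ (1 + τ) * X' + 2 * (1 + τ⁻¹) * e := by
    linarith [mul_le_mul_of_nonneg_left hXX' (by positivity : 0 ≤ 1 + τ)]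
  have hXY : X' ≤ (1 + τ) * θ * Y + 3 / 2 * (1 + τ⁻¹) * e := by
    linarith [mul_le_mul_of_nonneg_left hYY' (by positivity : 0 ≤ (1 + τ) / 3)]
  have habsorb : X' ≤ (1 - τ) * X' + ((1 + τ) * θ * 2 + 3 / 2) * (1 + τ⁻¹) * e := by
    linarith [mul_le_mul_of_nonneg_left hYX (by positivity : 0 ≤ (1 + τ) * θ),
      mul_le_mul_of_nonneg_right hcontract hX']
  rw [div_mul_eq_mul_div, le_div_iff₀ hτ0]
  linarith

theorem PowerLikeWeight.wsq_fold_le (hW : PowerLikeWeight a K θ W) (hθ : 0 ≤ θ) (ha : 0 ≤ a)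
    {f : ℝ × ℝ → ℝ} (hf : MemLp f 2 (volume.restrict (rect h a))) :
    wsq (strip h (2 / 3 * a) a) (fun y => W (2 / 3 / (1 - 2 / 3) * (a - y))) f ≤
      2 * θ * wsq (strip h (1 / 2 * a) a) (fun y => W (1 / 2 / (1 - 1 / 2) * (a - y))) f := by
  have hreflect : IsWeight a fun y => W (1 / 2 / (1 - 1 / 2) * (a - y)) := by
    norm_num
    exact ⟨hW.continuousOn.comp (by fun_prop) fun y hy => ⟨by linarith [hy.2], by linarith [hy.1]⟩,
      fun y hy => hW.nonneg _ ⟨by linarith [hy.2], by linarith [hy.1]⟩⟩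
  refine wsq_strip_le (by positivity) hreflect hf (by positivity) (by linarith) le_rfl le_rfl
    fun y hy => ?_
  norm_num
  exact ⟨hW.nonneg _ ⟨by linarith [hy.2], by linarith [hy.1]⟩,
    hW.doubling _ ⟨by linarith [hy.2], by linarith [hy.1]⟩⟩

theorem exists_lower_le (hK : 0 ≤ K) (hθ0 : 0 < θ) (hθ1 : θ < 1) : ∃ C : ℝ, 0 < C ∧
    ∀ {h a : ℝ} {W : ℝ → ℝ} {u F G : ℝ × ℝ → ℝ}, PowerLikeWeight a K θ W →
      KornData h a u F G → (∀ x, u (x, 0) = u (x, a)) →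
      wsq (strip h 0 (2 / 3 * a)) W (pdy u) ≤ C * dataBound h a W u F G := by
  obtain ⟨C, hC, hfold⟩ := exists_fold_le hK
  obtain ⟨τ, C', hτ, hC', habsorb⟩ := exists_absorb_folds hθ0 hθ1
  refine ⟨C' * C, by positivity, fun {h a W u F G} hW hd hper => ?_⟩
  have ha := hd.height_pos
  have hnonneg : 0 ≤ wsq (strip h 0 (2 / 3 * a)) W (pdy u) :=
    setIntegral_nonneg (measurableSet_strip _ _ _) fun p hp =>
      mul_nonneg (hW.nonneg_of_mem_rect (strip_subset_rect le_rfl (by linarith) hp)) (sq_nonneg _)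
  have hmono : wsq (strip h 0 (1 / 2 * a)) W (pdy u) ≤ wsq (strip h 0 (2 / 3 * a)) W (pdy u) := by
    simpa using wsq_strip_le zero_le_one hW.toIsWeight hd.memLp_pdy le_rfl le_rfl
      (by linarith : 1 / 2 * a ≤ 2 / 3 * a) (by linarith) fun y hy =>
        ⟨hW.nonneg y ⟨hy.1.le, by linarith [hy.2]⟩, (one_mul _).ge⟩
  have hhalf := (hd.fold_young hW (by norm_num) hτ
    (hfold hW hd hper (left_mem_Icc.2 (by norm_num)))).2
  have htwo_thirds := (hd.fold_young hW (by norm_num) hτ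
    (hfold hW hd hper (right_mem_Icc.2 (by norm_num)))).1
  rw [mul_assoc]
  exact habsorb _ _ _ _ _ hnonneg hmono (hW.wsq_fold_le hθ0.le ha.le hd.memLp_pdy) hhalf
    htwo_thirds

theorem exists_four_fold_le {K : ℝ} (hK : 0 ≤ K) : ∃ C : ℝ, 0 < C ∧
    ∀ {h a θ : ℝ} {W : ℝ → ℝ} {u F G : ℝ × ℝ → ℝ}, PowerLikeWeight a K θ W →
      KornData h a u F G →
      wsq (rect h a) (fun _ => W a) (fun p =>
        -(2 / 3) * pdy u (diagAffine 1 0 (-(2 / 3)) a p) +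
          1 / 3 * pdy u (diagAffine 1 0 (-(1 / 3)) a p) +
          1 / 6 * pdy u (diagAffine 1 0 (1 / 6) (a / 2) p) +
          1 / 6 * pdy u (diagAffine 1 0 (-(1 / 6)) (a / 2) p)) ≤ C * dataBound h a W u F G := by
  obtain ⟨C, hC, hkorn⟩ := exists_korn_combination hK 4
  refine ⟨C, hC, fun {h a θ W u F G} hW hd => ?_⟩
  have ha := hd.height_pos
  have hmem (i : Fin 4) (y : ℝ) (hy : y ∈ Ioo 0 a) :
      (![-(2 / 3), -(1 / 3), 1 / 6, -(1 / 6)] : Fin 4 → ℝ) i * y +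
        (![a, a, a / 2, a / 2] : Fin 4 → ℝ) i ∈ Ioo (a / 3) a := by
    obtain ⟨hy0, hya⟩ := hy
    fin_cases i <;> simp <;> constructor <;> linarith
  have hbound := hkorn (concaveWeight_const (hW.nonneg a (right_mem_Icc.2 ha.le))) hW.toIsWeight hd
    (μ := ![1, -1, 1, -1]) (t := ![-(2 / 3), -(1 / 3), 1 / 6, -(1 / 6)])
    (s := ![a, a, a / 2, a / 2]) (by intro i; fin_cases i <;> simp)
    (by intro i; fin_cases i <;> norm_num [abs_div])
    (fun i y hy => hW.top_le _ (Ioo_subset_Icc_self (hmem i y hy)))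
    (fun i y hy => Ioo_subset_Ioo_left (by positivity) (hmem i y hy))
    (fun x => by simp [Fin.sum_univ_four])
    (fun x => by
      have hthird : -(2 / 3) * a + a = -(1 / 6) * a + a / 2 := by ring
      have htwo_thirds : -(1 / 3) * a + a = 1 / 6 * a + a / 2 := by ring
      simp only [Fin.sum_univ_four, Matrix.cons_val]
      rw [hthird, htwo_thirds]
      ring)
  simpa [Fin.sum_univ_four] using hbound

theorem sq_le_add_sum_four (x₁ x₂ x₃ x₄ : ℝ) : x₁ ^ 2 ≤
    3 / 2 * x₂ ^ 2 + 9 * (x₁ + x₂ + x₃ + x₄) ^ 2 + 9 * x₃ ^ 2 + 9 * x₄ ^ 2 := by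
  have hpair : x₁ ^ 2 ≤ 3 / 2 * x₂ ^ 2 + 3 * (x₁ + x₂) ^ 2 := by
    linarith [sq_nonneg (2 * x₁ + 3 * x₂)]
  have hsum : (x₁ + x₂) ^ 2 ≤ 3 * ((x₁ + x₂ + x₃ + x₄) ^ 2 + x₃ ^ 2 + x₄ ^ 2) := by
    linarith [sq_nonneg (x₁ + x₂ + x₃ + x₄ + x₃), sq_nonneg (x₁ + x₂ + x₃ + x₄ + x₄),
      sq_nonneg (x₃ - x₄)]
  linarith

theorem wsq_le_add_sum_four {V : ℝ → ℝ} (hV : IsWeight a V) {f₁ f₂ f₃ f₄ : ℝ × ℝ → ℝ}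
    (h₁ : MemLp f₁ 2 (volume.restrict (rect h a))) (h₂ : MemLp f₂ 2 (volume.restrict (rect h a)))
    (h₃ : MemLp f₃ 2 (volume.restrict (rect h a))) (h₄ : MemLp f₄ 2 (volume.restrict (rect h a))) :
    wsq (rect h a) V f₁ ≤ 3 / 2 * wsq (rect h a) V f₂ +
      9 * wsq (rect h a) V (fun p => f₁ p + f₂ p + f₃ p + f₄ p) + 9 * wsq (rect h a) V f₃ +
        9 * wsq (rect h a) V f₄ := by
  have hadd : MemLp (fun p => f₁ p + f₂ p + f₃ p + f₄ p) 2 (volume.restrict (rect h a)) :=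
    ((h₁.add h₂).add h₃).add h₄
  have hsum := wsq_le_sum (I := Finset.univ) (c := ![3 / 2, 9, 9, 9])
    (g := ![f₂, fun p => f₁ p + f₂ p + f₃ p + f₄ p, f₃, f₄]) hV h₁
    (by simp [Fin.forall_fin_succ, h₂, h₃, h₄, hadd]) fun p _ => by
        simpa [Fin.sum_univ_four] using sq_le_add_sum_four (f₁ p) (f₂ p) (f₃ p) (f₄ p)
  simpa [Fin.sum_univ_four] using hsum

/-- On the middle third the weight is comparable with `W a`, so the four strips of the
combination are controlled by the lower strip and the upper one itself. -/
theorem exists_upper_le (hK : 0 ≤ K) : ∃ C : ℝ, 0 < C ∧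
    ∀ {h a θ : ℝ} {W : ℝ → ℝ} {u F G : ℝ × ℝ → ℝ}, PowerLikeWeight a K θ W →
      KornData h a u F G →
      wsq (strip h (a / 3) a) (fun _ => W a) (pdy u) ≤
        54 * wsq (strip h 0 (2 / 3 * a)) W (pdy u) + C * dataBound h a W u F G := by
  obtain ⟨C, hC, hfold⟩ := exists_four_fold_le hK
  refine ⟨54 * C, by positivity, fun {h a θ W u F G} hW hd => ?_⟩
  have ha := hd.height_pos
  have hWa : 0 ≤ W a := hW.nonneg a (right_mem_Icc.2 ha.le)
  have hV : IsWeight a fun _ => W a := ⟨continuousOn_const, fun _ _ => hWa⟩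
  have htop : wsq (strip h (2 / 3 * a) a) (fun _ => W a) (pdy u) ≤
      wsq (strip h (a / 3) a) (fun _ => W a) (pdy u) := by
    simpa using wsq_strip_le zero_le_one hV hd.memLp_pdy (by positivity)
      (by linarith : a / 3 ≤ 2 / 3 * a) le_rfl le_rfl fun y _ => ⟨hWa, (one_mul _).ge⟩
  have hmid (b c : ℝ) (hb : a / 3 ≤ b) (hc : c ≤ 2 / 3 * a) :
      wsq (strip h b c) (fun _ => W a) (pdy u) ≤ 3 * wsq (strip h 0 (2 / 3 * a)) W (pdy u) :=
    wsq_strip_le zero_le_three hW.toIsWeight hd.memLp_pdy le_rfl (by linarith) hc (by linarith)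
      fun y hy => ⟨hWa, hW.top_le y ⟨by linarith [hy.1], by linarith [hy.2]⟩⟩
  have hterm {t r s b c κ : ℝ} (ht : t ≠ 0) (hr : r ^ 2 = t ^ 2) (hκ : |t| = κ)
      (hI : ∀ y, t * y + s ∈ Ioo b c ↔ y ∈ Ioo 0 a) :
      wsq (rect h a) (fun _ => W a) (fun p => r * pdy u (diagAffine 1 0 t s p)) =
        κ * wsq (strip h b c) (fun _ => W a) (pdy u) :=
    hκ ▸ wsq_comp_vertical (W := fun _ => W a) ht hr hI (fun _ _ => rfl) (pdy u)
  have hfour := wsq_le_add_sum_four hV (hd.memLp_mul_pdy_comp (-(2 / 3)) a (-(2 / 3)))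
    (hd.memLp_mul_pdy_comp (-(1 / 3)) a (1 / 3)) (hd.memLp_mul_pdy_comp (1 / 6) (a / 2) (1 / 6))
    (hd.memLp_mul_pdy_comp (-(1 / 6)) (a / 2) (1 / 6))
  rw [hterm (b := a / 3) (c := a) (κ := 2 / 3),
    hterm (b := 2 / 3 * a) (c := a) (κ := 1 / 3),
    hterm (b := a / 2) (c := 2 / 3 * a) (κ := 1 / 6),
    hterm (b := a / 3) (c := a / 2) (κ := 1 / 6)] at hfour
  · linarith [hfold hW hd, hmid (a / 2) (2 / 3 * a) (by linarith) le_rfl,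
      hmid (a / 3) (a / 2) le_rfl (by linarith)]
  all_goals first
    | (norm_num [abs_div]; done)
    | (intro y; constructor <;> rintro ⟨h₁, h₂⟩ <;> constructor <;> linarith)

theorem exists_korn_periodic (hK : 0 ≤ K) (hθ0 : 0 < θ) (hθ1 : θ < 1) : ∃ C : ℝ, 0 < C ∧
    ∀ {h a : ℝ} {W : ℝ → ℝ} {u F G : ℝ × ℝ → ℝ}, PowerLikeWeight a K θ W →
      KornData h a u F G → (∀ x, u (x, 0) = u (x, a)) →
      wsq (rect h a) W (pdy u) ≤ C * dataBound h a W u F G := by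
  obtain ⟨C, hC, hlower⟩ := exists_lower_le hK hθ0 hθ1
  obtain ⟨C', hC', hupper⟩ := exists_upper_le hK
  refine ⟨55 * C + C', by positivity, fun {h a W u F G} hW hd hper => ?_⟩
  have ha := hd.height_pos
  have hWa : 0 ≤ W a := hW.nonneg a (right_mem_Icc.2 ha.le)
  have hcover : rect h a ⊆ strip h 0 (2 / 3 * a) ∪ strip h (a / 3) a := fun p hp =>
    (lt_or_ge p.2 (2 / 3 * a)).imp (fun hlt => ⟨hp.1, hp.2.1, hlt⟩)
      fun hge => ⟨hp.1, by linarith, hp.2.2⟩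
  have hsplit := wsq_le_add_of_subset_union hW.toIsWeight hd.memLp_pdy (measurableSet_strip _ _ _)
    (measurableSet_strip _ _ _) (strip_subset_rect le_rfl (by linarith))
    (strip_subset_rect (by positivity) le_rfl) hcover
  have htop : wsq (strip h (a / 3) a) W (pdy u) ≤
      wsq (strip h (a / 3) a) (fun _ => W a) (pdy u) := by
    have hconst : IsWeight a fun _ => W a := ⟨continuousOn_const, fun _ _ => hWa⟩
    simpa using wsq_strip_le zero_le_one hconst hd.memLp_pdy (by positivity) le_rfl le_rfl le_rfl
      fun y hy => by
        have hy' : y ∈ Icc 0 a := ⟨by linarith [hy.1], hy.2.le⟩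
        exact ⟨hW.nonneg y hy', by simpa using hW.mono hy' (right_mem_Icc.2 ha.le) hy'.2⟩
  linarith [hlower hW hd hper, hupper hW hd]

end Fold

/-! ### Sums of powers as weights -/

/-- The sum of powers `∑ᵢ cᵢ r ^ αᵢ`; the weight of the theorem is its value at the distance to a
side. Its derivatives are again of this form. -/
noncomputable def powSum {k : ℕ} (c α : Fin k → ℝ) (r : ℝ) : ℝ := ∑ i, c i * r ^ α i

section PowSum

variable {k : ℕ} {c α : Fin k → ℝ} {a β ε ζ r : ℝ}

theorem powSum_nonneg (hc : ∀ i, 0 ≤ c i) (hr : 0 ≤ r) : 0 ≤ powSum c α r :=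
  Finset.sum_nonneg fun i _ => mul_nonneg (hc i) (Real.rpow_nonneg hr _)

theorem powSum_mono (hc : ∀ i, 0 ≤ c i) (hα : ∀ i, 0 ≤ α i) {s : ℝ} (hr : 0 ≤ r) (hrs : r ≤ s) :
    powSum c α r ≤ powSum c α s :=
  Finset.sum_le_sum fun i _ => mul_le_mul_of_nonneg_left (Real.rpow_le_rpow hr hrs (hα i)) (hc i)

theorem powSum_mul_le (hc : ∀ i, 0 ≤ c i) (hα : ∀ i, α i ≤ β) {m : ℝ} (hm : 1 ≤ m) (hr : 0 ≤ r) :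
    powSum c α (m * r) ≤ m ^ β * powSum c α r := by
  rw [powSum, powSum, Finset.mul_sum]
  refine Finset.sum_le_sum fun i _ => ?_
  rw [Real.mul_rpow (zero_le_one.trans hm) hr, mul_left_comm]
  exact mul_le_mul_of_nonneg_right (Real.rpow_le_rpow_of_exponent_le hm (hα i))
    (mul_nonneg (hc i) (Real.rpow_nonneg hr _))

theorem contDiffAt_powSum (hr : 0 < r) : ContDiffAt ℝ ∞ (powSum c α) r :=
  ContDiffAt.sum fun _ _ => contDiffAt_const.mul (Real.contDiffAt_rpow_const_of_ne hr.ne')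

theorem hasDerivAt_powSum (hr : 0 < r) :
    HasDerivAt (powSum c α) (powSum (fun i => c i * α i) (fun i => α i - 1) r) r := by
  have hsum : HasDerivAt (fun r => ∑ i, c i * r ^ α i) (∑ i, c i * (α i * r ^ (α i - 1))) r :=
    HasDerivAt.fun_sum fun i _ => (Real.hasDerivAt_rpow_const (Or.inl hr.ne')).const_mul (c i)
  exact hsum.congr_deriv (Finset.sum_congr rfl fun i _ => by ring)

theorem mul_powSum_deriv_le (hc : ∀ i, 0 ≤ c i) (hα : ∀ i, α i ≤ β) (hr : 0 < r) :
    r * powSum (fun i => c i * α i) (fun i => α i - 1) r ≤ β * powSum c α r := by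
  rw [powSum, powSum, Finset.mul_sum, Finset.mul_sum]
  refine Finset.sum_le_sum fun i _ => ?_
  calc r * (c i * α i * r ^ (α i - 1)) = α i * (c i * r ^ α i) := by
        rw [Real.rpow_sub_one hr.ne']
        field_simp
    _ ≤ β * (c i * r ^ α i) :=
        mul_le_mul_of_nonneg_right (hα i) (mul_nonneg (hc i) (Real.rpow_nonneg hr.le _))

theorem sq_concavity_of_mul_le {F F₁ F₂ : ℝ} (hβ : β < 1 / 2) (hr : 0 < r) (hF : 0 ≤ F)
    (hF₁ : 0 ≤ F₁) (h₁ : r * F₁ ≤ β * F) (h₂ : r * F₂ ≤ (β - 1) * F₁) :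
    F₁ ^ 2 + F * F₂ ≤ 0 ∧ 2 * F₁ ^ 2 ≤ 1 / (1 - 2 * β) * -(F₁ ^ 2 + F * F₂) := by
  have hβ' : 0 < 1 - 2 * β := by linarith
  have hFF₁ : 0 ≤ F * F₁ := mul_nonneg hF hF₁
  have hsq : r * F₁ ^ 2 ≤ β * (F * F₁) := by nlinarith
  have hconcave : r * (F₁ ^ 2 + F * F₂) ≤ -((1 - 2 * β) * (F * F₁)) := by nlinarith
  refine ⟨nonpos_of_mul_nonpos_right (hconcave.trans (neg_nonpos.2 (mul_nonneg hβ'.le hFF₁))) hr,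
    ?_⟩
  rw [div_mul_eq_mul_div, one_mul, le_div_iff₀ hβ']
  refine le_of_mul_le_mul_left ?_ hr
  calc r * (2 * F₁ ^ 2 * (1 - 2 * β)) = 2 * (1 - 2 * β) * (r * F₁ ^ 2) := by ring
    _ ≤ 2 * (1 - 2 * β) * (β * (F * F₁)) := by gcongr
    _ = 2 * β * ((1 - 2 * β) * (F * F₁)) := by ring
    _ ≤ (1 - 2 * β) * (F * F₁) :=
        mul_le_of_le_one_left (mul_nonneg hβ'.le hFF₁) (by linarith)
    _ ≤ r * -(F₁ ^ 2 + F * F₂) := by linarith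

theorem contDiffAt_powSum_affine (hr : 0 < ζ * r + ε) :
    ContDiffAt ℝ ∞ (fun y => powSum c α (ζ * y + ε)) r :=
  ContDiffAt.comp (g := powSum c α) r (contDiffAt_powSum hr) (by fun_prop)

theorem hasDerivAt_powSum_affine (hr : 0 < ζ * r + ε) :
    HasDerivAt (fun y => powSum c α (ζ * y + ε))
      (powSum (fun i => c i * α i) (fun i => α i - 1) (ζ * r + ε) * ζ) r :=
  (hasDerivAt_powSum hr).comp (h := fun y => ζ * y + ε) r
    (by simpa using ((hasDerivAt_id r).const_mul ζ).add_const ε)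

theorem exists_concaveWeight_powSum (hβ : β < 1 / 2) (hc : ∀ i, 0 ≤ c i)
    (hα : ∀ i, α i ∈ Icc 0 β) (hε : 0 < ε) (hζ : 0 < ζ) :
    ∃ V₁ V₂, ConcaveWeight a (1 / (1 - 2 * β)) (fun y => powSum c α (ζ * y + ε) ^ 2) V₁ V₂ := by
  have hpos : ∀ y ∈ Icc 0 a, 0 < ζ * y + ε := fun y hy =>
    add_pos_of_nonneg_of_pos (mul_nonneg hζ.le hy.1) hε
  set f := powSum c α with hf
  set f₁ := powSum (fun i => c i * α i) (fun i => α i - 1) with hf₁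
  set f₂ := powSum (fun i => c i * α i * (α i - 1)) (fun i => α i - 1 - 1)
  have hcα : ∀ i, 0 ≤ c i * α i := fun i => mul_nonneg (hc i) (hα i).1
  have hconcave : ∀ y ∈ Icc 0 a, f₁ (ζ * y + ε) ^ 2 + f (ζ * y + ε) * f₂ (ζ * y + ε) ≤ 0 ∧
      2 * f₁ (ζ * y + ε) ^ 2 ≤
        1 / (1 - 2 * β) * -(f₁ (ζ * y + ε) ^ 2 + f (ζ * y + ε) * f₂ (ζ * y + ε)) := fun y hy =>
    sq_concavity_of_mul_le hβ (hpos y hy) (powSum_nonneg hc (hpos y hy).le)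
      (powSum_nonneg hcα (hpos y hy).le) (mul_powSum_deriv_le hc (fun i => (hα i).2) (hpos y hy))
      (mul_powSum_deriv_le hcα (fun i => sub_le_sub_right (hα i).2 1) (hpos y hy))
  refine ⟨fun y => 2 * f (ζ * y + ε) * (f₁ (ζ * y + ε) * ζ),
    fun y => 2 * ζ ^ 2 * (f₁ (ζ * y + ε) ^ 2 + f (ζ * y + ε) * f₂ (ζ * y + ε)), ?_⟩
  constructor
  case smooth => exact fun y hy => (contDiffAt_powSum_affine (hpos y hy)).pow 2
  case hasDerivAt =>
    exact fun y hy => ((hasDerivAt_powSum_affine (hpos y hy)).pow 2).congr_deriv (by simp [hf, hf₁])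
  case hasDerivAt₁ =>
    exact fun y hy => (((hasDerivAt_powSum_affine (hpos y hy)).const_mul 2).mul
      ((hasDerivAt_powSum_affine (hpos y hy)).mul_const ζ)).congr_deriv (by ring)
  case continuousOn₂ =>
    have hcont : ∀ c α : Fin k → ℝ, ContinuousOn (fun y => powSum c α (ζ * y + ε)) (Icc 0 a) :=
      fun c α y hy => (contDiffAt_powSum_affine (hpos y hy)).continuousAt.continuousWithinAt
    exact (((hcont _ _).pow 2).add ((hcont _ _).mul (hcont _ _))).const_mul _
  case nonneg => exact fun y _ => sq_nonneg _
  case nonpos₂ => exact fun y hy => mul_nonpos_of_nonneg_of_nonpos (by positivity) (hconcave y hy).1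
  case sq_le =>
    intro y hy
    have := mul_le_mul_of_nonneg_left (hconcave y hy).2
      (by positivity : 0 ≤ 2 * ζ ^ 2 * f (ζ * y + ε) ^ 2)
    linarith

theorem powSum_sq_le_rpow_mul (hc : ∀ i, 0 ≤ c i) (hα : ∀ i, α i ∈ Icc 0 β) (hε : 0 ≤ ε)
    {m y z : ℝ} (hm : 1 ≤ m) (hy : 0 ≤ y) (hz : 0 ≤ z) (hzy : z ≤ m * y) :
    powSum c α (z + ε) ^ 2 ≤ m ^ (2 * β) * powSum c α (y + ε) ^ 2 := by
  rw [mul_comm 2 β, Real.rpow_mul (by linarith), Real.rpow_two, ← mul_pow]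
  refine pow_le_pow_left₀ (powSum_nonneg hc (add_nonneg hz hε)) ?_ 2
  calc powSum c α (z + ε) ≤ powSum c α (m * (y + ε)) :=
        powSum_mono hc (fun i => (hα i).1) (add_nonneg hz hε) (by nlinarith)
    _ ≤ m ^ β * powSum c α (y + ε) := powSum_mul_le hc (fun i => (hα i).2) hm (add_nonneg hy hε)

theorem powerLikeWeight_powSum (hβ : β < 1 / 2) (hc : ∀ i, 0 ≤ c i) (hα : ∀ i, α i ∈ Icc 0 β)
    (ha : 0 < a) (hε : 0 < ε) :
    PowerLikeWeight a (1 / (1 - 2 * β)) ((2 : ℝ) ^ (2 * β) / 2)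
      (fun y => powSum c α (y + ε) ^ 2) where
  continuousOn y hy := by
    have hcont : ContinuousAt (fun y => powSum c α (1 * y + ε)) y :=
      (contDiffAt_powSum_affine (by linarith [hy.1])).continuousAt
    simp only [one_mul] at hcont
    exact (hcont.pow 2).continuousWithinAt
  nonneg y _ := sq_nonneg _
  mono y hy z _ hyz := pow_le_pow_left₀ (powSum_nonneg hc (by linarith [hy.1]))
    (powSum_mono hc (fun i => (hα i).1) (by linarith [hy.1]) (by linarith)) 2
  doubling y hy := by
    rw [mul_div_cancel₀ _ two_ne_zero]
    exact powSum_sq_le_rpow_mul hc hα hε.le one_le_two hy.1 (by linarith [hy.1]) le_rfl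
  top_le y hy := by
    have hy0 : 0 ≤ y := by linarith [hy.1]
    have h3 : (3 : ℝ) ^ (2 * β) ≤ 3 :=
      (Real.rpow_le_rpow_of_exponent_le (by norm_num) (by linarith)).trans_eq (Real.rpow_one 3)
    calc powSum c α (a + ε) ^ 2 ≤ 3 ^ (2 * β) * powSum c α (y + ε) ^ 2 :=
          powSum_sq_le_rpow_mul hc hα hε.le (by norm_num) hy0 ha.le (by linarith [hy.1])
      _ ≤ 3 * powSum c α (y + ε) ^ 2 := by gcongr
  concave ζ hζ := exists_concaveWeight_powSum hβ hc hα hε hζ.1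

end PowSum

/-! ### Approximation by smooth functions with equal boundary values -/

section MeanSquare

variable {α : Type*} [MeasurableSpace α] {μ : Measure α}

theorem integral_sq_eq_toReal_eLpNorm_sq {f : α → ℝ} (hf : MemLp f 2 μ) :
    ∫ x, f x ^ 2 ∂μ = (eLpNorm f 2 μ).toReal ^ 2 := by
  have hnonneg : 0 ≤ ∫ x, f x ^ 2 ∂μ := integral_nonneg fun x => sq_nonneg _
  rw [hf.eLpNorm_eq_integral_rpow_norm (by norm_num) (by norm_num)]
  simp only [ENNReal.toReal_ofNat, Real.rpow_ofNat, Real.norm_eq_abs, sq_abs]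
  rw [ENNReal.toReal_ofReal (Real.rpow_nonneg hnonneg _), ← Real.rpow_natCast,
    ← Real.rpow_mul hnonneg]
  norm_num

theorem tendsto_integral_sq_of_eLpNorm {f : ℕ → α → ℝ} (hf : ∀ n, MemLp (f n) 2 μ)
    (ht : Tendsto (fun n => eLpNorm (f n) 2 μ) atTop (𝓝 0)) :
    Tendsto (fun n => ∫ x, f n x ^ 2 ∂μ) atTop (𝓝 0) := by
  simp only [fun n => integral_sq_eq_toReal_eLpNorm_sq (hf n)]
  simpa using ((ENNReal.tendsto_toReal ENNReal.zero_ne_top).comp ht).pow 2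

theorem integral_add_sq_le {f g : α → ℝ} (hf : MemLp f 2 μ) (hg : MemLp g 2 μ) :
    ∫ x, (f x + g x) ^ 2 ∂μ ≤ 2 * ∫ x, f x ^ 2 ∂μ + 2 * ∫ x, g x ^ 2 ∂μ := by
  have hf2 := hf.integrable_sq.const_mul 2
  have hg2 := hg.integrable_sq.const_mul 2
  rw [← integral_const_mul, ← integral_const_mul, ← integral_add hf2 hg2]
  refine integral_mono (hf.add hg).integrable_sq (hf2.add hg2) fun x => ?_
  linarith [add_sq_le (a := f x) (b := g x)]

theorem integral_sub_sq_le {f g k : α → ℝ} (hf : MemLp f 2 μ) (hg : MemLp g 2 μ)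
    (hk : MemLp k 2 μ) :
    ∫ x, (f x - k x) ^ 2 ∂μ ≤ 2 * ∫ x, (f x - g x) ^ 2 ∂μ + 2 * ∫ x, (g x - k x) ^ 2 ∂μ := by
  simpa only [Pi.sub_apply, sub_add_sub_cancel] using integral_add_sq_le (hf.sub hg) (hg.sub hk)

theorem tendsto_integral_sub_sq {f g k : ℕ → α → ℝ} (hf : ∀ n, MemLp (f n) 2 μ)
    (hg : ∀ n, MemLp (g n) 2 μ) (hk : ∀ n, MemLp (k n) 2 μ)
    (hfg : Tendsto (fun n => ∫ x, (f n x - g n x) ^ 2 ∂μ) atTop (𝓝 0))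
    (hgk : Tendsto (fun n => ∫ x, (g n x - k n x) ^ 2 ∂μ) atTop (𝓝 0)) :
    Tendsto (fun n => ∫ x, (f n x - k n x) ^ 2 ∂μ) atTop (𝓝 0) :=
  squeeze_zero (fun _ => integral_nonneg fun _ => sq_nonneg _)
    (fun n => integral_sub_sq_le (hf n) (hg n) (hk n))
    (by simpa using (hfg.const_mul 2).add (hgk.const_mul 2))

end MeanSquare

section Poincare

variable {a h δ : ℝ} {f g : ℝ × ℝ → ℝ}

theorem rect_mono_height (hδ : δ ≤ a) : rect h δ ⊆ rect h a :=
  prod_mono subset_rfl (Ioo_subset_Ioo_right hδ)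

theorem memLp_Ioo_of_continuous {b c : ℝ} {g : ℝ → ℝ} (hg : Continuous g) :
    MemLp g 2 (volume.restrict (Ioo b c)) := by
  obtain ⟨C, hC⟩ := (isCompact_Icc (a := b) (b := c)).exists_bound_of_continuousOn hg.continuousOn
  exact MemLp.of_bound hg.aestronglyMeasurable C ((ae_restrict_iff' measurableSet_Ioo).2
    (Eventually.of_forall fun y hy => hC y (Ioo_subset_Icc_self hy)))

theorem memLp_rect_of_continuous (hf : Continuous f) : MemLp f 2 (volume.restrict (rect h a)) :=
  memLp_rect_of_continuousOn hf.continuousOn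

theorem continuous_fderiv_apply (hf : ContDiff ℝ ∞ f) (e : ℝ × ℝ) :
    Continuous fun p => fderiv ℝ f p e :=
  (contDiff_fderiv_apply hf e).continuous

theorem setIntegral_rect_mono_of_slice (hf : Continuous f) (hg : Continuous g)
    (hle : ∀ x, ∫ y in Ioo 0 a, f (x, y) ≤ ∫ y in Ioo 0 a, g (x, y)) :
    ∫ p in rect h a, f p ≤ ∫ p in rect h a, g p := by
  have hint {k : ℝ × ℝ → ℝ} (hk : Continuous k) :
      Integrable k ((volume.restrict (Ioo 0 h)).prod (volume.restrict (Ioo 0 a))) := by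
    rw [Measure.prod_restrict, ← Measure.volume_eq_prod]
    exact integrableOn_rect_of_continuousOn hk.continuousOn
  rw [rect, Measure.volume_eq_prod, ← Measure.prod_restrict, integral_prod _ (hint hf),
    integral_prod _ (hint hg)]
  exact integral_mono (hint hf).integral_prod_left (hint hg).integral_prod_left hle

theorem setIntegral_rect_comp_fst (hδ : 0 ≤ δ) (f : ℝ → ℝ) :
    ∫ p in rect h δ, f p.1 = δ * ∫ x in Ioo 0 h, f x := by
  rw [rect, Measure.volume_eq_prod]
  have hprod := setIntegral_prod_mul (μ := volume) (ν := volume) f (fun _ : ℝ => (1 : ℝ))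
    (Ioo 0 h) (Ioo 0 δ)
  simp only [mul_one] at hprod
  rw [hprod, setIntegral_const, Real.volume_real_Ioo_of_le hδ, sub_zero, smul_eq_mul, mul_one,
    mul_comm]

theorem sub_sq_le_mul_setIntegral_deriv_sq {g g' : ℝ → ℝ} (hg : ∀ t, HasDerivAt g (g' t) t)
    (hc : Continuous g') {y : ℝ} (hy : y ∈ Ioo 0 δ) :
    (g y - g 0) ^ 2 ≤ δ * ∫ t in Ioo 0 δ, g' t ^ 2 := by
  have hδ : 0 ≤ δ := hy.1.le.trans hy.2.le
  have hnonneg : 0 ≤ ∫ t in Ioo 0 δ, g' t ^ 2 :=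
    setIntegral_nonneg measurableSet_Ioo fun _ _ => sq_nonneg _
  have hftc : g y - g 0 = ∫ t in Ioc 0 y, g' t := by
    rw [← intervalIntegral.integral_of_le hy.1.le, intervalIntegral.integral_eq_sub_of_hasDerivAt
      (fun t _ => hg t) (hc.intervalIntegrable _ _)]
  have habs : |g y - g 0| ≤ ∫ t in Ioo 0 δ, |g' t| := by
    rw [hftc]
    refine abs_integral_le_integral_abs.trans (setIntegral_mono_subset
      (fun t ht => ⟨ht.1, ht.2.trans_lt hy.2⟩) measurableSet_Ioo ?_ fun _ _ => abs_nonneg _)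
    exact ((memLp_Ioo_of_continuous hc).integrable one_le_two).abs
  have hcs := integral_mul_le_sqrt_mul_sqrt (memLp_Ioo_of_continuous (b := 0) (c := δ) hc)
    (memLp_Ioo_of_continuous (continuous_const (y := 1)))
  simp only [abs_one, mul_one, one_pow, setIntegral_const, Real.volume_real_Ioo_of_le hδ, sub_zero,
    smul_eq_mul] at hcs
  calc (g y - g 0) ^ 2 = |g y - g 0| ^ 2 := (sq_abs _).symm
    _ ≤ (√(∫ t in Ioo 0 δ, g' t ^ 2) * √δ) ^ 2 := by
        gcongr
        exact habs.trans hcs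
    _ = δ * ∫ t in Ioo 0 δ, g' t ^ 2 := by
        rw [mul_pow, Real.sq_sqrt hnonneg, Real.sq_sqrt hδ, mul_comm]

theorem setIntegral_sub_bottom_sq_le (hδ : 0 ≤ δ) (hf : ContDiff ℝ ∞ f) :
    ∫ p in rect h δ, (f p - f (p.1, 0)) ^ 2 ≤ δ ^ 2 * ∫ p in rect h δ, pdy f p ^ 2 := by
  have hcf := hf.continuous
  have hcy : Continuous (pdy f) := continuous_fderiv_apply hf _
  rw [← integral_const_mul]
  refine setIntegral_rect_mono_of_slice (by fun_prop) (by fun_prop) fun x => ?_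
  have hslice : Continuous fun y => pdy f (x, y) := hcy.comp (by fun_prop)
  calc ∫ y in Ioo 0 δ, (f (x, y) - f (x, 0)) ^ 2
      ≤ ∫ _y in Ioo 0 δ, δ * ∫ t in Ioo 0 δ, pdy f (x, t) ^ 2 := by
        refine setIntegral_mono_on (MemLp.integrable_sq (memLp_Ioo_of_continuous (by fun_prop)))
          (integrable_const _) measurableSet_Ioo fun y hy => ?_
        exact sub_sq_le_mul_setIntegral_deriv_sq
          (fun t => hasDerivAt_slice_snd (hf.differentiable (by simp) _)) hslice hy
    _ = ∫ y in Ioo 0 δ, δ ^ 2 * pdy f (x, y) ^ 2 := by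
        rw [setIntegral_const, integral_const_mul, Real.volume_real_Ioo_of_le hδ, smul_eq_mul]
        ring

theorem setIntegral_sq_le_bottom (hδ : 0 ≤ δ) (hf : ContDiff ℝ ∞ f) :
    ∫ p in rect h δ, f p ^ 2 ≤
      2 * δ ^ 2 * (∫ p in rect h δ, pdy f p ^ 2) + 2 * δ * ∫ x in Ioo 0 h, f (x, 0) ^ 2 := by
  have hcf := hf.continuous
  have hsplit := integral_sub_sq_le (k := fun _ => 0)
    (memLp_rect_of_continuous (h := h) (a := δ) hcf)
    (memLp_rect_of_continuous (f := fun p => f (p.1, 0)) (by fun_prop))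
    (memLp_rect_of_continuous continuous_const)
  simp only [sub_zero] at hsplit
  rw [setIntegral_rect_comp_fst hδ fun x => f (x, 0) ^ 2] at hsplit
  linarith [setIntegral_sub_bottom_sq_le (h := h) hδ hf]

theorem mul_setIntegral_bottom_sq_le (ha : 0 ≤ a) (hf : ContDiff ℝ ∞ f) :
    a * ∫ x in Ioo 0 h, f (x, 0) ^ 2 ≤
      2 * (∫ p in rect h a, f p ^ 2) + 2 * a ^ 2 * ∫ p in rect h a, pdy f p ^ 2 := by
  have hcf := hf.continuous
  have hsplit := integral_sub_sq_le (k := fun _ => 0)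
    (memLp_rect_of_continuous (h := h) (a := a) (f := fun p => f (p.1, 0)) (by fun_prop))
    (memLp_rect_of_continuous hcf) (memLp_rect_of_continuous continuous_const)
  simp only [sub_zero, sub_sq_comm (f (_, 0))] at hsplit
  rw [setIntegral_rect_comp_fst ha fun x => f (x, 0) ^ 2] at hsplit
  linarith [setIntegral_sub_bottom_sq_le (h := h) ha hf]

end Poincare

section FirstJet

/-- The squared `H¹` norm on `S` of a triple `w = (u, u_x, u_y)`, the derivatives being weak or
classical. -/
noncomputable def sobolevSq (S : Set (ℝ × ℝ)) (w : Fin 3 → ℝ × ℝ → ℝ) : ℝ :=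
  ∑ i, ∫ p in S, w i p ^ 2

/-- The triple `(f, f_x, f_y)`. -/
noncomputable def firstJet (f : ℝ × ℝ → ℝ) : Fin 3 → ℝ × ℝ → ℝ := ![f, pdx f, pdy f]

/-- The odd part, up to a factor `2`, of a triple `(u, u_x, u_y)` under the reflection
`y ↦ a - y`; the reflection changes the sign of the last component. -/
def oddPart (a : ℝ) (w : Fin 3 → ℝ × ℝ → ℝ) (i : Fin 3) (p : ℝ × ℝ) : ℝ :=
  w i p - (![1, 1, -1] : Fin 3 → ℝ) i * w i (diagAffine 1 0 (-1) a p)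

variable {a h δ : ℝ} {f g : ℝ × ℝ → ℝ} {S : Set (ℝ × ℝ)} {w w' : Fin 3 → ℝ × ℝ → ℝ}

theorem sobolevSq_nonneg (S : Set (ℝ × ℝ)) (w : Fin 3 → ℝ × ℝ → ℝ) : 0 ≤ sobolevSq S w :=
  Finset.sum_nonneg fun _ _ => integral_nonneg fun _ => sq_nonneg _

theorem sobolevSq_add_le (hw : ∀ i, MemLp (w i) 2 (volume.restrict S))
    (hw' : ∀ i, MemLp (w' i) 2 (volume.restrict S)) :
    sobolevSq S (w + w') ≤ 2 * sobolevSq S w + 2 * sobolevSq S w' := by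
  simp only [sobolevSq, Finset.mul_sum, ← Finset.sum_add_distrib]
  exact Finset.sum_le_sum fun i _ => integral_add_sq_le (hw i) (hw' i)

theorem sobolevSq_neg (S : Set (ℝ × ℝ)) (w : Fin 3 → ℝ × ℝ → ℝ) :
    sobolevSq S (-w) = sobolevSq S w := by
  simp only [sobolevSq, Pi.neg_apply, neg_sq]

theorem sobolevSq_sub_le (hw : ∀ i, MemLp (w i) 2 (volume.restrict S))
    (hw' : ∀ i, MemLp (w' i) 2 (volume.restrict S)) :
    sobolevSq S (w - w') ≤ 2 * sobolevSq S w + 2 * sobolevSq S w' := by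
  rw [sub_eq_add_neg, ← sobolevSq_neg S w']
  exact sobolevSq_add_le hw fun i => (hw' i).neg

theorem sobolevSq_mono_height (hδ : δ ≤ a)
    (hw : ∀ i, MemLp (w i) 2 (volume.restrict (rect h a))) :
    sobolevSq (rect h δ) w ≤ sobolevSq (rect h a) w :=
  Finset.sum_le_sum fun i _ => setIntegral_mono_subset (rect_mono_height hδ)
    (measurableSet_rect h a) (hw i).integrable_sq fun _ _ => sq_nonneg _

theorem tendsto_sobolevSq_strip (ha : 0 < a)
    (hw : ∀ i, MemLp (w i) 2 (volume.restrict (rect h a))) :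
    Tendsto (fun n : ℕ => sobolevSq (rect h (a / (n + 1))) w) atTop (𝓝 0) := by
  have hempty : ⋂ n : ℕ, rect h (a / (n + 1)) = ∅ := by
    refine eq_empty_iff_forall_notMem.2 fun p hp => ?_
    rw [mem_iInter] at hp
    have hlim : Tendsto (fun n : ℕ => a / ((n : ℝ) + 1)) atTop (𝓝 0) := by
      simpa only [mul_one_div, mul_zero] using tendsto_one_div_add_atTop_nhds_zero_nat.const_mul a
    exact (hp 0).2.1.not_ge (ge_of_tendsto' hlim fun n => (hp n).2.2.le)
  suffices ∀ i, Tendsto (fun n : ℕ => ∫ p in rect h (a / (n + 1)), w i p ^ 2) atTop (𝓝 0) by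
    simpa [sobolevSq] using tendsto_finsetSum Finset.univ fun i _ => this i
  intro i
  have hanti := tendsto_setIntegral_of_antitone (μ := volume) (f := fun p => w i p ^ 2)
    (s := fun n : ℕ => rect h (a / (n + 1))) (fun n => measurableSet_rect _ _)
    (fun m n hmn => rect_mono_height (by gcongr))
    ⟨0, by simpa [IntegrableOn] using (hw i).integrable_sq⟩
  simpa only [hempty, setIntegral_empty] using hanti

theorem memLp_firstJet (hf : ContDiff ℝ ∞ f) (i : Fin 3) :
    MemLp (firstJet f i) 2 (volume.restrict (rect h a)) := by
  fin_cases i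
  · exact memLp_rect_of_continuous hf.continuous
  · exact memLp_rect_of_continuous (continuous_fderiv_apply hf _)
  · exact memLp_rect_of_continuous (continuous_fderiv_apply hf _)

theorem IsSobolevH1.memLp_triple {u ux uy : ℝ × ℝ → ℝ} (hu : IsSobolevH1 S u ux uy) (i : Fin 3) :
    MemLp (![u, ux, uy] i) 2 (volume.restrict S) := by
  fin_cases i
  · exact hu.memLp
  · exact hu.memLp_dx
  · exact hu.memLp_dy

theorem firstJet_sub (hf : Differentiable ℝ f) (hg : Differentiable ℝ g) :
    firstJet (fun p => f p - g p) = firstJet f - firstJet g := by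
  have hd p (e : ℝ × ℝ) : fderiv ℝ (fun p => f p - g p) p e = fderiv ℝ f p e - fderiv ℝ g p e := by
    rw [fderiv_fun_sub (hf p) (hg p), _root_.sub_apply]
  funext i p
  fin_cases i
  exacts [rfl, hd p (1, 0), hd p (0, 1)]

theorem firstJet_sub_reflection (hf : ContDiff ℝ ∞ f) :
    firstJet (fun p => f p - f (diagAffine 1 0 (-1) a p)) = oddPart a (firstJet f) := by
  have hd := hf.differentiable (by simp)
  rw [firstJet_sub hd (g := fun p => f (diagAffine 1 0 (-1) a p))
    ((hf.comp (contDiff_diagAffine 1 0 (-1) a)).differentiable (by simp))]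
  funext i p
  fin_cases i
  · simp [oddPart, firstJet]
  · simp [oddPart, firstJet, pdx_comp_diagAffine (σ := 1) (τ := 0) (t := -1) (s := a) (hd _)]
  · simp [oddPart, firstJet, pdy_comp_diagAffine (σ := 1) (τ := 0) (t := -1) (s := a) (hd _)]

theorem oddPart_add (a : ℝ) (w w' : Fin 3 → ℝ × ℝ → ℝ) :
    oddPart a (w + w') = oddPart a w + oddPart a w' := by
  funext i p
  simp only [oddPart, Pi.add_apply]
  ring

theorem diagAffine_reflection_preimage (h a : ℝ) :
    diagAffine 1 0 (-1) a ⁻¹' rect h a = rect h a :=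
  preimage_diagAffine_prod (fun x => by simp)
    fun y => by constructor <;> rintro ⟨h₁, h₂⟩ <;> constructor <;> linarith

theorem memLp_comp_reflection (hf : MemLp f 2 (volume.restrict (rect h a))) :
    MemLp (fun p => f (diagAffine 1 0 (-1) a p)) 2 (volume.restrict (rect h a)) :=
  memLp_comp_diagAffine one_ne_zero (neg_ne_zero.2 one_ne_zero) 0 a hf
    (diagAffine_reflection_preimage h a).ge

theorem memLp_oddPart (hw : ∀ i, MemLp (w i) 2 (volume.restrict (rect h a))) (i : Fin 3) :
    MemLp (oddPart a w i) 2 (volume.restrict (rect h a)) :=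
  (hw i).sub ((memLp_comp_reflection (hw i)).const_mul _)

theorem sobolevSq_oddPart_le (hw : ∀ i, MemLp (w i) 2 (volume.restrict (rect h a))) :
    sobolevSq (rect h a) (oddPart a w) ≤ 4 * sobolevSq (rect h a) w := by
  rw [sobolevSq, sobolevSq, Finset.mul_sum]
  refine Finset.sum_le_sum fun i _ => ?_
  have hsplit := integral_sub_sq_le (g := fun _ => 0) (hw i) (memLp_rect_of_continuous
    continuous_const) ((memLp_comp_reflection (hw i)).const_mul ((![1, 1, -1] : Fin 3 → ℝ) i))
  have hsign : (![1, 1, -1] : Fin 3 → ℝ) i ^ 2 = 1 := by fin_cases i <;> norm_num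
  have hreflect := wsq_comp_reflection (V := 1) (W := 1) (one_pow 2) neg_one_sq
    (diagAffine_reflection_preimage h a) (fun _ _ => rfl) ((![1, 1, -1] : Fin 3 → ℝ) i) (w i)
  simp only [wsq, Pi.one_apply, one_mul, hsign] at hreflect
  simp only [sub_zero, zero_sub, neg_sq] at hsplit
  rw [hreflect] at hsplit
  calc ∫ p in rect h a, oddPart a w i p ^ 2 ≤ _ := hsplit
    _ = 4 * ∫ p in rect h a, w i p ^ 2 := by ring

theorem sobolevSq_oddPart_strip_le (hδ : δ ≤ a)
    (hw : ∀ i, MemLp (w i) 2 (volume.restrict (rect h a)))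
    (hw' : ∀ i, MemLp (w' i) 2 (volume.restrict (rect h a))) :
    sobolevSq (rect h δ) (oddPart a w) ≤
      8 * sobolevSq (rect h a) (w - w') + 2 * sobolevSq (rect h δ) (oddPart a w') := by
  have hmem (i : Fin 3) : MemLp ((w - w') i) 2 (volume.restrict (rect h a)) := (hw i).sub (hw' i)
  have hstrip := Measure.restrict_mono (μ := volume) (rect_mono_height (h := h) hδ) le_rfl
  have hsplit := sobolevSq_add_le (fun i => (memLp_oddPart hmem i).mono_measure hstrip)
    fun i => (memLp_oddPart hw' i).mono_measure hstrip
  rw [← oddPart_add, sub_add_cancel] at hsplit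
  linarith [sobolevSq_mono_height hδ (memLp_oddPart hmem), sobolevSq_oddPart_le hmem]

theorem mul_setIntegral_bottom_sq_le_sobolevSq (ha : 0 ≤ a) (hf : ContDiff ℝ ∞ f) :
    a * ∫ x in Ioo 0 h, f (x, 0) ^ 2 ≤ (2 + 2 * a ^ 2) * sobolevSq (rect h a) (firstJet f) := by
  have hnonneg (k : ℝ × ℝ → ℝ) : 0 ≤ ∫ p in rect h a, k p ^ 2 :=
    integral_nonneg fun _ => sq_nonneg _
  simp only [sobolevSq, firstJet, Fin.sum_univ_three, Matrix.cons_val]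
  nlinarith [mul_setIntegral_bottom_sq_le (h := h) ha hf, hnonneg f, hnonneg (pdx f),
    hnonneg (pdy f), sq_nonneg a]

end FirstJet

section PeriodicApproximation

variable {a h δ : ℝ} {u ux uy : ℝ × ℝ → ℝ} {g : ℝ → ℝ}

theorem exists_vertical_cutoff : ∃ M : ℝ, 0 < M ∧ ∀ δ : ℝ, 0 < δ → ∃ ρ : ℝ → ℝ,
    ContDiff ℝ ∞ ρ ∧ ρ 0 = 1 ∧ (∀ y, |ρ y| ≤ 1) ∧ (∀ y, δ ≤ y → ρ y = 0) ∧
      (∀ y, δ ≤ y → deriv ρ y = 0) ∧ ∀ y, |deriv ρ y| ≤ M / δ := by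
  obtain ⟨M, hM, hbound⟩ := exists_bound_deriv_smoothTransition
  refine ⟨2 * M, by positivity, fun δ hδ => ⟨fun y => 1 - Real.smoothTransition (2 / δ * y), ?_⟩⟩
  have hone {y : ℝ} (hy : δ ≤ y) : 1 < 2 / δ * y := by
    rw [div_mul_eq_mul_div, lt_div_iff₀ hδ]
    linarith
  have hderiv (y : ℝ) : deriv (fun y => 1 - Real.smoothTransition (2 / δ * y)) y =
      -(deriv Real.smoothTransition (2 / δ * y) * (2 / δ)) := by
    rw [deriv_const_sub, deriv_comp_mul_left, smul_eq_mul, mul_comm]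
  refine ⟨contDiff_const.sub (Real.smoothTransition.contDiff.comp (contDiff_const.mul contDiff_id)),
    by simp, fun y => abs_le.2 ⟨?_, ?_⟩, fun y hy => ?_, fun y hy => ?_, fun y => ?_⟩
  · linarith [Real.smoothTransition.le_one (2 / δ * y)]
  · linarith [Real.smoothTransition.nonneg (2 / δ * y)]
  · simp [Real.smoothTransition.one_of_one_le (hone hy).le]
  · rw [hderiv, deriv_smoothTransition_of_one_lt (hone hy), zero_mul, neg_zero]
  · rw [hderiv, abs_neg, abs_mul, abs_of_pos (by positivity : 0 < 2 / δ), mul_comm 2 M,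
      mul_div_assoc]
    gcongr
    exact hbound _

theorem setIntegral_cutoff_mul_sq_le {ρ : ℝ → ℝ} {b : ℝ} {f : ℝ × ℝ → ℝ} (hδ : δ ≤ a)
    (hρ : Continuous ρ) (hb : ∀ y, |ρ y| ≤ b) (hzero : ∀ y, δ ≤ y → ρ y = 0)
    (hf : Continuous f) :
    ∫ p in rect h a, (ρ p.2 * f p) ^ 2 ≤ b ^ 2 * ∫ p in rect h δ, f p ^ 2 := by
  rw [setIntegral_eq_of_subset_of_forall_sdiff_eq_zero (measurableSet_rect h a)
    (rect_mono_height hδ), ← integral_const_mul]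
  · refine integral_mono (integrableOn_rect_of_continuousOn (by fun_prop))
      (integrableOn_rect_of_continuousOn (by fun_prop)) fun p => ?_
    simp only [mul_pow]
    gcongr ?_ * _
    exact sq_le_sq.2 ((hb p.2).trans (le_abs_self b))
  · rintro p ⟨hp, hnot⟩
    have hle : δ ≤ p.2 := not_lt.1 fun hlt => hnot ⟨hp.1, hp.2.1, hlt⟩
    rw [hzero _ hle, zero_mul, zero_pow two_ne_zero]

theorem firstJet_vertical_mul {ρ : ℝ → ℝ} {f : ℝ × ℝ → ℝ} (hρ : Differentiable ℝ ρ)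
    (hf : Differentiable ℝ f) :
    firstJet (fun p => ρ p.2 * f p) = ![fun p => ρ p.2 * f p, fun p => ρ p.2 * pdx f p,
      fun p => ρ p.2 * pdy f p + deriv ρ p.2 * f p] := by
  have hd (p : ℝ × ℝ) : HasFDerivAt (fun p => ρ p.2 * f p) (ρ p.2 • fderiv ℝ f p +
      f p • deriv ρ p.2 • ContinuousLinearMap.snd ℝ ℝ ℝ) p :=
    ((hρ p.2).hasDerivAt.comp_hasFDerivAt p hasFDerivAt_snd).mul (hf p).hasFDerivAt
  funext i p
  fin_cases i
  · rfl
  · simp [firstJet, pdx, (hd p).fderiv]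
  · simp [firstJet, pdy, (hd p).fderiv, mul_comm (f p)]

/-- The boundary term comes from the derivative of the cutoff, through the Poincaré inequality on
the strip of height `δ`. -/
theorem sobolevSq_cutoff_mul_le {ρ : ℝ → ℝ} {M : ℝ} {f : ℝ × ℝ → ℝ} (hδ : 0 < δ) (hδa : δ ≤ a)
    (hρ : ContDiff ℝ ∞ ρ) (hρ_le : ∀ y, |ρ y| ≤ 1) (hρ_eq : ∀ y, δ ≤ y → ρ y = 0)
    (hρ'_eq : ∀ y, δ ≤ y → deriv ρ y = 0) (hρ'_le : ∀ y, |deriv ρ y| ≤ M / δ)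
    (hf : ContDiff ℝ ∞ f) :
    sobolevSq (rect h a) (firstJet fun p => ρ p.2 * f p) ≤ (2 + 4 * M ^ 2) *
      (sobolevSq (rect h δ) (firstJet f) + 1 / δ * ∫ x in Ioo 0 h, f (x, 0) ^ 2) := by
  have hcρ := hρ.continuous
  have hρ' : Continuous (deriv ρ) := hρ.continuous_deriv (by simp)
  have hcf := hf.continuous
  have hcx : Continuous (pdx f) := continuous_fderiv_apply hf _
  have hcy : Continuous (pdy f) := continuous_fderiv_apply hf _
  have hzero := setIntegral_cutoff_mul_sq_le (h := h) hδa hcρ hρ_le hρ_eq hcf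
  have hx := setIntegral_cutoff_mul_sq_le (h := h) hδa hcρ hρ_le hρ_eq hcx
  have hy := setIntegral_cutoff_mul_sq_le (h := h) hδa hcρ hρ_le hρ_eq hcy
  have hy' := setIntegral_cutoff_mul_sq_le (h := h) hδa hρ' hρ'_le hρ'_eq hcf
  have hsum := integral_add_sq_le
    (memLp_rect_of_continuous (h := h) (a := a) (f := fun p => ρ p.2 * pdy f p) (by fun_prop))
    (memLp_rect_of_continuous (f := fun p => deriv ρ p.2 * f p) (by fun_prop))
  have hpoincare : (M / δ) ^ 2 * (∫ p in rect h δ, f p ^ 2) ≤ 2 * M ^ 2 *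
      (∫ p in rect h δ, pdy f p ^ 2) + 2 * M ^ 2 * (1 / δ * ∫ x in Ioo 0 h, f (x, 0) ^ 2) :=
    (mul_le_mul_of_nonneg_left (setIntegral_sq_le_bottom hδ.le hf) (sq_nonneg _)).trans_eq
      (by field_simp)
  have hboundary : 0 ≤ 1 / δ * ∫ x in Ioo 0 h, f (x, 0) ^ 2 :=
    mul_nonneg (by positivity) (integral_nonneg fun _ => sq_nonneg _)
  have hnonneg (k : ℝ × ℝ → ℝ) : 0 ≤ ∫ p in rect h δ, k p ^ 2 :=
    integral_nonneg fun _ => sq_nonneg _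
  rw [firstJet_vertical_mul (hρ.differentiable (by simp)) (hf.differentiable (by simp))]
  simp only [sobolevSq, firstJet, Fin.sum_univ_three, Matrix.cons_val]
  nlinarith [mul_nonneg (sq_nonneg M) (hnonneg f), mul_nonneg (sq_nonneg M) (hnonneg (pdx f)),
    hnonneg f, hnonneg (pdx f)]

theorem exists_extension_supported_in_strip : ∃ M : ℝ, 0 < M ∧ ∀ {h a δ : ℝ} {f : ℝ × ℝ → ℝ},
    0 < δ → δ ≤ a → ContDiff ℝ ∞ f → ∃ χ : ℝ × ℝ → ℝ, ContDiff ℝ ∞ χ ∧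
      (∀ x, χ (x, 0) = f (x, 0)) ∧ (∀ x, χ (x, a) = 0) ∧
      sobolevSq (rect h a) (firstJet χ) ≤
        M * (sobolevSq (rect h δ) (firstJet f) + 1 / δ * ∫ x in Ioo 0 h, f (x, 0) ^ 2) := by
  obtain ⟨M, hM, hcut⟩ := exists_vertical_cutoff
  refine ⟨2 + 4 * M ^ 2, by positivity, fun {h a δ f} hδ hδa hf => ?_⟩
  obtain ⟨ρ, hρ, hρ_zero, hρ_le, hρ_eq, hρ'_eq, hρ'_le⟩ := hcut δ hδ
  exact ⟨fun p => ρ p.2 * f p, (hρ.comp contDiff_snd).mul hf, fun x => by simp [hρ_zero],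
    fun x => by simp [hρ_eq a hδa],
    sobolevSq_cutoff_mul_le hδ hδa hρ hρ_le hρ_eq hρ'_eq hρ'_le hf⟩

theorem HasTraceOnSide.exists_tendsto {s : ℝ} (hu : IsSobolevH1 (rect h a) u ux uy)
    (htrace : HasTraceOnSide h a s u ux uy g) :
    ∃ φ : ℕ → ℝ × ℝ → ℝ, (∀ n, ContDiff ℝ ∞ (φ n)) ∧
      Tendsto (fun n => sobolevSq (rect h a) (firstJet (φ n) - ![u, ux, uy])) atTop (𝓝 0) ∧
      Tendsto (fun n => ∫ x in Ioo 0 h, (φ n (x, s) - g x) ^ 2) atTop (𝓝 0) := by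
  obtain ⟨hg, φ, hφ, hzero, hx, hy, hside⟩ := htrace
  refine ⟨φ, hφ, ?_, tendsto_integral_sq_of_eLpNorm (fun n => (memLp_Ioo_of_continuous
    ((hφ n).continuous.comp (by fun_prop : Continuous fun x : ℝ => (x, s)))).sub hg) hside⟩
  have hmem (i : Fin 3) (n : ℕ) : MemLp ((firstJet (φ n) - ![u, ux, uy]) i) 2
      (volume.restrict (rect h a)) := (memLp_firstJet (hφ n) i).sub (hu.memLp_triple i)
  have hlim := ((tendsto_integral_sq_of_eLpNorm (hmem 0) hzero).add
    (tendsto_integral_sq_of_eLpNorm (hmem 1) hx)).add (tendsto_integral_sq_of_eLpNorm (hmem 2) hy)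
  simpa only [sobolevSq, Fin.sum_univ_three, add_zero] using hlim

theorem exists_tendsto_of_trace_eq (ha : 0 < a) (hu : IsSobolevH1 (rect h a) u ux uy)
    (hbot : HasTraceOnSide h a 0 u ux uy g) (htop : HasTraceOnSide h a a u ux uy g) :
    ∃ ψ : ℕ → ℝ × ℝ → ℝ, (∀ n, ContDiff ℝ ∞ (ψ n)) ∧
      Tendsto (fun n => sobolevSq (rect h a) (firstJet (ψ n) - ![u, ux, uy])) atTop (𝓝 0) ∧
      Tendsto (fun n => ∫ x in Ioo 0 h, (ψ n (x, 0) - ψ n (x, a)) ^ 2) atTop (𝓝 0) := by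
  obtain ⟨φ, hφ, hφu, hφg⟩ := hbot.exists_tendsto hu
  obtain ⟨ψ, hψ, hψu, hψg⟩ := htop.exists_tendsto hu
  refine ⟨ψ, hψ, hψu, ?_⟩
  have hslice {f : ℝ × ℝ → ℝ} (hf : ContDiff ℝ ∞ f) (t : ℝ) :
      MemLp (fun x => f (x, t)) 2 (volume.restrict (Ioo 0 h)) :=
    memLp_Ioo_of_continuous (hf.continuous.comp (by fun_prop : Continuous fun x : ℝ => (x, t)))
  have hjet n : sobolevSq (rect h a) (firstJet fun p => ψ n p - φ n p) ≤
      2 * sobolevSq (rect h a) (firstJet (ψ n) - ![u, ux, uy]) +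
        2 * sobolevSq (rect h a) (firstJet (φ n) - ![u, ux, uy]) := by
    rw [firstJet_sub ((hψ n).differentiable (by simp)) ((hφ n).differentiable (by simp)),
      ← sub_sub_sub_cancel_right _ _ ![u, ux, uy]]
    exact sobolevSq_sub_le (fun i => (memLp_firstJet (hψ n) i).sub (hu.memLp_triple i))
      fun i => (memLp_firstJet (hφ n) i).sub (hu.memLp_triple i)
  have hlim : Tendsto (fun n => ∫ x in Ioo 0 h, (ψ n (x, 0) - φ n (x, 0)) ^ 2) atTop (𝓝 0) := by
    have hjets := squeeze_zero (fun n => sobolevSq_nonneg _ _) hjet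
      (by simpa using (hψu.const_mul 2).add (hφu.const_mul 2))
    refine squeeze_zero (fun n => integral_nonneg fun _ => sq_nonneg _) (fun n => ?_)
      (by simpa using hjets.const_mul (a⁻¹ * (2 + 2 * a ^ 2)))
    rw [mul_assoc, le_inv_mul_iff₀ ha]
    exact mul_setIntegral_bottom_sq_le_sobolevSq ha.le ((hψ n).sub (hφ n))
  refine tendsto_integral_sub_sq (fun n => hslice (hψ n) 0) (fun _ => hbot.1)
    (fun n => hslice (hψ n) a) ?_ (by simpa only [sub_sq_comm (g _)] using hψg)
  exact tendsto_integral_sub_sq (fun n => hslice (hψ n) 0) (fun n => hslice (hφ n) 0)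
    (fun _ => hbot.1) hlim hφg

theorem exists_periodic_approx (ha : 0 < a) (hu : IsSobolevH1 (rect h a) u ux uy)
    (hbot : HasTraceOnSide h a 0 u ux uy g) (htop : HasTraceOnSide h a a u ux uy g) {ε : ℝ}
    (hε : 0 < ε) :
    ∃ φ : ℝ × ℝ → ℝ, ContDiff ℝ ∞ φ ∧ (∀ x, φ (x, 0) = φ (x, a)) ∧
      sobolevSq (rect h a) (firstJet φ - ![u, ux, uy]) < ε := by
  obtain ⟨M, hM, hextend⟩ := exists_extension_supported_in_strip
  obtain ⟨ψ, hψ, hψu, hjump⟩ := exists_tendsto_of_trace_eq ha hu hbot htop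
  have hmem n i : MemLp ((firstJet (ψ n) - ![u, ux, uy]) i) 2 (volume.restrict (rect h a)) :=
    (memLp_firstJet (hψ n) i).sub (hu.memLp_triple i)
  obtain ⟨m, hstrip⟩ := ((tendsto_sobolevSq_strip ha (memLp_oddPart hu.memLp_triple)).const_mul
    (4 * M)).eventually_lt_const (by simpa using hε) |>.exists
  set δ := a / ((m : ℝ) + 1)
  have hδ : 0 < δ := by positivity
  have hδa : δ ≤ a := div_le_self ha.le (by linarith [m.cast_nonneg (α := ℝ)])
  obtain ⟨n, hn⟩ := ((hψu.const_mul (2 + 16 * M)).add (hjump.const_mul (2 * M / δ))).const_add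
    (4 * M * sobolevSq (rect h δ) (oddPart a ![u, ux, uy]))
    |>.eventually_lt_const (by simpa using hstrip) |>.exists
  obtain ⟨χ, hχ, hχ_bot, hχ_top, hχ_le⟩ := hextend (h := h) hδ hδa
    (f := fun p => ψ n p - ψ n (diagAffine 1 0 (-1) a p))
    ((hψ n).sub ((hψ n).comp (contDiff_diagAffine 1 0 (-1) a)))
  refine ⟨fun p => ψ n p - χ p, (hψ n).sub hχ, fun x => by simp [hχ_bot, hχ_top, diagAffine], ?_⟩
  have hodd := sobolevSq_oddPart_strip_le hδa (memLp_firstJet (hψ n)) hu.memLp_triple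
  have hside (x : ℝ) : diagAffine 1 0 (-1) a (x, 0) = (x, a) := by simp [diagAffine]
  simp only [firstJet_sub_reflection (hψ n), hside] at hχ_le
  rw [firstJet_sub ((hψ n).differentiable (by simp)) (hχ.differentiable (by simp)),
    sub_right_comm]
  calc _ ≤ 2 * sobolevSq (rect h a) (firstJet (ψ n) - ![u, ux, uy]) +
        2 * sobolevSq (rect h a) (firstJet χ) := sobolevSq_sub_le (hmem n) (memLp_firstJet hχ)
    _ ≤ 2 * sobolevSq (rect h a) (firstJet (ψ n) - ![u, ux, uy]) + 2 * (M *
        (8 * sobolevSq (rect h a) (firstJet (ψ n) - ![u, ux, uy]) +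
          2 * sobolevSq (rect h δ) (oddPart a ![u, ux, uy]) +
          1 / δ * ∫ x in Ioo 0 h, (ψ n (x, 0) - ψ n (x, a)) ^ 2)) := by
        gcongr
        exact hχ_le.trans (by gcongr)
    _ < ε := by
        refine lt_of_eq_of_lt ?_ hn
        ring

end PeriodicApproximation

/-! ### The Korn inequality for Sobolev functions -/

section Limits

variable {ι : Type*} {l : Filter ι} {h a : ℝ} {V W : ℝ → ℝ} {f g : ℝ × ℝ → ℝ}

theorem abs_wsq_sub_le (hW : IsWeight a W) (hf : MemLp f 2 (volume.restrict (rect h a)))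
    (hg : MemLp g 2 (volume.restrict (rect h a))) :
    |wsq (rect h a) W g - wsq (rect h a) W f| ≤ wsq (rect h a) W (fun p => g p - f p) +
      2 * (√(wsq (rect h a) W f) * √(wsq (rect h a) W (fun p => g p - f p))) := by
  have hd : MemLp (fun p => g p - f p) 2 (volume.restrict (rect h a)) := hg.sub hf
  have hcs := integral_weight_mul_le hW.continuousOn hW.nonneg hf hd
  have if_sq := integrableOn_wsq hW.continuousOn hf
  have ig_sq := integrableOn_wsq hW.continuousOn hg
  have id_sq := integrableOn_wsq hW.continuousOn hd
  have i_mul : IntegrableOn (fun p => W p.2 * (|f p| * |g p - f p|)) (rect h a) :=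
    integrableOn_rect_continuousOn_mul (continuousOn_comp_snd hW.continuousOn)
      (hf.abs.integrable_mul hd.abs)
  have hpoint : ∀ p ∈ rect h a, |W p.2 * g p ^ 2 - W p.2 * f p ^ 2| ≤
      W p.2 * (g p - f p) ^ 2 + 2 * (W p.2 * (|f p| * |g p - f p|)) := fun p hp => by
    have hp0 := hW.nonneg_of_mem_rect hp
    calc |W p.2 * g p ^ 2 - W p.2 * f p ^ 2|
        = |W p.2 * (g p - f p) ^ 2 + 2 * (W p.2 * (f p * (g p - f p)))| := by ring_nf
      _ ≤ |W p.2 * (g p - f p) ^ 2| + |2 * (W p.2 * (f p * (g p - f p)))| := abs_add_le _ _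
      _ = W p.2 * (g p - f p) ^ 2 + 2 * (W p.2 * (|f p| * |g p - f p|)) := by
          simp only [abs_mul, abs_of_nonneg hp0, abs_two, abs_sq]
  calc |wsq (rect h a) W g - wsq (rect h a) W f|
      = |∫ p in rect h a, (W p.2 * g p ^ 2 - W p.2 * f p ^ 2)| := by
        rw [integral_sub ig_sq if_sq, wsq, wsq]
    _ ≤ ∫ p in rect h a, |W p.2 * g p ^ 2 - W p.2 * f p ^ 2| := abs_integral_le_integral_abs
    _ ≤ ∫ p in rect h a, (W p.2 * (g p - f p) ^ 2 + 2 * (W p.2 * (|f p| * |g p - f p|))) :=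
        setIntegral_mono_on (ig_sq.sub if_sq).abs (id_sq.add (i_mul.const_mul 2))
          (measurableSet_rect h a) hpoint
    _ = wsq (rect h a) W (fun p => g p - f p) +
          2 * ∫ p in rect h a, W p.2 * (|f p| * |g p - f p|) := by
        rw [integral_add id_sq (i_mul.const_mul 2), integral_const_mul, wsq]
    _ ≤ _ := by gcongr; exact hcs

theorem exists_wsq_le_integral_sq (hW : ContinuousOn W (Icc 0 a)) :
    ∃ B, ∀ {f : ℝ × ℝ → ℝ}, MemLp f 2 (volume.restrict (rect h a)) →
      wsq (rect h a) W f ≤ B * ∫ p in rect h a, f p ^ 2 := by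
  obtain ⟨B, hB⟩ := isCompact_Icc.exists_bound_of_continuousOn hW
  refine ⟨B, fun {f} hf => ?_⟩
  rw [wsq, ← integral_const_mul]
  refine setIntegral_mono_on (integrableOn_wsq hW hf) (hf.integrable_sq.const_mul B)
    (measurableSet_rect h a) fun p hp => ?_
  gcongr
  exact (le_abs_self _).trans (hB _ (rect_subset_Icc h a hp).2)

theorem tendsto_wsq (hW : IsWeight a W) {φ : ι → ℝ × ℝ → ℝ}
    (hφ : ∀ n, MemLp (φ n) 2 (volume.restrict (rect h a)))
    (hf : MemLp f 2 (volume.restrict (rect h a)))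
    (hlim : Tendsto (fun n => ∫ p in rect h a, (φ n p - f p) ^ 2) l (𝓝 0)) :
    Tendsto (fun n => wsq (rect h a) W (φ n)) l (𝓝 (wsq (rect h a) W f)) := by
  obtain ⟨B, hB⟩ := exists_wsq_le_integral_sq (h := h) hW.continuousOn
  have hdiff : Tendsto (fun n => wsq (rect h a) W (fun p => φ n p - f p)) l (𝓝 0) :=
    squeeze_zero (fun n => wsq_nonneg hW _) (fun n => hB ((hφ n).sub hf))
      (by simpa using hlim.const_mul B)
  have hbound := hdiff.add ((hdiff.sqrt.const_mul √(wsq (rect h a) W f)).const_mul 2)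
  simp only [Real.sqrt_zero, mul_zero, add_zero] at hbound
  rw [tendsto_iff_dist_tendsto_zero]
  exact squeeze_zero (fun n => dist_nonneg) (fun n => abs_wsq_sub_le hW hf (hφ n)) hbound

theorem tendsto_wsq_weight [l.IsCountablyGenerated] {B : ℝ} {Vn : ι → ℝ → ℝ}
    (hcont : ∀ᶠ n in l, ContinuousOn (Vn n) (Icc 0 a))
    (hbound : ∀ᶠ n in l, ∀ y ∈ Icc 0 a, |Vn n y| ≤ B)
    (hlim : ∀ y ∈ Icc 0 a, Tendsto (fun n => Vn n y) l (𝓝 (V y)))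
    (hf : MemLp f 2 (volume.restrict (rect h a))) :
    Tendsto (fun n => wsq (rect h a) (Vn n) f) l (𝓝 (wsq (rect h a) V f)) := by
  refine tendsto_integral_filter_of_dominated_convergence (fun p => B * f p ^ 2) ?_ ?_
    (hf.integrable_sq.const_mul B) ?_
  · filter_upwards [hcont] with n hn using (integrableOn_wsq hn hf).aestronglyMeasurable
  · filter_upwards [hbound] with n hn
    refine ae_restrict_rect fun p hp => ?_
    rw [Real.norm_eq_abs, abs_mul, abs_sq]
    gcongr
    exact hn _ (rect_subset_Icc h a hp).2
  · exact ae_restrict_rect fun p hp => (hlim _ (rect_subset_Icc h a hp).2).mul_const _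

theorem tendsto_kornBound {Vn : ι → ℝ → ℝ} {un An Dn Bn : ι → ℝ × ℝ → ℝ} {u A D B : ℝ × ℝ → ℝ}
    (hu : Tendsto (fun n => wsq (rect h a) (Vn n) (un n)) l (𝓝 (wsq (rect h a) V u)))
    (hA : Tendsto (fun n => wsq (rect h a) (Vn n) (An n)) l (𝓝 (wsq (rect h a) V A)))
    (hD : Tendsto (fun n => wsq (rect h a) (Vn n) (Dn n)) l (𝓝 (wsq (rect h a) V D)))
    (hB : Tendsto (fun n => wsq (rect h a) (Vn n) (Bn n)) l (𝓝 (wsq (rect h a) V B))) :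
    Tendsto (fun n => kornBound h a (Vn n) (un n) (An n) (Dn n) (Bn n)) l
      (𝓝 (kornBound h a V u A D B)) :=
  ((hu.sqrt.mul hB.sqrt).div_const h).add ((hA.add hD).add hB)

theorem wsq_le_kornBound_of_tendsto_weight [l.NeBot] [l.IsCountablyGenerated] {B C : ℝ}
    {Vn : ι → ℝ → ℝ} {u A D G : ℝ × ℝ → ℝ}
    (hcont : ∀ᶠ n in l, ContinuousOn (Vn n) (Icc 0 a))
    (hbound : ∀ᶠ n in l, ∀ y ∈ Icc 0 a, |Vn n y| ≤ B)
    (hlim : ∀ y ∈ Icc 0 a, Tendsto (fun n => Vn n y) l (𝓝 (V y)))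
    (hf : MemLp f 2 (volume.restrict (rect h a))) (hu : MemLp u 2 (volume.restrict (rect h a)))
    (hA : MemLp A 2 (volume.restrict (rect h a))) (hD : MemLp D 2 (volume.restrict (rect h a)))
    (hG : MemLp G 2 (volume.restrict (rect h a)))
    (hkorn : ∀ᶠ n in l, wsq (rect h a) (Vn n) f ≤ C * kornBound h a (Vn n) u A D G) :
    wsq (rect h a) V f ≤ C * kornBound h a V u A D G := by
  have hconv {q : ℝ × ℝ → ℝ} (hq : MemLp q 2 (volume.restrict (rect h a))) :=
    tendsto_wsq_weight hcont hbound hlim hq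
  exact le_of_tendsto_of_tendsto (hconv hf)
    ((tendsto_kornBound (hconv hu) (hconv hA) (hconv hD) (hconv hG)).const_mul C) hkorn

end Limits

section SobolevKorn

variable {h a C K θ : ℝ} {V W : ℝ → ℝ} {u ux uy v vx vy F G : ℝ × ℝ → ℝ} {g : ℝ → ℝ}

theorem setIntegral_sq_le_sobolevSq (S : Set (ℝ × ℝ)) (w : Fin 3 → ℝ × ℝ → ℝ) (i : Fin 3) :
    ∫ p in S, w i p ^ 2 ≤ sobolevSq S w :=
  Finset.single_le_sum (f := fun i => ∫ p in S, w i p ^ 2)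
    (fun _ _ => integral_nonneg fun _ => sq_nonneg _) (Finset.mem_univ i)

theorem korn_of_smooth_periodic (ha : 0 < a) (hW : IsWeight a W)
    (hF : MemLp F 2 (volume.restrict (rect h a)))
    (hsmooth : ∀ φ : ℝ × ℝ → ℝ, ContDiff ℝ ∞ φ → (∀ x, φ (x, 0) = φ (x, a)) →
      wsq (rect h a) W (pdy φ) ≤ C * dataBound h a W φ F G)
    (hu : IsSobolevH1 (rect h a) u ux uy) (hbot : HasTraceOnSide h a 0 u ux uy g)
    (htop : HasTraceOnSide h a a u ux uy g) :
    wsq (rect h a) W uy ≤ C * kornBound h a W u ux (fun p => uy p + F p) G := by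
  choose φ hφ hper hclose using fun n : ℕ =>
    exists_periodic_approx ha hu hbot htop (ε := 1 / ((n : ℝ) + 1)) (by positivity)
  have hjet (i : Fin 3) : Tendsto
      (fun n => ∫ p in rect h a, (firstJet (φ n) i p - ![u, ux, uy] i p) ^ 2) atTop (𝓝 0) :=
    squeeze_zero (fun n => integral_nonneg fun _ => sq_nonneg _)
      (fun n => (setIntegral_sq_le_sobolevSq _ _ i).trans (hclose n).le)
      tendsto_one_div_add_atTop_nhds_zero_nat
  have hmem (n : ℕ) (i : Fin 3) := memLp_firstJet (h := h) (a := a) (hφ n) i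
  have hlim (i : Fin 3) : Tendsto (fun n => wsq (rect h a) W (firstJet (φ n) i)) atTop
      (𝓝 (wsq (rect h a) W (![u, ux, uy] i))) :=
    tendsto_wsq hW (fun n => hmem n i) (hu.memLp_triple i) (hjet i)
  have hshear : Tendsto (fun n => wsq (rect h a) W (fun p => pdy (φ n) p + F p)) atTop
      (𝓝 (wsq (rect h a) W (fun p => uy p + F p))) :=
    tendsto_wsq hW (fun n => (hmem n 2).add hF) (hu.memLp_dy.add hF)
      (by simp only [add_sub_add_right_eq_sub]; exact hjet 2)
  exact le_of_tendsto_of_tendsto' (hlim 2)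
    ((tendsto_kornBound (hlim 0) (hlim 1) hshear tendsto_const_nhds).const_mul C)
    fun n => hsmooth (φ n) (hφ n) (hper n)

theorem exists_korn_periodic_of_reflection (hK : 0 ≤ K) (hθ0 : 0 < θ) (hθ1 : θ < 1) :
    ∃ C : ℝ, 0 < C ∧ ∀ {h a : ℝ} {W d : ℝ → ℝ} {u F G : ℝ × ℝ → ℝ},
      d = (fun y => y) ∨ d = (fun y => a - y) → PowerLikeWeight a K θ W →
      KornData h a u F G → (∀ x, u (x, 0) = u (x, a)) →
      wsq (rect h a) (fun y => W (d y)) (pdy u) ≤ C * dataBound h a (fun y => W (d y)) u F G := by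
  obtain ⟨C, hC, hkorn⟩ := exists_korn_periodic hK hθ0 hθ1
  refine ⟨C, hC, fun {h a W d u F G} hside hW hd hper => ?_⟩
  obtain rfl | rfl := hside
  · exact hkorn hW hd hper
  have hpre := diagAffine_reflection_preimage h a
  have hVW : ∀ y ∈ Ioo 0 a, W y = W (a - (-1 * y + a)) := fun y _ => by ring_nf
  have key := hkorn hW (hd.comp_diagAffine one_ne_zero (by norm_num : (-1 : ℝ) ≠ 0) 0 a hd.width_pos
    hd.height_pos hpre.ge) (fun x => by simp [diagAffine, hper x])
  rwa [hd.dataBound_comp_reflection (W := fun y => W (a - y)) (by norm_num) (by norm_num) hpre hVW,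
    hd.pdy_comp_diagAffine,
    wsq_comp_reflection (W := fun y => W (a - y)) (by norm_num) (by norm_num) hpre hVW,
    neg_one_sq, one_mul] at key

end SobolevKorn

section PowSumKorn

variable {k : ℕ} {c α : Fin k → ℝ} {β a : ℝ}

theorem continuous_powSum (hα : ∀ i, 0 ≤ α i) : Continuous (powSum c α) :=
  continuous_finsetSum _ fun i _ => continuous_const.mul (Real.continuous_rpow_const (hα i))

theorem abs_powSum_sq_le (hc : ∀ i, 0 ≤ c i) (hα : ∀ i, 0 ≤ α i) {r s : ℝ} (hr : 0 ≤ r)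
    (hrs : r ≤ s) : |powSum c α r ^ 2| ≤ powSum c α s ^ 2 := by
  rw [abs_sq]
  exact pow_le_pow_left₀ (powSum_nonneg hc hr) (powSum_mono hc hα hr hrs) 2

/-- The power sum is shifted away from its singularity at `0` so that its square is smooth. -/
theorem wsq_powSum_le_of_shifted (hc : ∀ i, 0 ≤ c i) (hα : ∀ i, 0 ≤ α i) {d : ℝ → ℝ}
    (hd : Continuous d) (hdm : MapsTo d (Icc 0 a) (Icc 0 a)) {h C : ℝ} {f u A D G : ℝ × ℝ → ℝ}
    (hf : MemLp f 2 (volume.restrict (rect h a))) (hu : MemLp u 2 (volume.restrict (rect h a)))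
    (hA : MemLp A 2 (volume.restrict (rect h a))) (hD : MemLp D 2 (volume.restrict (rect h a)))
    (hG : MemLp G 2 (volume.restrict (rect h a)))
    (hkorn : ∀ ε > 0, wsq (rect h a) (fun y => powSum c α (d y + ε) ^ 2) f ≤
      C * kornBound h a (fun y => powSum c α (d y + ε) ^ 2) u A D G) :
    wsq (rect h a) (fun y => powSum c α (d y) ^ 2) f ≤
      C * kornBound h a (fun y => powSum c α (d y) ^ 2) u A D G := by
  have hcont := continuous_powSum (c := c) hα
  have hε : ∀ᶠ ε : ℝ in 𝓝[>] 0, ε ∈ Ioo 0 1 := Ioo_mem_nhdsGT zero_lt_one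
  refine wsq_le_kornBound_of_tendsto_weight (l := 𝓝[>] 0) (B := powSum c α (a + 1) ^ 2)
    (Vn := fun ε y => powSum c α (d y + ε) ^ 2) (Eventually.of_forall fun ε => by fun_prop)
    (hε.mono fun ε hε y hy => abs_powSum_sq_le hc hα (add_nonneg (hdm hy).1 hε.1.le)
      (add_le_add (hdm hy).2 hε.2.le)) (fun y _ => ?_) hf hu hA hD hG
    (hε.mono fun ε hε => hkorn ε hε.1)
  have hlim : Continuous fun ε => powSum c α (d y + ε) ^ 2 := by fun_prop
  simpa using (hlim.tendsto 0).mono_left nhdsWithin_le_nhds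

theorem exists_korn_sobolev (hβ : β < 1 / 2) :
    ∃ C : ℝ, 0 < C ∧ ∀ {k : ℕ} {c α : Fin k → ℝ} {h a : ℝ} {d : ℝ → ℝ}
      {u ux uy v vx vy : ℝ × ℝ → ℝ} {g : ℝ → ℝ}, 0 < a → 0 < h →
      d = (fun y => y) ∨ d = (fun y => a - y) → (∀ i, 0 ≤ c i) → (∀ i, α i ∈ Icc 0 β) →
      IsSobolevH1 (rect h a) u ux uy → IsSobolevH1 (rect h a) v vx vy →
      HasTraceOnSide h a 0 u ux uy g → HasTraceOnSide h a a u ux uy g →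
      wsq (rect h a) (fun y => powSum c α (d y) ^ 2) uy ≤
        C * kornBound h a (fun y => powSum c α (d y) ^ 2) u ux (fun p => uy p + vx p) vy := by
  have hθ : (2 : ℝ) ^ (2 * β) < 2 :=
    (Real.rpow_lt_rpow_of_exponent_lt one_lt_two (by linarith)).trans_eq (Real.rpow_one 2)
  obtain ⟨C, hC, hkorn⟩ := exists_korn_periodic_of_reflection (K := 1 / (1 - 2 * β))
    (θ := (2 : ℝ) ^ (2 * β) / 2) (by apply div_nonneg <;> linarith) (by positivity) (by linarith)
  refine ⟨C, hC, fun {k c α h a d u ux uy v vx vy g} ha hh hside hc hα hu hv hbot htop => ?_⟩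
  have hα0 i : 0 ≤ α i := (hα i).1
  have hcont := continuous_powSum (c := c) hα0
  obtain ⟨hd, hdm⟩ : Continuous d ∧ MapsTo d (Icc 0 a) (Icc 0 a) := by
    obtain rfl | rfl := hside
    · exact ⟨continuous_id, mapsTo_id _⟩
    · exact ⟨by fun_prop, fun y hy => ⟨sub_nonneg.2 hy.2, sub_le_self a hy.1⟩⟩
  refine wsq_powSum_le_of_shifted hc hα0 hd hdm hu.memLp_dy hu.memLp hu.memLp_dx
    (hu.memLp_dy.add hv.memLp_dx) hv.memLp_dy fun ε hε => ?_
  have hW : IsWeight a (fun y => powSum c α (d y + ε) ^ 2) :=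
    ⟨by fun_prop, fun _ _ => sq_nonneg _⟩
  exact korn_of_smooth_periodic ha hW hv.memLp_dx
    (fun φ hφ hper => hkorn hside (powerLikeWeight_powSum hβ hc hα ha hε)
      ⟨hh, ha, hφ, hv.curlFree, hv.memLp_dx, hv.memLp_dy⟩ hper) hu hbot htop

end PowSumKorn

/-! ### From one off-diagonal derivative to the full gradient -/

section Identification

variable {k : ℕ} {h a s : ℝ} {p : ℝ × ℝ}

theorem sideDist_eq (hp : p.1 ∈ Ioo 0 h) : sideDist h s p = |p.2 - s| := by
  have hmem : WithLp.toLp 2 (p.1, s) ∈ WithLp.toLp 2 '' (Ioo 0 h ×ˢ {s} : Set (ℝ × ℝ)) :=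
    mem_image_of_mem _ ⟨hp, rfl⟩
  refine le_antisymm ((Metric.infDist_le_dist_of_mem hmem).trans_eq ?_) ?_
  · simp [WithLp.prod_dist_eq_of_L2, Real.dist_eq, Real.sqrt_sq_eq_abs]
  · refine (Metric.le_infDist ⟨_, hmem⟩).2 ?_
    rintro _ ⟨⟨x, y⟩, ⟨-, rfl : y = s⟩, rfl⟩
    rw [WithLp.prod_dist_eq_of_L2]
    exact Real.le_sqrt_of_sq_le (le_add_of_nonneg_left (sq_nonneg _))

theorem sideWeight_zero (c α : Fin k → ℝ) (hp : p ∈ rect h a) :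
    sideWeight h 0 c α p = powSum c α p.2 := by
  simp only [sideWeight, powSum, sideDist_eq hp.1, sub_zero, abs_of_pos hp.2.1]

theorem sideWeight_height (c α : Fin k → ℝ) (hp : p ∈ rect h a) :
    sideWeight h a c α p = powSum c α (a - p.2) := by
  simp only [sideWeight, powSum, sideDist_eq hp.1, abs_sub_comm p.2 a,
    abs_of_pos (sub_pos.2 hp.2.2)]

theorem frob_sq (M : Matrix (Fin 2) (Fin 2) ℝ) :
    frob M ^ 2 = M 0 0 ^ 2 + M 0 1 ^ 2 + (M 1 0 ^ 2 + M 1 1 ^ 2) := by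
  rw [frob, Real.sq_sqrt (by positivity)]
  simp only [Fin.sum_univ_two]

theorem frob_gradMat_sq (ux uy vx vy : ℝ × ℝ → ℝ) (p : ℝ × ℝ) :
    frob (gradMat ux uy vx vy p) ^ 2 = ux p ^ 2 + uy p ^ 2 + (vx p ^ 2 + vy p ^ 2) :=
  frob_sq _

theorem frob_symPart_gradMat_sq (ux uy vx vy : ℝ × ℝ → ℝ) (p : ℝ × ℝ) :
    frob (symPart (gradMat ux uy vx vy p)) ^ 2 =
      ux p ^ 2 + 1 / 2 * (uy p + vx p) ^ 2 + vy p ^ 2 := by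
  have hentry (i j : Fin 2) : symPart (gradMat ux uy vx vy p) i j =
      1 / 2 * (gradMat ux uy vx vy p i j + gradMat ux uy vx vy p j i) := rfl
  have h00 : gradMat ux uy vx vy p 0 0 = ux p := rfl
  have h01 : gradMat ux uy vx vy p 0 1 = uy p := rfl
  have h10 : gradMat ux uy vx vy p 1 0 = vx p := rfl
  have h11 : gradMat ux uy vx vy p 1 1 = vy p := rfl
  rw [frob_sq, hentry, hentry, hentry, hentry, h00, h01, h10, h11]
  ring

end Identification

section FullGradient

variable {h a C : ℝ} {w : ℝ → ℝ} {wt u ux uy v vx vy : ℝ × ℝ → ℝ}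

theorem l2norm_sq_eq_setIntegral (hwt : ∀ p ∈ rect h a, wt p = w p.2) (f : ℝ × ℝ → ℝ) :
    l2norm (rect h a) (fun p => wt p * f p) ^ 2 = ∫ p in rect h a, w p.2 ^ 2 * f p ^ 2 := by
  rw [l2norm, Real.sq_sqrt (integral_nonneg fun _ => sq_nonneg _)]
  exact setIntegral_congr_fun (measurableSet_rect h a) fun p hp => by simp only [hwt p hp, mul_pow]

theorem l2norm_eq_sqrt_wsq (hwt : ∀ p ∈ rect h a, wt p = w p.2) (f : ℝ × ℝ → ℝ) :
    l2norm (rect h a) (fun p => wt p * f p) = √(wsq (rect h a) (fun y => w y ^ 2) f) := by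
  rw [wsq, ← l2norm_sq_eq_setIntegral hwt]
  exact (Real.sqrt_sq (Real.sqrt_nonneg _)).symm

theorem l2norm_symPart_sq (hw : IsWeight a (fun y => w y ^ 2))
    (hwt : ∀ p ∈ rect h a, wt p = w p.2) (hu : IsSobolevH1 (rect h a) u ux uy)
    (hv : IsSobolevH1 (rect h a) v vx vy) :
    l2norm (rect h a) (fun p => wt p * frob (symPart (gradMat ux uy vx vy p))) ^ 2 =
      wsq (rect h a) (fun y => w y ^ 2) ux +
        1 / 2 * wsq (rect h a) (fun y => w y ^ 2) (fun p => uy p + vx p) +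
        wsq (rect h a) (fun y => w y ^ 2) vy := by
  have i_ux := integrableOn_wsq hw.continuousOn hu.memLp_dx
  have i_shear : IntegrableOn (fun p => 1 / 2 * (w p.2 ^ 2 * (uy p + vx p) ^ 2)) (rect h a) :=
    (integrableOn_wsq hw.continuousOn (hu.memLp_dy.add hv.memLp_dx)).const_mul _
  have i_vy := integrableOn_wsq hw.continuousOn hv.memLp_dy
  simp only [l2norm_sq_eq_setIntegral hwt, frob_symPart_gradMat_sq, mul_add,
    mul_left_comm _ (1 / 2 : ℝ)]
  rw [wsq, wsq, wsq, ← integral_const_mul, ← integral_add i_ux i_shear]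
  exact integral_add (i_ux.add i_shear) i_vy

theorem l2norm_gradMat_sq (hw : IsWeight a (fun y => w y ^ 2))
    (hwt : ∀ p ∈ rect h a, wt p = w p.2) (hu : IsSobolevH1 (rect h a) u ux uy)
    (hv : IsSobolevH1 (rect h a) v vx vy) :
    l2norm (rect h a) (fun p => wt p * frob (gradMat ux uy vx vy p)) ^ 2 =
      wsq (rect h a) (fun y => w y ^ 2) ux + wsq (rect h a) (fun y => w y ^ 2) uy +
        (wsq (rect h a) (fun y => w y ^ 2) vx + wsq (rect h a) (fun y => w y ^ 2) vy) := by
  have i_ux := integrableOn_wsq hw.continuousOn hu.memLp_dx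
  have i_uy := integrableOn_wsq hw.continuousOn hu.memLp_dy
  have i_vx := integrableOn_wsq hw.continuousOn hv.memLp_dx
  have i_vy := integrableOn_wsq hw.continuousOn hv.memLp_dy
  simp only [l2norm_sq_eq_setIntegral hwt, frob_gradMat_sq, mul_add]
  rw [wsq, wsq, wsq, wsq, ← integral_add i_ux i_uy, ← integral_add i_vx i_vy]
  exact integral_add (i_ux.add i_uy) (i_vx.add i_vy)

theorem l2norm_gradMat_sq_le_of_wsq_le (hh : 0 < h) (hC : 0 ≤ C) (hw : ContinuousOn w (Icc 0 a))
    (hwt : ∀ p ∈ rect h a, wt p = w p.2) (hu : IsSobolevH1 (rect h a) u ux uy)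
    (hv : IsSobolevH1 (rect h a) v vx vy)
    (hkorn : wsq (rect h a) (fun y => w y ^ 2) uy ≤
      C * kornBound h a (fun y => w y ^ 2) u ux (fun p => uy p + vx p) vy) :
    l2norm (rect h a) (fun p => wt p * frob (gradMat ux uy vx vy p)) ^ 2 ≤
      (6 * C + 4) * (l2norm (rect h a) (fun p => wt p * u p) *
        l2norm (rect h a) (fun p => wt p * frob (symPart (gradMat ux uy vx vy p))) / h +
        l2norm (rect h a) (fun p => wt p * frob (symPart (gradMat ux uy vx vy p))) ^ 2) := by
  have hV : IsWeight a (fun y => w y ^ 2) := ⟨hw.pow 2, fun _ _ => sq_nonneg _⟩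
  have hgrad := l2norm_gradMat_sq hV hwt hu hv
  have hsym := l2norm_symPart_sq hV hwt hu hv
  have hvx : wsq (rect h a) (fun y => w y ^ 2) vx ≤
      2 * wsq (rect h a) (fun y => w y ^ 2) (fun p => uy p + vx p) +
        2 * wsq (rect h a) (fun y => w y ^ 2) uy :=
    wsq_le_add hV hv.memLp_dx (hu.memLp_dy.add hv.memLp_dx) hu.memLp_dy fun p _ => by
      nlinarith [sq_nonneg ((uy p + vx p) + uy p)]
  rw [hgrad, l2norm_eq_sqrt_wsq hwt u]
  set S := l2norm (rect h a) (fun p => wt p * frob (symPart (gradMat ux uy vx vy p)))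
  set N := √(wsq (rect h a) (fun y => w y ^ 2) u)
  have hS : 0 ≤ S := Real.sqrt_nonneg _
  have hux := wsq_nonneg (h := h) hV ux
  have hshear := wsq_nonneg (h := h) hV (fun p => uy p + vx p)
  have hvy := wsq_nonneg (h := h) hV vy
  have hvyS : √(wsq (rect h a) (fun y => w y ^ 2) vy) ≤ S := by
    rw [Real.sqrt_le_left hS, hsym]
    linarith
  have hbound : kornBound h a (fun y => w y ^ 2) u ux (fun p => uy p + vx p) vy ≤
      N * S / h + 2 * S ^ 2 := by
    have hmixed : N * √(wsq (rect h a) (fun y => w y ^ 2) vy) / h ≤ N * S / h := by gcongr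
    unfold kornBound
    linarith
  have huy := hkorn.trans (mul_le_mul_of_nonneg_left hbound hC)
  have hNS : 0 ≤ N * S / h := by positivity
  have hCNS := mul_nonneg hC hNS
  calc _ ≤ 4 * S ^ 2 + 3 * (C * (N * S / h + 2 * S ^ 2)) := by linarith
    _ ≤ (6 * C + 4) * (N * S / h + S ^ 2) := by linarith

end FullGradient

theorem theorem2p2 (k : ℕ) (β : ℝ) (hβ₀ : 0 ≤ β) (hβ : β < 1 / 2) :
    ∃ C : ℝ, 0 < C ∧
      ∀ (a h : ℝ), 0 < a → 0 < h →
      -- the side `(0,h) × {s}` to which the distance is taken is either horizontal side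
      ∀ s : ℝ, s = 0 ∨ s = a →
      ∀ c α : Fin k → ℝ, (∀ i, 0 ≤ c i) → (∀ i, 0 ≤ α i ∧ α i ≤ β) →
      ∀ u ux uy v vx vy : ℝ × ℝ → ℝ,
        IsSobolevH1 (rect h a) u ux uy → IsSobolevH1 (rect h a) v vx vy →
        (∃ g : ℝ → ℝ, HasTraceOnSide h a 0 u ux uy g ∧ HasTraceOnSide h a a u ux uy g) →
        l2norm (rect h a)
            (fun p => sideWeight h s c α p * frob (gradMat ux uy vx vy p)) ^ 2 ≤
          C * (l2norm (rect h a) (fun p => sideWeight h s c α p * u p) *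
                l2norm (rect h a)
                  (fun p => sideWeight h s c α p * frob (symPart (gradMat ux uy vx vy p))) / h +
              l2norm (rect h a)
                  (fun p => sideWeight h s c α p * frob (symPart (gradMat ux uy vx vy p))) ^ 2) := by
  obtain ⟨C, hC, hkorn⟩ := exists_korn_sobolev hβ
  refine ⟨6 * C + 4, by positivity, ?_⟩
  rintro a h ha hh s hs c α hc hα u ux uy v vx vy hu hv ⟨g, hbot, htop⟩
  have hcont := continuous_powSum (c := c) fun i => (hα i).1
  obtain ⟨d, hd, hside⟩ : ∃ d : ℝ → ℝ, (d = (fun y => y) ∨ d = fun y => a - y) ∧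
      ∀ p ∈ rect h a, sideWeight h s c α p = powSum c α (d p.2) := by
    obtain rfl | rfl := hs
    · exact ⟨fun y => y, Or.inl rfl, fun p hp => sideWeight_zero c α hp⟩
    · exact ⟨fun y => s - y, Or.inr rfl, fun p hp => sideWeight_height c α hp⟩
  have hd_cont : Continuous d := by obtain rfl | rfl := hd <;> fun_prop
  exact l2norm_gradMat_sq_le_of_wsq_le (w := fun y => powSum c α (d y)) hh hC.le
    (hcont.comp hd_cont).continuousOn hside hu hv (hkorn ha hh hd hc hα hu hv hbot htop)
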